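/- Let $d\ge 5$ be an integer. For real $\lambda\ge 0$ such that $\lambda^2$ is a non-negative integer, let $N_\lambda=|\{m\in\mathbb Z^d: |m|=\lambda\}|$, where $|\cdot|$ is the Euclidean norm, and for $f:\mathbb Z^d\to\mathbb R$ and $n\in\mathbb Z^d$ put $$A_\lambda f(n)=N_\lambda^{-1}\sum_{m\in\mathbb Z^d,\ |m|=\lambda} f(n-m),\qquad A_*f(n)=\sup_{\lambda\ge 0,\ \lambda^2\in\mathbb Z}|A_\lambda f(n)|\in[0,\infty].$$ Then there is a constant $C_d<\infty$, depending only on $d$, such that for every $f:\mathbb Z^d\to\mathbb R$ $$\|A_*f\|_2\le C_d\,\|f\|_2,$$ where $\|g\|_2=\bigl(\sum_{n\in\mathbb Z^d}|g(n)|^2\bigr)^{1/2}\in[0,\infty]$ is the $\ell^2(\mathbb Z^d)$ norm. In particular $A_*$ is bounded on $\ell^2(\mathbb Z^d)$. -/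

import Mathlib

open MeasureTheory
open scoped NNReal ENNReal

noncomputable section

/-- The discrete sphere `{m ∈ ℤ^d : |m| = lam}`, where `|·|` is the Euclidean length. -/
def discreteSphere (d : ℕ) (lam : ℝ) : Set (Fin d → ℤ) :=
  {m | √(∑ i, (m i : ℝ) ^ 2) = lam}

theorem discreteSphere_finite (d : ℕ) (lam : ℝ) : (discreteSphere d lam).Finite := by
  refine (Set.finite_Icc (fun _ : Fin d => -⌈lam⌉) (fun _ => ⌈lam⌉)).subset ?_
  intro m hm
  have key : ∀ i, |(m i : ℝ)| ≤ lam := fun i => by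
    rw [← show √(∑ i, (m i : ℝ) ^ 2) = lam from hm]
    exact Real.abs_le_sqrt
      (Finset.single_le_sum (f := fun i => (m i : ℝ) ^ 2) (fun j _ => sq_nonneg _)
        (Finset.mem_univ i))
  refine ⟨fun i => ?_, fun i => ?_⟩
  · have h := (abs_le.1 (key i)).1
    have h2 := Int.le_ceil lam
    have : ((-⌈lam⌉ : ℤ) : ℝ) ≤ m i := by push_cast; linarith
    exact_mod_cast this
  · have h := (abs_le.1 (key i)).2.trans (Int.le_ceil lam)
    exact_mod_cast h

/-- The points of the discrete sphere as a finite set. -/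
def discreteSphereFinset (d : ℕ) (lam : ℝ) : Finset (Fin d → ℤ) :=
  (discreteSphere_finite d lam).toFinset

/-- The discrete spherical average
`A_lam f (n) = N_lam⁻¹ ∑_{|m| = lam} f (n - m)`, `N_lam` being the number of lattice points `m`
with `|m| = lam`. -/
def sphericalAverage {d : ℕ} (lam : ℝ) (f : (Fin d → ℤ) → ℝ) (n : Fin d → ℤ) : ℝ :=
  ((discreteSphereFinset d lam).card : ℝ)⁻¹ * ∑ m ∈ discreteSphereFinset d lam, f (n - m)

/-- The admissible radii: `lam ≥ 0` such that `lam ^ 2` is a natural number. -/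
def admissibleRadii : Set ℝ :=
  {lam | 0 ≤ lam ∧ ∃ k : ℕ, lam ^ 2 = k}

/-- The discrete spherical maximal function `A_* f (n) = sup_lam |A_lam f (n)|`, with values in
`[0, ∞]`, so that the supremum always exists. -/
def sphericalMaximal {d : ℕ} (f : (Fin d → ℤ) → ℝ) (n : Fin d → ℤ) : ℝ≥0∞ :=
  ⨆ lam ∈ admissibleRadii, ENNReal.ofReal |sphericalAverage lam f n|

end

/-!
The circle method of Magyar, Stein and Wainger. The indicator of the sphere of radius `√n` is the
`n`-th Fourier coefficient in `t` of the Gaussian kernel `S^(-d/2) e((t + i / S) |m|²)`, up to a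
factor comparable to `S^(-d/2)` when `S ≤ n ≤ 4 S`. By Dirichlet's theorem every `t` has the form
`a / q + u / S` with `q² max(1, u²) ≤ S`, so all sums over spheres are dominated at once by the
integral, over all triples `(a, q, u)`, of the maximal function in `S = 4^j` of the convolutions
with these kernels.

For a fixed triple, Poisson summation shows that the multiplier of the kernel is, up to an error,
the product of a Gauss sum factor bounded by a multiple of `(q |1 - i u|)^(-d / 2)`, which does not
depend on `S`, and the multiplier of a Gaussian kernel on the lattice `q ℤ^d`. The latter kernels
have a bounded maximal function, by a `T T*` argument, and the errors have a bounded square function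
in `j`. The resulting bound is integrable over all triples exactly because `d ≥ 5`, and Minkowski's
inequality gives an `ℓ²` bound for the sums over spheres, still to be divided by their cardinality.

The number of lattice points on the sphere of radius `√n` is bounded below by a multiple of
`n^(d/2 - 1)`, again by the circle method: the arcs of small height around the fractions of
denominator `Q = M!` contribute a product of the density of solutions of `|m|² = n` modulo `Q`,
which is at least `1 / 16`, and the singular integral, while the other arcs are negligible by the
integrability above.
-/

noncomputable section

open Complex (I)
open scoped Real

/-! ### Quadratic Gauss sums -/

section GaussSum

variable {q : ℕ} [NeZero q]

/-- The quadratic Gauss sum `G(a, n; q) = ∑ x mod q, e((a x² + n x) / q)`, the arithmetic factor of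
the theta series near the rational number `a / q`. -/
def quadGaussSum (q : ℕ) [NeZero q] (a n : ZMod q) : ℂ :=
  ∑ x : ZMod q, ZMod.stdAddChar (a * x ^ 2 + n * x)

theorem quadGaussSum_one (a n : ZMod 1) : quadGaussSum 1 a n = 1 := by
  simp [quadGaussSum, Subsingleton.elim a 0, Subsingleton.elim n 0]

theorem norm_quadGaussSum_le (a n : ZMod q) : ‖quadGaussSum q a n‖ ≤ q :=
  (norm_sum_le _ _).trans (by simp [ZMod.stdAddChar_apply, Circle.norm_coe, ZMod.card])

theorem card_natCast_mul_eq_zero_le (c : ℕ) :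
    (Finset.univ.filter fun h : ZMod q => (c : ZMod q) * h = 0).card ≤ c.gcd q := by
  refine (Finset.card_le_card fun h hh => ?_).trans
    (IsAddCyclic.card_nsmul_eq_zero_le (Nat.gcd_pos_of_pos_right c (NeZero.pos q)))
  simp only [Finset.mem_filter, Finset.mem_univ, true_and] at hh ⊢
  rw [nsmul_eq_mul, ← Int.cast_natCast, Nat.gcd_eq_gcd_ab]
  push_cast
  rw [ZMod.natCast_self, zero_mul, add_zero, mul_right_comm, hh, zero_mul]

-- Substituting `x = y + h` in `∑ x, ∑ y, e((a (x² - y²) + n (x - y)) / q)` makes `y` linear.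
theorem quadGaussSum_mul_conj (a n : ZMod q) :
    quadGaussSum q a n * (starRingEnd ℂ) (quadGaussSum q a n) =
      ∑ h : ZMod q, ZMod.stdAddChar (a * h ^ 2 + n * h) * if 2 * a * h = 0 then (q : ℂ) else 0 := by
  have shift (y : ZMod q) :
      ∑ x : ZMod q, (ZMod.stdAddChar (a * x ^ 2 + n * x) : ℂ) *
        (starRingEnd ℂ) (ZMod.stdAddChar (a * y ^ 2 + n * y)) =
      ∑ h : ZMod q, ZMod.stdAddChar (a * h ^ 2 + n * h) * ZMod.stdAddChar (y * (2 * a * h)) := by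
    rw [← Equiv.sum_comp (Equiv.addRight y)]
    refine Finset.sum_congr rfl fun h _ => ?_
    rw [← AddChar.map_neg_eq_conj, ← AddChar.map_add_eq_mul, ← AddChar.map_add_eq_mul,
      Equiv.coe_addRight]
    congr 1
    ring
  rw [quadGaussSum, map_sum, Finset.sum_mul_sum, Finset.sum_comm, Finset.sum_congr rfl
    fun y _ => shift y, Finset.sum_comm]
  refine Finset.sum_congr rfl fun h _ => ?_
  rw [← Finset.mul_sum, AddChar.sum_mulShift _ (ZMod.isPrimitive_stdAddChar q), ZMod.card]
  split_ifs <;> simp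

theorem norm_quadGaussSum_sq_le (a n : ZMod q) :
    ‖quadGaussSum q a n‖ ^ 2 ≤
      q * (Finset.univ.filter fun h : ZMod q => 2 * a * h = 0).card := by
  have norm_sq : ‖quadGaussSum q a n‖ ^ 2 =
      ‖quadGaussSum q a n * (starRingEnd ℂ) (quadGaussSum q a n)‖ := by
    rw [norm_mul, RCLike.norm_conj, sq]
  rw [norm_sq, quadGaussSum_mul_conj]
  calc _ ≤ ∑ h : ZMod q, (if 2 * a * h = 0 then (q : ℝ) else 0) := by
        refine (norm_sum_le _ _).trans (Finset.sum_le_sum fun h _ => ?_)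
        rw [norm_mul, ZMod.stdAddChar_apply, Circle.norm_coe, one_mul]
        split_ifs <;> simp
    _ = _ := by rw [← Finset.sum_filter, Finset.sum_const, nsmul_eq_mul, mul_comm]

theorem norm_quadGaussSum_natCast_sq_le (a : ℕ) (n : ZMod q) :
    ‖quadGaussSum q a n‖ ^ 2 ≤ q * ((2 * a).gcd q : ℕ) := by
  refine (norm_quadGaussSum_sq_le _ n).trans ?_
  gcongr
  simpa only [Nat.cast_mul, Nat.cast_ofNat] using card_natCast_mul_eq_zero_le (q := q) (2 * a)

theorem norm_quadGaussSum_le_sqrt {a : ZMod q} (ha : IsUnit a) (n : ZMod q) :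
    ‖quadGaussSum q a n‖ ≤ √(2 * q) := by
  refine Real.le_sqrt_of_sq_le ((norm_quadGaussSum_sq_le a n).trans ?_)
  have cancel (h : ZMod q) : 2 * a * h = 0 ↔ ((2 : ℕ) : ZMod q) * h = 0 := by
    rw [mul_right_comm, ha.mul_left_eq_zero, Nat.cast_ofNat]
  simp only [cancel, mul_comm (2 : ℝ)]
  gcongr
  exact_mod_cast (card_natCast_mul_eq_zero_le 2).trans (Nat.gcd_le_left q two_pos)

theorem norm_quadGaussSum_le_sqrt_of_isCoprime {a : ℤ} (ha : IsCoprime a (q : ℤ)) (n : ZMod q) :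
    ‖quadGaussSum q a n‖ ≤ √(2 * q) :=
  norm_quadGaussSum_le_sqrt ((ZMod.coe_int_isUnit_iff_isCoprime a q).2 ha.symm) n

end GaussSum

/-! ### Gaussian sums over the integers -/

/-- The sum of the inverse squares of the nonzero integers (the term `n = 0` is `1 / 0 = 0`). -/
def intInvSqSum : ℝ := ∑' n : ℤ, 1 / (n : ℝ) ^ 2

theorem intInvSqSum_nonneg : 0 ≤ intInvSqSum := tsum_nonneg fun n => by positivity

theorem hasSum_one_div_sub_sq (N : ℤ) :
    HasSum (fun n : ℤ => 1 / ((n - N : ℤ) : ℝ) ^ 2) intInvSqSum :=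
  (Equiv.hasSum_iff (f := fun n : ℤ => 1 / (n : ℝ) ^ 2) (Equiv.subRight N)).2
    (Real.summable_one_div_int_pow.2 one_lt_two).hasSum

section QuadraticDecay

variable {E : Type*} [NormedAddCommGroup E] [CompleteSpace E] {F : ℤ → E} {b : ℝ} {N : ℤ}

theorem summable_of_quadratic_decay
    (hF : ∀ n, n ≠ N → ‖F n‖ ≤ b * (1 / ((n - N : ℤ) : ℝ) ^ 2)) : Summable F := by
  refine Summable.of_norm_bounded_eventually ((hasSum_one_div_sub_sq N).summable.mul_left b) ?_
  filter_upwards [(Set.finite_singleton N).compl_mem_cofinite] with n hn using hF n hn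

theorem norm_tsum_sub_le_of_quadratic_decay (hb : 0 ≤ b)
    (hF : ∀ n, n ≠ N → ‖F n‖ ≤ b * (1 / ((n - N : ℤ) : ℝ) ^ 2)) :
    ‖∑' n, F n - F N‖ ≤ b * intInvSqSum := by
  rw [(summable_of_quadratic_decay hF).tsum_eq_add_tsum_ite N, add_sub_cancel_left]
  refine tsum_of_norm_bounded ((hasSum_one_div_sub_sq N).mul_left b) fun n => ?_
  split_ifs with h
  · rw [norm_zero]
    positivity
  · exact hF n h

end QuadraticDecay

theorem half_abs_sub_round_le {n : ℤ} {y : ℝ} (hn : n ≠ round y) :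
    |((n - round y : ℤ) : ℝ)| / 2 ≤ |n - y| := by
  have one_le : (1 : ℝ) ≤ |((n - round y : ℤ) : ℝ)| := by
    exact_mod_cast Int.one_le_abs (sub_ne_zero.2 hn)
  have triangle : |((n - round y : ℤ) : ℝ)| ≤ |n - y| + |y - round y| := by
    push_cast
    exact abs_sub_le _ _ _
  linarith [abs_sub_round y]

theorem exp_neg_le_one_div {y : ℝ} (hy : 0 < y) : Real.exp (-y) ≤ 1 / y := by
  rw [Real.exp_neg, ← one_div]
  exact one_div_le_one_div_of_le hy (by linarith [Real.add_one_le_exp y])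

theorem norm_exp_neg_mul_ofReal_sq (w : ℂ) (z : ℝ) :
    ‖Complex.exp (-w * (z : ℂ) ^ 2)‖ = Real.exp (-(w.re * z ^ 2)) := by
  rw [Complex.norm_exp]
  congr 1
  rw [← Complex.ofReal_pow, mul_comm, Complex.re_ofReal_mul, Complex.neg_re]
  ring

theorem norm_gaussian_le {w : ℂ} (hw : 0 < w.re) {y : ℝ} {n : ℤ} (hn : n ≠ round y) :
    ‖Complex.exp (-w * (n - y) ^ 2)‖ ≤ 4 / w.re * (1 / ((n - round y : ℤ) : ℝ) ^ 2) := by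
  have abs_pos : (0 : ℝ) < |((n - round y : ℤ) : ℝ)| :=
    _root_.abs_pos.2 (by exact_mod_cast sub_ne_zero.2 hn)
  have sq_le : ((n - round y : ℤ) : ℝ) ^ 2 / 4 ≤ (n - y) ^ 2 := by
    rw [← sq_abs, ← sq_abs ((n : ℝ) - y)]
    nlinarith [half_abs_sub_round_le hn, abs_nonneg ((n : ℝ) - y)]
  have sq_pos : 0 < ((n - round y : ℤ) : ℝ) ^ 2 := by
    rw [← sq_abs]
    positivity
  have norm_eq : ‖Complex.exp (-w * ((n : ℂ) - y) ^ 2)‖ = Real.exp (-(w.re * (n - y) ^ 2)) := by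
    rw [← norm_exp_neg_mul_ofReal_sq, Complex.ofReal_sub, Complex.ofReal_intCast]
  calc _ ≤ 1 / (w.re * (n - y) ^ 2) :=
        norm_eq.trans_le (exp_neg_le_one_div (mul_pos hw (by linarith)))
    _ ≤ 1 / (w.re * (((n - round y : ℤ) : ℝ) ^ 2 / 4)) := by gcongr
    _ = _ := by field_simp

section GaussianSum

variable {g : ℤ → ℂ} {b : ℝ} {w : ℂ}

theorem norm_mul_gaussian_le (hg : ∀ n, ‖g n‖ ≤ b) (hw : 0 < w.re) {y : ℝ} {n : ℤ}
    (hn : n ≠ round y) :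
    ‖g n * Complex.exp (-w * (n - y) ^ 2)‖ ≤
      b * (4 / w.re) * (1 / ((n - round y : ℤ) : ℝ) ^ 2) := by
  rw [norm_mul, mul_assoc]
  exact mul_le_mul (hg n) (norm_gaussian_le hw hn) (norm_nonneg _) ((norm_nonneg _).trans (hg n))

theorem summable_mul_gaussian (hg : ∀ n, ‖g n‖ ≤ b) (hw : 0 < w.re) (y : ℝ) :
    Summable fun n : ℤ => g n * Complex.exp (-w * (n - y) ^ 2) :=
  summable_of_quadratic_decay fun _ => norm_mul_gaussian_le hg hw

theorem norm_tsum_mul_gaussian_sub_le (hg : ∀ n, ‖g n‖ ≤ b) (hw : 0 < w.re) (y : ℝ) :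
    ‖∑' n : ℤ, g n * Complex.exp (-w * (n - y) ^ 2) -
      g (round y) * Complex.exp (-w * (round y - y) ^ 2)‖ ≤ b * (4 / w.re) * intInvSqSum :=
  norm_tsum_sub_le_of_quadratic_decay
    (mul_nonneg ((norm_nonneg _).trans (hg 0)) (by positivity))
    (F := fun n : ℤ => g n * Complex.exp (-w * (n - y) ^ 2)) fun _ => norm_mul_gaussian_le hg hw

end GaussianSum

theorem summable_exp_neg_mul_int_sq {c : ℝ} (hc : 0 < c) :
    Summable fun m : ℤ => Real.exp (-(c * m ^ 2)) := by
  refine (summable_mul_gaussian (g := fun _ => 1) (b := 1) (by simp) (w := c)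
    (by simpa using hc) 0).norm.congr fun m => ?_
  rw [one_mul, ← Complex.ofReal_intCast, ← Complex.ofReal_sub, norm_exp_neg_mul_ofReal_sq,
    sub_zero, Complex.ofReal_re]

/-! ### The theta multiplier -/

/-- The one-dimensional kernel `S^{-1/2} e((t + i / S) m²)`. -/
def thetaKernel (S t : ℝ) (m : ℤ) : ℂ :=
  ((√S)⁻¹ : ℝ) * Complex.exp (2 * π * I * m ^ 2 * (t + I / S))

/-- The Fourier multiplier of `thetaKernel`. -/
def thetaMultiplier (S t x : ℝ) : ℂ :=
  ∑' m : ℤ, thetaKernel S t m * Complex.exp (2 * π * I * m * x)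

/-- The factor `(2 (1 - i u))^{-1/2}` produced by Poisson summation at `a / q + u / S`. -/
def thetaFactor (u : ℝ) : ℂ := ((2 * (1 - u * I)) ^ (1 / 2 : ℂ))⁻¹

/-- After Poisson summation at `a / q + u / S`, the theta multiplier is a sum of Gaussians with
exponent `gaussScale S q / (1 - i u)`. -/
def gaussScale (S : ℝ) (q : ℕ) : ℝ := π * S / (2 * q ^ 2)

theorem gaussScale_pos {S : ℝ} (hS : 0 < S) (q : ℕ) [NeZero q] : 0 < gaussScale S q := by
  have : (0 : ℝ) < q := Nat.cast_pos.2 (NeZero.pos q)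
  rw [gaussScale]
  positivity

theorem norm_one_sub_mul_I (u : ℝ) : ‖(1 - u * I : ℂ)‖ = √(1 + u ^ 2) := by
  have h := Complex.norm_add_mul_I 1 (-u)
  rwa [one_pow, neg_sq, Complex.ofReal_one, Complex.ofReal_neg, neg_mul, ← sub_eq_add_neg] at h

theorem one_sub_mul_I_ne_zero (u : ℝ) : (1 - u * I : ℂ) ≠ 0 := by
  rw [← norm_ne_zero_iff, norm_one_sub_mul_I]
  positivity

theorem re_div_one_sub_mul_I (c u : ℝ) : ((c : ℂ) / (1 - u * I)).re = c / (1 + u ^ 2) := by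
  rw [Complex.div_re]
  simp [Complex.normSq_apply]
  ring

theorem re_gaussScale_div_pos {S : ℝ} (hS : 0 < S) (q : ℕ) [NeZero q] (u : ℝ) :
    0 < ((gaussScale S q : ℂ) / (1 - u * I)).re := by
  rw [re_div_one_sub_mul_I]
  exact div_pos (gaussScale_pos hS q) (by positivity)

theorem norm_thetaFactor_sq (u : ℝ) : ‖thetaFactor u‖ ^ 2 = (2 * √(1 + u ^ 2))⁻¹ := by
  rw [thetaFactor, norm_inv, inv_pow, ← norm_pow, ← Complex.cpow_nat_mul]
  norm_num [norm_one_sub_mul_I]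

theorem thetaFactor_pow (u : ℝ) (d : ℕ) :
    thetaFactor u ^ d = ((2 * (1 - u * I)) ^ (d / 2 : ℂ))⁻¹ := by
  rw [thetaFactor, inv_pow, ← Complex.cpow_nat_mul]
  congr 2
  ring

theorem norm_exp_two_pi_I_mul (m : ℤ) (x : ℝ) : ‖Complex.exp (2 * π * I * m * x)‖ = 1 := by
  rw [← Complex.norm_exp_ofReal_mul_I (2 * π * m * x)]
  congr 2
  push_cast
  ring

theorem norm_thetaKernel (S t : ℝ) (m : ℤ) :
    ‖thetaKernel S t m‖ = (√S)⁻¹ * Real.exp (-(2 * π * m ^ 2 / S)) := by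
  have re_im : (2 * π * I * (m : ℂ) ^ 2 * (t + I / S)) =
      ((-(2 * π * m ^ 2 / S) : ℝ) : ℂ) + ((2 * π * m ^ 2 * t : ℝ) : ℂ) * I := by
    push_cast
    linear_combination (2 * π * (m : ℂ) ^ 2 / S) * Complex.I_sq
  rw [thetaKernel, norm_mul, Complex.norm_real, Real.norm_of_nonneg (by positivity),
    re_im, Complex.exp_add, norm_mul, Complex.norm_exp_ofReal_mul_I, mul_one, Complex.norm_exp,
    Complex.ofReal_re]

theorem summable_norm_thetaKernel {S : ℝ} (hS : 0 < S) (t : ℝ) :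
    Summable fun m => ‖thetaKernel S t m‖ := by
  simp_rw [norm_thetaKernel]
  refine Summable.mul_left _ ?_
  refine (summable_exp_neg_mul_int_sq (c := 2 * π / S) (by positivity)).congr fun m => ?_
  rw [div_mul_eq_mul_div]

theorem summable_thetaMultiplier {S : ℝ} (hS : 0 < S) (t x : ℝ) :
    Summable fun m : ℤ => thetaKernel S t m * Complex.exp (2 * π * I * m * x) := by
  refine Summable.of_norm ((summable_norm_thetaKernel hS t).congr fun m => ?_)
  rw [norm_mul, norm_exp_two_pi_I_mul, mul_one]

/-! ### Poisson summation at a rational point -/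

theorem tsum_int_eq_sum_zmod {E : Type*} [NormedAddCommGroup E] [CompleteSpace E] {F : ℤ → E}
    (hF : Summable F) (q : ℕ) [NeZero q] :
    ∑' m, F m = ∑ x : ZMod q, ∑' k : ℤ, F (q * k + x.val) := by
  have val_symm (x : ZMod q) : (((ZMod.finEquiv q).symm x : Fin q) : ℕ) = x.val := by
    obtain ⟨n, rfl⟩ := Nat.exists_eq_succ_of_ne_zero (NeZero.ne q)
    rfl
  let e : Fin q × ℤ ≃ ℤ := (Equiv.prodComm _ _).trans (Int.divModEquiv q).symm
  rw [← e.tsum_eq F, Summable.tsum_prod (f := fun p => F (e p)) (e.summable_iff.2 hF),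
    tsum_fintype]
  refine Fintype.sum_equiv (ZMod.finEquiv q).toEquiv _ _ fun r => tsum_congr fun k => ?_
  have val_eq := val_symm (ZMod.finEquiv q r)
  rw [RingEquiv.symm_apply_apply] at val_eq
  change F ((Int.divModEquiv q).symm (k, r)) = F (q * k + (ZMod.finEquiv q r).val)
  rw [Int.divModEquiv_symm_apply, ← val_eq, mul_comm, add_comm]

theorem tsum_exp_neg_quadratic_shift {A : ℂ} (hA : 0 < A.re) (β y : ℂ) :
    ∑' k : ℤ, Complex.exp (-π * A * (k + β) ^ 2 + 2 * π * I * (k + β) * y) =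
      (A ^ (1 / 2 : ℂ))⁻¹ *
        ∑' n : ℤ, Complex.exp (2 * π * I * n * β) * Complex.exp (-π / A * (n - y) ^ 2) := by
  have hA0 : A ≠ 0 := fun h => by simp [h] at hA
  have left (k : ℤ) : Complex.exp (-π * A * (k + β) ^ 2 + 2 * π * I * (k + β) * y) =
      Complex.exp (-π * A * β ^ 2 + 2 * π * I * β * y) *
        Complex.exp (-π * A * (k : ℂ) ^ 2 + 2 * π * (-A * β + I * y) * k) := by
    rw [← Complex.exp_add]
    congr 1
    ring
  have right (n : ℤ) :
      Complex.exp (-π * A * β ^ 2 + 2 * π * I * β * y) *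
        Complex.exp (-π / A * (n + I * (-A * β + I * y)) ^ 2) =
      Complex.exp (2 * π * I * n * β) * Complex.exp (-π / A * (n - y) ^ 2) := by
    have complete : (n : ℂ) + I * (-A * β + I * y) = (n - y) - I * A * β := by
      linear_combination y * Complex.I_sq
    rw [complete, ← Complex.exp_add, ← Complex.exp_add]
    congr 1
    field_simp
    linear_combination (-(A ^ 2 * β ^ 2)) * Complex.I_sq
  rw [tsum_congr left, tsum_mul_left, Complex.tsum_exp_neg_quadratic hA, one_div,
    mul_left_comm, ← tsum_mul_left, tsum_congr right]

theorem ofReal_mul_cpow {c : ℝ} (hc : 0 < c) (z : ℂ) (a : ℝ) :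
    ((c : ℂ) * z) ^ (a : ℂ) = (c ^ a : ℝ) * z ^ (a : ℂ) := by
  rcases eq_or_ne z 0 with rfl | hz
  · rcases eq_or_ne a 0 with rfl | ha
    · simp
    · simp [ha]
  rw [Complex.cpow_def_of_ne_zero (mul_ne_zero (Complex.ofReal_ne_zero.2 hc.ne') hz),
    Complex.log_ofReal_mul hc hz, add_mul, Complex.exp_add, ← Complex.cpow_def_of_ne_zero hz,
    ← Complex.ofReal_mul, ← Complex.ofReal_exp, ← Real.rpow_def_of_pos hc]

theorem ofReal_mul_cpow_half {c : ℝ} (hc : 0 < c) (z : ℂ) :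
    ((c : ℂ) * z) ^ (1 / 2 : ℂ) = √c * z ^ (1 / 2 : ℂ) := by
  simpa [Real.sqrt_eq_rpow] using ofReal_mul_cpow hc z (1 / 2)

section Poisson

variable {S : ℝ} {q : ℕ} [NeZero q]

-- The integer part of `(a / q) * (q k + r)²` disappears, and what remains is a shifted Gaussian.
theorem thetaKernel_mul_exp_residue (hS : 0 < S) (a r k : ℤ) (u x : ℝ) :
    thetaKernel S (a / q + u / S) (q * k + r) *
        Complex.exp (2 * π * I * ((q * k + r : ℤ) : ℂ) * x) =
      ((√S)⁻¹ : ℝ) * Complex.exp (2 * π * I * (a * r ^ 2 : ℤ) / q) *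
        Complex.exp (-π * ((q ^ 2 / S : ℝ) * (2 * (1 - u * I))) * (k + r / q) ^ 2 +
          2 * π * I * (k + r / q) * (q * x : ℝ)) := by
  have hq : (q : ℂ) ≠ 0 := NeZero.ne _
  have hS' : (S : ℂ) ≠ 0 := Complex.ofReal_ne_zero.2 hS.ne'
  rw [thetaKernel, mul_assoc _ (Complex.exp _), mul_assoc _ (Complex.exp _),
    ← Complex.exp_add, ← Complex.exp_add]
  congr 1
  rw [Complex.exp_eq_exp_iff_exists_int]
  refine ⟨a * (q * k ^ 2 + 2 * k * r), ?_⟩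
  push_cast
  field_simp
  linear_combination ((q * k + r) ^ 2 * q) * Complex.I_sq

theorem tsum_thetaKernel_residue (hS : 0 < S) (a : ℤ) (u x : ℝ) (y : ZMod q) :
    ∑' k : ℤ, thetaKernel S (a / q + u / S) (q * k + y.val) *
        Complex.exp (2 * π * I * ((q * k + y.val : ℤ) : ℂ) * x) =
      thetaFactor u / q * ∑' n : ℤ, ZMod.stdAddChar ((a : ZMod q) * y ^ 2 + (n : ZMod q) * y) *
        Complex.exp (-(gaussScale S q / (1 - u * I)) * (n - (q * x : ℝ)) ^ 2) := by
  have hq : (0 : ℝ) < q := Nat.cast_pos.2 (NeZero.pos q)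
  have hqC : (q : ℂ) ≠ 0 := NeZero.ne _
  have hS' : (S : ℂ) ≠ 0 := Complex.ofReal_ne_zero.2 hS.ne'
  have hu := one_sub_mul_I_ne_zero u
  have re_pos : 0 < (((q ^ 2 / S : ℝ) : ℂ) * (2 * (1 - u * I))).re := by
    rw [Complex.re_ofReal_mul]
    simpa using div_pos (by positivity) hS
  have root : (((q ^ 2 / S : ℝ) : ℂ) * (2 * (1 - u * I))) ^ (1 / 2 : ℂ) =
      ((q / √S : ℝ) : ℂ) * (2 * (1 - u * I)) ^ (1 / 2 : ℂ) := by
    rw [ofReal_mul_cpow_half (by positivity), Real.sqrt_div (by positivity), Real.sqrt_sq hq.le]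
  have exponent : -(π : ℂ) / ((q ^ 2 / S : ℝ) * (2 * (1 - u * I))) =
      -(gaussScale S q / (1 - u * I)) := by
    rw [gaussScale]
    push_cast
    field_simp
  have char (n : ℤ) : (ZMod.stdAddChar ((a : ZMod q) * y ^ 2 + (n : ZMod q) * y) : ℂ) =
      Complex.exp (2 * π * I * (a * (y.val : ℤ) ^ 2 : ℤ) / q) *
        Complex.exp (2 * π * I * n * ((y.val : ℤ) / q)) := by
    have assoc : 2 * π * I * n * (((y.val : ℤ) : ℂ) / q) =
        2 * π * I * (n * (y.val : ℤ) : ℤ) / q := by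
      push_cast
      ring
    rw [assoc, ← ZMod.stdAddChar_coe, ← ZMod.stdAddChar_coe, ← AddChar.map_add_eq_mul]
    simp
  have sqrt_ne : ((√S : ℝ) : ℂ) ≠ 0 := Complex.ofReal_ne_zero.2 (Real.sqrt_pos.2 hS).ne'
  rw [tsum_congr fun k => thetaKernel_mul_exp_residue hS a _ k u x, tsum_mul_left,
    tsum_exp_neg_quadratic_shift re_pos, root, exponent, thetaFactor, ← tsum_mul_left,
    ← tsum_mul_left, ← tsum_mul_left]
  refine tsum_congr fun n => ?_
  rw [char]
  push_cast
  field_simp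

theorem thetaMultiplier_eq (hS : 0 < S) (a : ℤ) (u x : ℝ) :
    thetaMultiplier S (a / q + u / S) x = thetaFactor u / q *
      ∑' n : ℤ, quadGaussSum q a n *
        Complex.exp (-(gaussScale S q / (1 - u * I)) * (n - (q * x : ℝ)) ^ 2) := by
  rw [thetaMultiplier, tsum_int_eq_sum_zmod (summable_thetaMultiplier hS _ x) q,
    Finset.sum_congr rfl fun y _ => tsum_thetaKernel_residue hS a u x y, ← Finset.mul_sum,
    ← Summable.tsum_finsetSum]
  · simp only [quadGaussSum, Finset.sum_mul]
  · refine fun y _ => summable_mul_gaussian (b := 1) (fun n => ?_) (re_gaussScale_div_pos hS q u) _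
    rw [ZMod.stdAddChar_apply, Circle.norm_coe]

theorem norm_thetaMultiplier_sub_le (hS : 0 < S) (a : ℤ) (u x : ℝ) {b : ℝ}
    (hb : ∀ n : ZMod q, ‖quadGaussSum q a n‖ ≤ b) :
    ‖thetaMultiplier S (a / q + u / S) x - thetaFactor u / q *
        (quadGaussSum q a (round (q * x) : ℤ) *
          Complex.exp (-(gaussScale S q / (1 - u * I)) * (round (q * x) - (q * x : ℝ)) ^ 2))‖ ≤
      ‖thetaFactor u‖ / q * (b * (4 / (gaussScale S q / (1 + u ^ 2))) * intInvSqSum) := by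
  rw [thetaMultiplier_eq hS, ← mul_sub, norm_mul, norm_div, Complex.norm_natCast,
    ← re_div_one_sub_mul_I]
  gcongr
  exact norm_tsum_mul_gaussian_sub_le (fun n => hb n) (re_gaussScale_div_pos hS q u) (q * x)

end Poisson

/-! ### Sums of products and bounds for positive kernels -/

section ProdFin

variable {α : Type*}

theorem prod_consEquiv {M : Type*} [CommMonoid M] {d : ℕ} (f : Fin (d + 1) → α → M)
    (p : α × (Fin d → α)) :
    ∏ i, f i (Fin.consEquiv (fun _ => α) p i) = f 0 p.1 * ∏ i : Fin d, f i.succ (p.2 i) := by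
  rw [Fin.prod_univ_succ]
  simp [Fin.consEquiv]

variable {d : ℕ}

theorem summable_norm_prod_fin {f : Fin d → α → ℂ} (hf : ∀ i, Summable fun k => ‖f i k‖) :
    Summable fun m : Fin d → α => ‖∏ i, f i (m i)‖ := by
  induction d with
  | zero => exact (hasSum_unique _).summable
  | succ n ih =>
    rw [← (Fin.consEquiv fun _ => α).summable_iff]
    exact ((hf 0).mul_norm (ih fun i => hf i.succ)).congr fun p =>
      (congrArg norm (prod_consEquiv f p)).symm

theorem tsum_prod_fin {f : Fin d → α → ℂ} (hf : ∀ i, Summable fun k => ‖f i k‖) :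
    ∑' m : Fin d → α, ∏ i, f i (m i) = ∏ i, ∑' k, f i k := by
  induction d with
  | zero => simp
  | succ n ih =>
    rw [Fin.prod_univ_succ, ← ih fun i => hf i.succ, tsum_mul_tsum_of_summable_norm (hf 0)
      (summable_norm_prod_fin fun i => hf i.succ), ← (Fin.consEquiv fun _ => α).tsum_eq]
    exact tsum_congr fun p => prod_consEquiv f p

theorem ennreal_tsum_prod_fin (f : Fin d → α → ℝ≥0∞) :
    ∑' m : Fin d → α, ∏ i, f i (m i) = ∏ i, ∑' k, f i k := by
  induction d with
  | zero => simp
  | succ n ih =>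
    rw [Fin.prod_univ_succ, ← ih, ← ENNReal.tsum_mul_right,
      ← (Fin.consEquiv fun _ => α).tsum_eq, ENNReal.tsum_prod']
    refine tsum_congr fun k => ?_
    rw [← ENNReal.tsum_mul_left]
    exact tsum_congr fun m => prod_consEquiv f (k, m)

end ProdFin

theorem ennreal_lintegral_mul_sq_le {α : Type*} [MeasurableSpace α] (μ : Measure α)
    {f g : α → ℝ≥0∞} (hf : AEMeasurable f μ) (hg : AEMeasurable g μ) :
    (∫⁻ x, f x * g x ∂μ) ^ 2 ≤ (∫⁻ x, f x ^ 2 ∂μ) * ∫⁻ x, g x ^ 2 ∂μ := by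
  calc _ ≤ ((∫⁻ a, f a ^ (2 : ℝ) ∂μ) ^ (1 / (2 : ℝ)) *
        (∫⁻ a, g a ^ (2 : ℝ) ∂μ) ^ (1 / (2 : ℝ))) ^ 2 := by
        gcongr
        exact ENNReal.lintegral_mul_le_Lp_mul_Lq μ Real.HolderConjugate.two_two hf hg
    _ = _ := by
      rw [mul_pow, ← ENNReal.rpow_natCast, ← ENNReal.rpow_natCast, ← ENNReal.rpow_mul,
        ← ENNReal.rpow_mul]
      norm_num

theorem ennreal_tsum_mul_sq_le {α : Type*} (f g : α → ℝ≥0∞) :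
    (∑' x, f x * g x) ^ 2 ≤ (∑' x, f x ^ 2) * ∑' x, g x ^ 2 := by
  let _ : MeasurableSpace α := ⊤
  simpa only [lintegral_count] using ennreal_lintegral_mul_sq_le Measure.count
    (measurable_from_top (f := f)).aemeasurable (measurable_from_top (f := g)).aemeasurable

theorem ennreal_sum_mul_sq_le {α : Type*} (s : Finset α) (f g : α → ℝ≥0∞) :
    (∑ x ∈ s, f x * g x) ^ 2 ≤ (∑ x ∈ s, f x ^ 2) * ∑ x ∈ s, g x ^ 2 := by
  simpa only [← Finset.tsum_subtype s] using
    ennreal_tsum_mul_sq_le (fun x : s => f x) fun x : s => g x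

theorem ennreal_tsum_mul_ne_top {α : Type*} {f g : α → ℝ≥0∞} (hf : ∑' x, f x ^ 2 ≠ ∞)
    (hg : ∑' x, g x ^ 2 ≠ ∞) : ∑' x, f x * g x ≠ ∞ := fun h => by
  have cauchy_schwarz := ennreal_tsum_mul_sq_le f g
  rw [h, ENNReal.top_pow two_ne_zero, top_le_iff] at cauchy_schwarz
  exact ENNReal.mul_ne_top hf hg cauchy_schwarz

theorem ennreal_le_of_sq_le_mul {V A : ℝ≥0∞} (hV : V ≠ ∞) (h : V ^ 2 ≤ A * V) : V ≤ A := by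
  rcases eq_or_ne V 0 with h0 | h0
  · simp [h0]
  · rw [sq] at h
    exact (ENNReal.mul_le_mul_iff_left h0 hV).1 h

section PositiveKernel

variable {X : Type*} {k : X → X → ℝ≥0∞} {C : ℝ≥0∞}

theorem tsum_sum_mul_sq (k : X → X → ℝ≥0∞) (s : Finset X) (h : X → ℝ≥0∞) :
    ∑' y, (∑ x ∈ s, k x y * h x) ^ 2 =
      ∑ x ∈ s, ∑ x' ∈ s, h x * h x' * ∑' y, k x y * k x' y := by
  have expand (y : X) : (∑ x ∈ s, k x y * h x) ^ 2 =
      ∑ x ∈ s, ∑ x' ∈ s, h x * h x' * (k x y * k x' y) := by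
    simp only [sq, Finset.sum_mul_sum, mul_mul_mul_comm, mul_comm]
  simp_rw [expand, ← ENNReal.tsum_mul_left]
  rw [Summable.tsum_finsetSum fun _ _ => ENNReal.summable]
  exact Finset.sum_congr rfl fun x _ => Summable.tsum_finsetSum fun _ _ => ENNReal.summable

theorem tsum_sum_mul_sq_le_mul (hkk : ∀ x x', ∑' y, k x y * k x' y ≤ C * (k x x' + k x' x))
    (s : Finset X) (h : X → ℝ≥0∞) :
    ∑' y, (∑ x ∈ s, k x y * h x) ^ 2 ≤ 2 * C * ∑ y ∈ s, h y * ∑ x ∈ s, k x y * h x := by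
  have expand : ∑ y ∈ s, h y * ∑ x ∈ s, k x y * h x =
      ∑ x ∈ s, ∑ x' ∈ s, h x * h x' * k x' x := by
    simp only [Finset.mul_sum, mul_comm, mul_left_comm]
  rw [tsum_sum_mul_sq, expand]
  calc _ ≤ ∑ x ∈ s, ∑ x' ∈ s, h x * h x' * (C * (k x x' + k x' x)) := by
        gcongr with x _ x' _
        exact hkk x x'
    _ = C * ∑ x ∈ s, ∑ x' ∈ s, h x * h x' * k x x' +
          C * ∑ x ∈ s, ∑ x' ∈ s, h x * h x' * k x' x := by
        simp_rw [Finset.mul_sum, ← Finset.sum_add_distrib]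
        exact Finset.sum_congr rfl fun x _ => Finset.sum_congr rfl fun x' _ => by ring
    _ = 2 * C * ∑ x ∈ s, ∑ x' ∈ s, h x * h x' * k x' x := by
        rw [Finset.sum_comm, mul_assoc, two_mul]
        simp only [mul_comm]

theorem tsum_sum_mul_sq_le (hkk : ∀ x x', ∑' y, k x y * k x' y ≤ C * (k x x' + k x' x))
    (hk : ∀ x x', ∑' y, k x y * k x' y ≠ ∞) (s : Finset X) {h : X → ℝ≥0∞} (hh : ∀ x, h x ≠ ∞) :
    ∑' y, (∑ x ∈ s, k x y * h x) ^ 2 ≤ (2 * C) ^ 2 * ∑ x ∈ s, h x ^ 2 := by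
  refine ennreal_le_of_sq_le_mul ?_ ?_
  · rw [tsum_sum_mul_sq]
    exact ENNReal.sum_ne_top.2 fun x _ => ENNReal.sum_ne_top.2 fun x' _ =>
      ENNReal.mul_ne_top (ENNReal.mul_ne_top (hh x) (hh x')) (hk x x')
  calc _ ≤ (2 * C * ∑ y ∈ s, h y * ∑ x ∈ s, k x y * h x) ^ 2 := by
        gcongr
        exact tsum_sum_mul_sq_le_mul hkk s h
    _ = (2 * C) ^ 2 * (∑ y ∈ s, h y * ∑ x ∈ s, k x y * h x) ^ 2 := mul_pow _ _ _
    _ ≤ (2 * C) ^ 2 * ((∑ x ∈ s, h x ^ 2) * ∑' y, (∑ x ∈ s, k x y * h x) ^ 2) := by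
        gcongr
        refine (ennreal_sum_mul_sq_le s _ _).trans ?_
        gcongr
        exact ENNReal.sum_le_tsum s
    _ = _ := (mul_assoc _ _ _).symm

-- A kernel with `k k* ≤ C (k + k*)` satisfies `‖k*‖² ≤ 2 C ‖k*‖`.
theorem tsum_kernel_sq_le (hC : C ≠ ∞) (hC0 : C ≠ 0) (hk : ∀ x, k x x ≠ ∞)
    (hkk : ∀ x x', ∑' y, k x y * k x' y ≤ C * (k x x' + k x' x)) (g : X → ℝ≥0∞) :
    ∑' x, (∑' y, k x y * g y) ^ 2 ≤ (2 * C) ^ 2 * ∑' y, g y ^ 2 := by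
  rcases eq_or_ne (∑' y, g y ^ 2) ∞ with hg | hg
  · rw [hg, ENNReal.mul_top (by simpa using hC0)]
    exact le_top
  have row_ne_top (x : X) : ∑' y, k x y ^ 2 ≠ ∞ := by
    simp_rw [sq]
    exact ne_top_of_le_ne_top (ENNReal.mul_ne_top hC (ENNReal.add_ne_top.2 ⟨hk x, hk x⟩)) (hkk x x)
  rw [ENNReal.tsum_eq_iSup_sum]
  refine iSup_le fun s => ?_
  set h : X → ℝ≥0∞ := fun x => ∑' y, k x y * g y with h_def
  have h_ne_top (x : X) : h x ≠ ∞ := ennreal_tsum_mul_ne_top (row_ne_top x) hg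
  have duality : ∑ x ∈ s, h x ^ 2 = ∑' y, (∑ x ∈ s, k x y * h x) * g y := by
    simp_rw [Finset.sum_mul]
    rw [Summable.tsum_finsetSum fun _ _ => ENNReal.summable]
    refine Finset.sum_congr rfl fun x _ => ?_
    simp_rw [mul_right_comm _ (h x), ENNReal.tsum_mul_right, sq, h_def]
  refine ennreal_le_of_sq_le_mul
    (ENNReal.sum_ne_top.2 fun x _ => ENNReal.pow_ne_top (h_ne_top x)) ?_
  calc (∑ x ∈ s, h x ^ 2) ^ 2 ≤ (∑' y, (∑ x ∈ s, k x y * h x) ^ 2) * ∑' y, g y ^ 2 :=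
        duality ▸ ennreal_tsum_mul_sq_le _ _
    _ ≤ ((2 * C) ^ 2 * ∑ x ∈ s, h x ^ 2) * ∑' y, g y ^ 2 := by
        gcongr
        exact tsum_sum_mul_sq_le hkk
          (fun x x' => ennreal_tsum_mul_ne_top (row_ne_top x) (row_ne_top x')) s h_ne_top
    _ = _ := mul_right_comm _ _ _

end PositiveKernel

theorem tsum_iSup_sq_le_of_linearized {X ι : Type*} {T : ι → X → ℝ≥0∞} {B : ℝ≥0∞}
    (hT : ∀ J : X → ι, ∑' x, T (J x) x ^ 2 ≤ B) : ∑' x, (⨆ j, T j x) ^ 2 ≤ 4 * B := by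
  rcases eq_or_ne B ∞ with rfl | hB
  · rw [ENNReal.mul_top four_ne_zero]
    exact le_top
  rcases isEmpty_or_nonempty ι with hι | hι
  · simp
  have sup_ne_top (x : X) : ⨆ j, T j x ≠ ∞ := by
    refine ne_top_of_le_ne_top (ENNReal.add_ne_top.2 ⟨ENNReal.one_ne_top, hB⟩) (iSup_le fun j => ?_)
    have sq_le : T j x ^ 2 ≤ B := (ENNReal.le_tsum x).trans (hT fun _ => j)
    rcases le_total (T j x) 1 with h | h
    · exact h.trans le_self_add
    · exact (le_self_pow₀ h two_ne_zero).trans (sq_le.trans le_add_self)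
  have exists_half_le (x : X) : ∃ j, ⨆ j, T j x ≤ 2 * T j x := by
    rcases eq_or_ne (⨆ j, T j x) 0 with h0 | h0
    · exact ⟨Classical.arbitrary ι, by simp [h0]⟩
    · obtain ⟨j, hj⟩ := lt_iSup_iff.1 (ENNReal.half_lt_self h0 (sup_ne_top x))
      rw [ENNReal.div_lt_iff (by simp) (by simp), mul_comm] at hj
      exact ⟨j, hj.le⟩
  choose J hJ using exists_half_le
  calc ∑' x, (⨆ j, T j x) ^ 2 ≤ ∑' x, (2 * T (J x) x) ^ 2 := by
        gcongr with x
        exact hJ x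
    _ = 4 * ∑' x, T (J x) x ^ 2 := by
        simp_rw [mul_pow, ENNReal.tsum_mul_left]
        norm_num
    _ ≤ 4 * B := by gcongr; exact hT J

/-! ### A maximal inequality along sublattices -/

/-- The positive kernel `t / (t + |m|)²` on the integers; its mass is bounded for `1 ≤ t` and it
dominates, up to constants, the kernels of the circle method. -/
def tentKernel (t : ℝ) (m : ℤ) : ℝ≥0∞ := ENNReal.ofReal (t / (t + |(m : ℝ)|) ^ 2)

theorem tentKernel_neg (t : ℝ) (m : ℤ) : tentKernel t (-m) = tentKernel t m := by
  simp [tentKernel]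

theorem tentKernel_zero_le {t : ℝ} (ht : 1 ≤ t) : tentKernel t 0 ≤ 1 := by
  rw [tentKernel, ENNReal.ofReal_le_one, Int.cast_zero, abs_zero, add_zero,
    div_le_one (by positivity)]
  exact le_self_pow₀ ht two_ne_zero

theorem div_add_sq_le_sub {t x : ℝ} (ht : 0 < t) (hx : 0 ≤ x) :
    t / (t + (x + 1)) ^ 2 ≤ t / (t + x) - t / (t + (x + 1)) := by
  rw [div_sub_div _ _ (by positivity) (by positivity), div_le_div_iff₀ (by positivity)
    (by positivity)]
  have : 0 ≤ t * (t + (x + 1)) := by positivity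
  nlinarith

theorem tsum_tentKernel_succ_le {t : ℝ} (ht : 0 < t) :
    ∑' n : ℕ, tentKernel t ((n : ℤ) + 1) ≤ 1 := by
  refine ENNReal.tsum_le_of_sum_range_le fun N => ?_
  have tent_le (n : ℕ) :
      t / (t + |(((n : ℤ) + 1 : ℤ) : ℝ)|) ^ 2 ≤ t / (t + n) - t / (t + (n + 1 : ℕ)) := by
    push_cast
    rw [abs_of_nonneg (by positivity)]
    exact div_add_sq_le_sub ht n.cast_nonneg
  simp only [tentKernel]
  rw [← ENNReal.ofReal_sum_of_nonneg fun n _ => by positivity, ENNReal.ofReal_le_one]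
  refine (Finset.sum_le_sum fun n _ => tent_le n).trans ?_
  rw [Finset.sum_range_sub' (fun n : ℕ => t / (t + n)), Nat.cast_zero, add_zero, div_self ht.ne']
  exact sub_le_self _ (by positivity)

theorem tsum_tentKernel_le {t : ℝ} (ht : 1 ≤ t) : ∑' m, tentKernel t m ≤ 3 := by
  have pos_part := tsum_tentKernel_succ_le (zero_lt_one.trans_le ht)
  have nonneg_part : ∑' n : ℕ, tentKernel t n ≤ 1 + 1 := by
    rw [tsum_eq_zero_add' ENNReal.summable]
    exact add_le_add (tentKernel_zero_le ht) (by exact_mod_cast pos_part)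
  have neg_part : ∑' n : ℕ, tentKernel t (-((n : ℤ) + 1)) ≤ 1 := by
    simpa only [tentKernel_neg] using pos_part
  rw [(HasSum.of_nat_of_neg_add_one (f := tentKernel t) ENNReal.summable.hasSum
    ENNReal.summable.hasSum).tsum_eq]
  exact (add_le_add nonneg_part neg_part).trans_eq (by norm_num)

theorem tsum_tentKernel_sub_le {t : ℝ} (ht : 1 ≤ t) (z : ℤ) : ∑' y, tentKernel t (z - y) ≤ 3 :=
  ((Equiv.subLeft z).tsum_eq (tentKernel t)).le.trans (tsum_tentKernel_le ht)

theorem tent_mul_tent_le {s t Y Z M : ℝ} (hs : 0 < s) (hst : s ≤ t) (hY : 0 ≤ Y) (hZ : 0 ≤ Z)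
    (hM : 0 ≤ M) (hMYZ : M ≤ Y + Z) :
    s / (s + Y) ^ 2 * (t / (t + Z) ^ 2) ≤
      16 * (t / (t + M) ^ 2) * (s / (s + Y) ^ 2 + t / (t + Z) ^ 2) := by
  have ht : 0 < t := hs.trans_le hst
  have pY : 0 ≤ s / (s + Y) ^ 2 := by positivity
  have pZ : 0 ≤ t / (t + Z) ^ 2 := by positivity
  have pM : 0 ≤ t / (t + M) ^ 2 := by positivity
  by_cases h : M ≤ t ∨ M ≤ 2 * Z
  · have tentZ_le : t / (t + Z) ^ 2 ≤ 16 * (t / (t + M) ^ 2) := by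
      rw [← mul_div_assoc, div_le_div_iff₀ (by positivity) (by positivity)]
      have : t + M ≤ 4 * (t + Z) := by rcases h with h | h <;> linarith
      have : (t + M) ^ 2 ≤ 16 * (t + Z) ^ 2 := by nlinarith
      nlinarith
    nlinarith [mul_le_mul_of_nonneg_left tentZ_le pY, mul_nonneg pM pZ]
  · push Not at h
    have tentY_le : s / (s + Y) ^ 2 ≤ 16 * (t / (t + M) ^ 2) := by
      rw [← mul_div_assoc, div_le_div_iff₀ (by positivity) (by positivity)]
      have : t + M ≤ 4 * (s + Y) := by linarith
      have : (t + M) ^ 2 ≤ 16 * (s + Y) ^ 2 := by nlinarith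
      nlinarith [mul_le_mul hst this (by positivity) ht.le]
    nlinarith [mul_le_mul_of_nonneg_right tentY_le pZ, mul_nonneg pM pY]

theorem tentKernel_mul_tentKernel_le {s t : ℝ} (hs : 0 < s) (hst : s ≤ t) (x x' y : ℤ) :
    tentKernel s (x - y) * tentKernel t (x' - y) ≤
      16 * tentKernel t (x - x') * (tentKernel s (x - y) + tentKernel t (x' - y)) := by
  have ht : 0 < t := hs.trans_le hst
  have triangle : |((x - x' : ℤ) : ℝ)| ≤ |((x - y : ℤ) : ℝ)| + |((x' - y : ℤ) : ℝ)| := by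
    push_cast
    rw [abs_sub_comm (x' : ℝ) y]
    exact abs_sub_le _ _ _
  simp only [tentKernel]
  rw [← ENNReal.ofReal_mul (by positivity), ← ENNReal.ofReal_add (by positivity) (by positivity),
    show (16 : ℝ≥0∞) = ENNReal.ofReal 16 by simp, ← ENNReal.ofReal_mul (by positivity),
    ← ENNReal.ofReal_mul (by positivity)]
  exact ENNReal.ofReal_le_ofReal
    (tent_mul_tent_le hs hst (abs_nonneg _) (abs_nonneg _) (abs_nonneg _) triangle)

theorem tsum_tentKernel_mul_le {s t : ℝ} (hs : 1 ≤ s) (hst : s ≤ t) (x x' : ℤ) :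
    ∑' y, tentKernel s (x - y) * tentKernel t (x' - y) ≤ 96 * tentKernel t (x - x') :=
  calc _ ≤ ∑' y, 16 * tentKernel t (x - x') * (tentKernel s (x - y) + tentKernel t (x' - y)) :=
        ENNReal.tsum_le_tsum fun y =>
          tentKernel_mul_tentKernel_le (zero_lt_one.trans_le hs) hst x x' y
    _ = 16 * tentKernel t (x - x') *
          (∑' y, tentKernel s (x - y) + ∑' y, tentKernel t (x' - y)) := by
        rw [ENNReal.tsum_mul_left, ENNReal.tsum_add]
    _ ≤ 16 * tentKernel t (x - x') * (3 + 3) := by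
        gcongr
        · exact tsum_tentKernel_sub_le hs x
        · exact tsum_tentKernel_sub_le (hs.trans hst) x'
    _ = _ := by
        rw [mul_right_comm]
        norm_num

/-- The product kernel of `tentKernel` on `ℤ^d`. -/
def tentKernelPi {d : ℕ} (t : ℝ) (m : Fin d → ℤ) : ℝ≥0∞ := ∏ i, tentKernel t (m i)

theorem tentKernelPi_ne_top {d : ℕ} (t : ℝ) (m : Fin d → ℤ) : tentKernelPi t m ≠ ∞ :=
  ENNReal.prod_ne_top fun _ _ => ENNReal.ofReal_ne_top

theorem tsum_tentKernelPi_mul_le_of_le {d : ℕ} {s t : ℝ} (hs : 1 ≤ s) (hst : s ≤ t)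
    (x x' : Fin d → ℤ) :
    ∑' y, tentKernelPi s (x - y) * tentKernelPi t (x' - y) ≤ 96 ^ d * tentKernelPi t (x' - x) := by
  simp only [tentKernelPi, Pi.sub_apply, ← Finset.prod_mul_distrib]
  rw [ennreal_tsum_prod_fin fun i y => tentKernel s (x i - y) * tentKernel t (x' i - y)]
  calc _ ≤ ∏ i, 96 * tentKernel t (x i - x' i) :=
        Finset.prod_le_prod' fun i _ => tsum_tentKernel_mul_le hs hst _ _
    _ = 96 ^ d * ∏ i, tentKernel t (x i - x' i) := by
        rw [Finset.prod_mul_distrib, Finset.prod_const, Finset.card_univ, Fintype.card_fin]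
    _ = _ := by simp only [← tentKernel_neg t (x _ - _), neg_sub]

theorem tsum_tentKernelPi_mul_le {d : ℕ} {s t : ℝ} (hs : 1 ≤ s) (ht : 1 ≤ t) (x x' : Fin d → ℤ) :
    ∑' y, tentKernelPi s (x - y) * tentKernelPi t (x' - y) ≤
      96 ^ d * (tentKernelPi s (x - x') + tentKernelPi t (x' - x)) := by
  rcases le_total s t with h | h
  · exact (tsum_tentKernelPi_mul_le_of_le hs h x x').trans (mul_le_mul_right le_add_self _)
  · simp_rw [mul_comm (tentKernelPi s _)]
    exact (tsum_tentKernelPi_mul_le_of_le ht h x' x).trans (mul_le_mul_right le_self_add _)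

theorem tsum_iSup_tentKernelPi_sq_le {d : ℕ} {ι : Type*} {τ : ι → ℝ} (hτ : ∀ j, 1 ≤ τ j)
    (g : (Fin d → ℤ) → ℝ≥0∞) :
    ∑' x, (⨆ j, ∑' m, tentKernelPi (τ j) m * g (x - m)) ^ 2 ≤
      4 * ((2 * 96 ^ d) ^ 2 * ∑' y, g y ^ 2) := by
  have convolution (j : ι) (x : Fin d → ℤ) :
      ∑' m, tentKernelPi (τ j) m * g (x - m) = ∑' y, tentKernelPi (τ j) (x - y) * g y := by
    rw [← (Equiv.subLeft x).tsum_eq]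
    exact tsum_congr fun y => by simp
  simp_rw [convolution]
  refine tsum_iSup_sq_le_of_linearized
    (T := fun j x => ∑' y, tentKernelPi (τ j) (x - y) * g y) fun J => ?_
  exact tsum_kernel_sq_le (k := fun x y => tentKernelPi (τ (J x)) (x - y))
    (ENNReal.pow_ne_top (by simp)) (by positivity) (fun x => tentKernelPi_ne_top _ _)
    (fun x x' => tsum_tentKernelPi_mul_le (hτ _) (hτ _) x x') g

theorem tsum_iSup_tentKernelPi_smul_sq_le {d : ℕ} (q : ℕ) [NeZero q] {ι : Type*} {τ : ι → ℝ}
    (hτ : ∀ j, 1 ≤ τ j) (g : (Fin d → ℤ) → ℝ≥0∞) :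
    ∑' x, (⨆ j, ∑' m, tentKernelPi (τ j) m * g (x - (q : ℤ) • m)) ^ 2 ≤
      4 * ((2 * 96 ^ d) ^ 2 * ∑' y, g y ^ 2) := by
  let E : (Fin d → Fin q) × (Fin d → ℤ) ≃ (Fin d → ℤ) :=
    (Equiv.prodComm _ _).trans ((Equiv.arrowProdEquivProdArrow (Fin d) (fun _ => ℤ)
      (fun _ => Fin q)).symm.trans
      (Equiv.piCongrRight fun _ => (Int.divModEquiv q).symm))
  have E_apply (p) : E p = fun i => (p.1 i : ℤ) + (q : ℤ) * p.2 i := by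
    ext i
    simp [E, Equiv.arrowProdEquivProdArrow, Int.divModEquiv_symm_apply]
    ring
  have E_sub (r k m) : E (r, k) - (q : ℤ) • m = E (r, k - m) := by
    rw [E_apply, E_apply]
    ext i
    simp
    ring
  rw [← E.tsum_eq, ← E.tsum_eq (fun y => g y ^ 2), ENNReal.tsum_prod', ENNReal.tsum_prod',
    ← ENNReal.tsum_mul_left, ← ENNReal.tsum_mul_left]
  refine ENNReal.tsum_le_tsum fun r => ?_
  simp_rw [E_sub]
  exact tsum_iSup_tentKernelPi_sq_le hτ fun k => g (E (r, k))

/-! ### Fourier coefficients on the torus -/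

section Fourier

open UnitAddTorus

attribute [local instance] instMeasureSpaceUnitAddCircle
attribute [local instance] instIsProbabilityMeasureUnitAddCircleVolume

variable {d : ℕ}

theorem norm_mFourier_apply (n : Fin d → ℤ) (t : UnitAddTorus (Fin d)) : ‖mFourier n t‖ = 1 := by
  simp only [mFourier, fourier_apply, ContinuousMap.coe_mk, norm_prod, Circle.norm_coe,
    Finset.prod_const_one]

/-- Bounded measurable functions on the torus, a class closed under the operations below all of
whose members have Fourier coefficients satisfying Parseval's identity. -/
structure IsBoundedMeasurable (g : UnitAddTorus (Fin d) → ℂ) : Prop where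
  measurable : Measurable g
  bounded : ∃ B : ℝ, ∀ t, ‖g t‖ ≤ B

namespace IsBoundedMeasurable

variable {g h : UnitAddTorus (Fin d) → ℂ}

theorem of_continuous (hg : Continuous g) : IsBoundedMeasurable g where
  measurable := hg.measurable
  bounded := by
    obtain ⟨B, hB⟩ := isCompact_univ.exists_bound_of_continuousOn hg.continuousOn
    exact ⟨B, fun t => hB t (Set.mem_univ t)⟩

theorem mul (hg : IsBoundedMeasurable g) (hh : IsBoundedMeasurable h) :
    IsBoundedMeasurable fun t => g t * h t where
  measurable := hg.measurable.mul hh.measurable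
  bounded := by
    obtain ⟨A, hA⟩ := hg.bounded
    obtain ⟨B, hB⟩ := hh.bounded
    refine ⟨A * B, fun t => ?_⟩
    rw [norm_mul]
    exact mul_le_mul (hA t) (hB t) (norm_nonneg _) ((norm_nonneg _).trans (hA t))

theorem sub (hg : IsBoundedMeasurable g) (hh : IsBoundedMeasurable h) :
    IsBoundedMeasurable fun t => g t - h t where
  measurable := hg.measurable.sub hh.measurable
  bounded := by
    obtain ⟨A, hA⟩ := hg.bounded
    obtain ⟨B, hB⟩ := hh.bounded
    exact ⟨A + B, fun t => (norm_sub_le _ _).trans (add_le_add (hA t) (hB t))⟩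

theorem memLp (hg : IsBoundedMeasurable g) (p : ℝ≥0∞) : MemLp g p volume := by
  obtain ⟨B, hB⟩ := hg.bounded
  exact MemLp.of_bound hg.measurable.aestronglyMeasurable B (Filter.Eventually.of_forall hB)

theorem integrable (hg : IsBoundedMeasurable g) : Integrable g :=
  memLp_one_iff_integrable.1 (hg.memLp 1)

theorem tsum_enorm_mFourierCoeff_sq (hg : IsBoundedMeasurable g) :
    ∑' x, ‖mFourierCoeff g x‖ₑ ^ 2 = ∫⁻ t, ‖g t‖ₑ ^ 2 := by
  have g_mem := hg.memLp 2
  have parseval : HasSum (fun x => ‖mFourierCoeff g x‖ ^ 2) (∫ t, ‖g t‖ ^ 2) := by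
    have coeff_eq (x) : mFourierCoeff g_mem.toLp x = mFourierCoeff g x :=
      integral_congr_ae (by filter_upwards [g_mem.coeFn_toLp] with t ht; rw [ht])
    have integral_eq : ∫ t, ‖g_mem.toLp g t‖ ^ 2 = ∫ t, ‖g t‖ ^ 2 :=
      integral_congr_ae (by filter_upwards [g_mem.coeFn_toLp] with t ht; rw [ht])
    simpa only [coeff_eq, integral_eq] using hasSum_sq_mFourierCoeff g_mem.toLp
  have enorm_sq (z : ℂ) : ‖z‖ₑ ^ 2 = ENNReal.ofReal (‖z‖ ^ 2) := by
    rw [ENNReal.ofReal_pow (norm_nonneg _), ofReal_norm]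
  simp_rw [enorm_sq]
  rw [← ENNReal.ofReal_tsum_of_nonneg (fun x => by positivity) parseval.summable,
    parseval.tsum_eq, ofReal_integral_eq_lintegral_ofReal g_mem.integrable_norm_pow'
      (Filter.Eventually.of_forall fun t => by positivity)]

end IsBoundedMeasurable

theorem hasSum_mul_mFourierCoeff {k : (Fin d → ℤ) → ℂ} (hk : Summable fun m => ‖k m‖)
    {g : UnitAddTorus (Fin d) → ℂ} (hg : Integrable g) (q : ℤ) (x : Fin d → ℤ) :
    HasSum (fun m => k m * mFourierCoeff g (x - q • m))
      (mFourierCoeff (fun t => (∑' m, k m * mFourier (q • m) t) * g t) x) := by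
  have integrable_term (m) : Integrable fun t => k m * (mFourier (-(x - q • m)) t • g t) :=
    (hg.bdd_mul (c := 1) (by fun_prop)
      (Filter.Eventually.of_forall fun t => (norm_mFourier_apply _ t).le)).const_mul _
  have integral_norm_term (m) :
      ∫ t, ‖k m * (mFourier (-(x - q • m)) t • g t)‖ = ‖k m‖ * ∫ t, ‖g t‖ := by
    rw [← integral_const_mul]
    simp only [norm_mul, norm_smul, norm_mFourier_apply, one_mul]
  have interchange := hasSum_integral_of_summable_integral_norm integrable_term (by
    simp_rw [integral_norm_term]
    exact hk.mul_right _)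
  simp_rw [integral_const_mul] at interchange
  suffices coeff_eq : mFourierCoeff (fun t => (∑' m, k m * mFourier (q • m) t) * g t) x =
      ∫ t, ∑' m, k m * (mFourier (-(x - q • m)) t • g t) by
    rw [coeff_eq]
    exact interchange
  refine integral_congr_ae (Filter.Eventually.of_forall fun t => ?_)
  simp only [smul_eq_mul]
  rw [← tsum_mul_right, ← tsum_mul_left]
  refine tsum_congr fun m => ?_
  rw [neg_sub, sub_eq_add_neg, mFourier_add]
  ring

theorem continuous_tsum_mFourier {k : (Fin d → ℤ) → ℂ} (hk : Summable fun m => ‖k m‖)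
    (q : ℤ) : Continuous fun ξ : UnitAddTorus (Fin d) => ∑' m, k m * mFourier (q • m) ξ :=
  continuous_tsum (fun m => by fun_prop) hk fun m ξ => by
    rw [norm_mul, norm_mFourier_apply, mul_one]

theorem mFourierCoeff_mFourier (n x : Fin d → ℤ) :
    mFourierCoeff (mFourier n) x = if x = n then 1 else 0 := by
  rw [← (orthonormal_iff_ite.1 (orthonormal_mFourier (d := Fin d))) x n, ContinuousMap.inner_toLp]
  simp only [mFourierCoeff, smul_eq_mul, mFourier_neg]
  exact integral_congr_ae (Filter.Eventually.of_forall fun t => by simp [mul_comm])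

theorem mFourierCoeff_sum (s : Finset (Fin d → ℤ)) (f : (Fin d → ℤ) → ℂ)
    (hf : ∀ n ∉ s, f n = 0) (x : Fin d → ℤ) :
    mFourierCoeff (fun t => ∑ n ∈ s, f n * mFourier n t) x = f x := by
  have integral_term (n) :
      ∫ t, mFourier (-x) t • (f n * mFourier n t) = f n * if x = n then 1 else 0 := by
    rw [← mFourierCoeff_mFourier, mFourierCoeff, ← integral_const_mul]
    simp only [smul_eq_mul, mul_left_comm]
  simp only [mFourierCoeff, Finset.smul_sum]
  rw [integral_finsetSum]
  · simp_rw [integral_term]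
    by_cases hx : x ∈ s
    · simp [hx]
    · simp [hx, hf x hx]
  · intro n _
    refine Integrable.of_bound (C := ‖f n‖) (by fun_prop)
      (Filter.Eventually.of_forall fun t => ?_)
    rw [norm_smul, norm_mul, norm_mFourier_apply, norm_mFourier_apply, one_mul, mul_one]

/-- The representative in `(0, 1]` of a point of the circle. -/
def circleRep (t : UnitAddCircle) : ℝ := (AddCircle.equivIoc 1 0 t : ℝ)

theorem measurable_circleRep : Measurable circleRep :=
  measurable_subtype_coe.comp (AddCircle.measurableEquivIoc 1 0).measurable

theorem coe_circleRep (t : UnitAddCircle) : (circleRep t : UnitAddCircle) = t :=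
  (AddCircle.equivIoc 1 0).symm_apply_apply t

theorem fourier_eq_exp (n : ℤ) (t : UnitAddCircle) :
    fourier n t = Complex.exp (2 * π * I * n * circleRep t) := by
  conv_lhs => rw [← coe_circleRep t]
  rw [fourier_coe_apply, Complex.ofReal_one, div_one]

end Fourier

/-! ### The product kernel -/

/-- The `d`-dimensional product of `thetaKernel`, that is, `S^{-d/2} e((t + i / S) |m|²)`. -/
def thetaKernelPi {d : ℕ} (S t : ℝ) (m : Fin d → ℤ) : ℂ := ∏ i, thetaKernel S t (m i)

theorem summable_norm_thetaKernelPi {d : ℕ} {S : ℝ} (hS : 0 < S) (t : ℝ) :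
    Summable fun m : Fin d → ℤ => ‖thetaKernelPi S t m‖ :=
  summable_norm_prod_fin fun _ => summable_norm_thetaKernel hS t

theorem sq_add_mul_exp_neg_le {r y : ℝ} (hr : 0 < r) :
    (r + y) ^ 2 * Real.exp (-(2 * π * y ^ 2 / r ^ 2)) ≤ 2 * r ^ 2 := by
  have sq_le : (r + y) ^ 2 ≤ 2 * r ^ 2 * (1 + y ^ 2 / r ^ 2) := by
    have : 2 * r ^ 2 * (1 + y ^ 2 / r ^ 2) = 2 * (r ^ 2 + y ^ 2) := by field_simp
    nlinarith [sq_nonneg (r - y)]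
  have le_exp : 1 + y ^ 2 / r ^ 2 ≤ Real.exp (2 * π * y ^ 2 / r ^ 2) := by
    have : 0 ≤ y ^ 2 / r ^ 2 := by positivity
    refine le_trans ?_ (Real.add_one_le_exp _)
    rw [mul_div_assoc]
    nlinarith [Real.pi_gt_three]
  rw [Real.exp_neg, ← div_eq_mul_inv, div_le_iff₀ (Real.exp_pos _)]
  exact sq_le.trans (by gcongr)

theorem enorm_thetaKernel_le_tentKernel {s : ℝ} (hs : 0 < s) (t : ℝ) (m : ℤ) :
    ‖thetaKernel s t m‖ₑ ≤ 2 * tentKernel √s m := by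
  have hr : 0 < √s := Real.sqrt_pos.2 hs
  have decay := sq_add_mul_exp_neg_le hr (y := |(m : ℝ)|)
  rw [sq_abs, Real.sq_sqrt hs.le] at decay
  rw [← ofReal_norm, norm_thetaKernel, tentKernel, show (2 : ℝ≥0∞) = ENNReal.ofReal 2 by simp,
    ← ENNReal.ofReal_mul (by norm_num)]
  apply ENNReal.ofReal_le_ofReal
  rw [← mul_div_assoc, inv_mul_eq_div, div_le_div_iff₀ hr (by positivity), mul_comm,
    mul_assoc 2 √s √s, Real.mul_self_sqrt hs.le]
  exact decay

theorem enorm_thetaKernelPi_le_tentKernelPi {d : ℕ} {s : ℝ} (hs : 0 < s) (t : ℝ)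
    (m : Fin d → ℤ) : ‖thetaKernelPi s t m‖ₑ ≤ 2 ^ d * tentKernelPi √s m := by
  have enorm_prod : ‖thetaKernelPi s t m‖ₑ = ∏ i, ‖thetaKernel s t (m i)‖ₑ := by
    simp_rw [thetaKernelPi, ← ofReal_norm, norm_prod]
    exact ENNReal.ofReal_prod_of_nonneg fun _ _ => norm_nonneg _
  calc _ ≤ ∏ i, 2 * tentKernel √s (m i) :=
        enorm_prod.trans_le (Finset.prod_le_prod' fun i _ =>
          enorm_thetaKernel_le_tentKernel hs t _)
    _ = _ := by
        rw [Finset.prod_mul_distrib, Finset.prod_const, Finset.card_univ, Fintype.card_fin,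
          tentKernelPi]

theorem tsum_thetaKernelPi_mul_mFourier {d : ℕ} {S : ℝ} (hS : 0 < S) (t : ℝ) (q : ℤ)
    (ξ : UnitAddTorus (Fin d)) :
    ∑' m, thetaKernelPi S t m * UnitAddTorus.mFourier (q • m) ξ =
      ∏ i, thetaMultiplier S t (q * circleRep (ξ i)) := by
  have factor := tsum_prod_fin (d := d) (f := fun i k => thetaKernel S t k *
    Complex.exp (2 * π * I * k * (q * circleRep (ξ i) : ℝ)))
    fun i => (summable_thetaMultiplier hS t _).norm
  simp only [thetaMultiplier, ← factor]
  refine tsum_congr fun m => ?_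
  rw [Finset.prod_mul_distrib, thetaKernelPi]
  congr 1
  simp only [UnitAddTorus.mFourier, ContinuousMap.coe_mk, fourier_eq_exp]
  refine Finset.prod_congr rfl fun i _ => ?_
  congr 1
  simp only [Pi.smul_apply, smul_eq_mul]
  push_cast
  ring

/-! ### The theta multiplier near a rational -/

theorem norm_prod_le_pow {d : ℕ} {a : Fin d → ℂ} {R : ℝ} (ha : ∀ i, ‖a i‖ ≤ R) :
    ‖∏ i, a i‖ ≤ R ^ d := by
  rw [norm_prod]
  exact (Finset.prod_le_prod (fun _ _ => norm_nonneg _) fun i _ => ha i).trans_eq (by simp)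

theorem norm_prod_sub_prod_le {d : ℕ} {a b : Fin d → ℂ} {R ε : ℝ} (hR : 0 ≤ R)
    (ha : ∀ i, ‖a i‖ ≤ R) (hb : ∀ i, ‖b i‖ ≤ R) (hab : ∀ i, ‖a i - b i‖ ≤ R * ε) :
    ‖∏ i, a i - ∏ i, b i‖ ≤ d * R ^ d * ε := by
  induction d with
  | zero => simp
  | succ n ih =>
    have telescope : a 0 * ∏ i : Fin n, a i.succ - b 0 * ∏ i : Fin n, b i.succ =
        (a 0 - b 0) * ∏ i : Fin n, a i.succ +
          b 0 * (∏ i : Fin n, a i.succ - ∏ i : Fin n, b i.succ) := by ring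
    have norm_tail : ‖∏ i : Fin n, a i.succ‖ ≤ R ^ n := norm_prod_le_pow fun i => ha i.succ
    have norm_tail_sub := ih (fun i => ha i.succ) (fun i => hb i.succ) fun i => hab i.succ
    rw [Fin.prod_univ_succ, Fin.prod_univ_succ, telescope]
    calc _ ≤ ‖a 0 - b 0‖ * ‖∏ i : Fin n, a i.succ‖ +
          ‖b 0‖ * ‖∏ i : Fin n, a i.succ - ∏ i : Fin n, b i.succ‖ := by
          rw [← norm_mul, ← norm_mul]
          exact norm_add_le _ _
      _ ≤ R * ε * R ^ n + R * (n * R ^ n * ε) :=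
          add_le_add
            (mul_le_mul (hab 0) norm_tail (norm_nonneg _) ((norm_nonneg _).trans (hab 0)))
            (mul_le_mul (hb 0) norm_tail_sub (norm_nonneg _) hR)
      _ = _ := by push_cast; ring

theorem norm_prod_sub_prod_mul_le {d : ℕ} {α c F : Fin d → ℂ} {B D ε : ℝ} (hB : 0 ≤ B)
    (hε : 0 ≤ ε) (hD : 1 + ε ≤ D) (hc : ∀ i, ‖c i‖ ≤ B) (hF : ∀ i, ‖F i‖ ≤ 1)
    (hα : ∀ i, ‖α i - c i * F i‖ ≤ B * ε) :
    ‖∏ i, α i - ∏ i, c i * F i‖ ≤ B ^ d * (d * D ^ d * ε) := by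
  have B_le : B ≤ B * D := le_mul_of_one_le_right hB (by linarith)
  have norm_main (i) : ‖c i * F i‖ ≤ B := by
    rw [norm_mul]
    exact (mul_le_mul (hc i) (hF i) (norm_nonneg _) hB).trans_eq (mul_one B)
  have norm_le (i) : ‖α i‖ ≤ B * D :=
    calc ‖α i‖ ≤ ‖c i * F i‖ + ‖α i - c i * F i‖ := norm_le_norm_add_norm_sub' _ _
      _ ≤ B * (1 + ε) := by linarith [norm_main i, hα i]
      _ ≤ B * D := by gcongr
  calc _ ≤ d * (B * D) ^ d * ε :=
        norm_prod_sub_prod_le (hB.trans B_le) norm_le (fun i => (norm_main i).trans B_le)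
          fun i => (hα i).trans (by gcongr)
    _ = _ := by rw [mul_pow]; ring

theorem thetaFactor_ne_zero (u : ℝ) : thetaFactor u ≠ 0 := by
  intro h
  have pos : 0 < (2 * √(1 + u ^ 2))⁻¹ := by positivity
  rw [← norm_thetaFactor_sq, h] at pos
  simp at pos

theorem norm_thetaMultiplier_zero_sub_le {s : ℝ} (hs : 0 < s) (y : ℝ) :
    ‖thetaMultiplier s 0 y - thetaFactor 0 *
        Complex.exp (-(π * s / 2 : ℝ) * (round y - y) ^ 2)‖ ≤
      ‖thetaFactor 0‖ * (4 / (π * s / 2) * intInvSqSum) := by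
  have h := norm_thetaMultiplier_sub_le (q := 1) hs 0 0 y (b := 1) (by simp [quadGaussSum_one])
  simpa [quadGaussSum_one, gaussScale] using h

/-- The size of the theta multiplier near a rational of denominator `q`, at the distance
encoded by `u`. -/
def majorBound (q : ℕ) (u : ℝ) : ℝ := ‖thetaFactor u‖ / q * √(2 * q)

theorem majorBound_nonneg (q : ℕ) (u : ℝ) : 0 ≤ majorBound q u := by
  rw [majorBound]
  positivity

/-- The amplitude of the dominant Gaussian in the theta multiplier near `a / q`. -/
def majorAmplitude (q : ℕ) [NeZero q] (a : ℤ) (u x : ℝ) : ℂ :=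
  thetaFactor u / q * quadGaussSum q a (round (q * x) : ℤ)

/-- The ratio between the theta multiplier near `a / q` and the theta multiplier near `0` of the
lattice `q ℤ`. -/
def majorCoeff (q : ℕ) [NeZero q] (a : ℤ) (u x : ℝ) : ℂ :=
  majorAmplitude q a u x / thetaFactor 0

/-- The relative error made when only the dominant Gaussian of the theta multiplier is kept. -/
def thetaError (S : ℝ) (q : ℕ) (u : ℝ) : ℝ := 4 / (gaussScale S q / (1 + u ^ 2)) * intInvSqSum

/-- An upper bound for `1 + thetaError S q u` on the range `q ^ 2 * max 1 (u ^ 2) ≤ S`. -/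
def thetaConst : ℝ := 1 + 16 * intInvSqSum / π

/-- The squared Euclidean distance from `y` to the integer lattice. -/
def latticeDistSq {d : ℕ} (y : Fin d → ℝ) : ℝ := ∑ i, (round (y i) - y i) ^ 2

theorem latticeDistSq_nonneg {d : ℕ} (y : Fin d → ℝ) : 0 ≤ latticeDistSq y :=
  Finset.sum_nonneg fun _ _ => sq_nonneg _

theorem one_le_thetaConst : 1 ≤ thetaConst := by
  have := intInvSqSum_nonneg
  rw [thetaConst, le_add_iff_nonneg_right]
  positivity

section ExpComparison

variable {X : ℝ}

theorem norm_exp_neg_div_one_sub_mul_I (u X : ℝ) :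
    ‖Complex.exp (-(X / (1 - u * I)))‖ = Real.exp (-(X / (1 + u ^ 2))) := by
  rw [Complex.norm_exp, Complex.neg_re, re_div_one_sub_mul_I]

theorem norm_exp_neg_ofReal (X : ℝ) : ‖Complex.exp (-X)‖ = Real.exp (-X) := by
  rw [Complex.norm_exp, Complex.neg_re, Complex.ofReal_re]

theorem norm_exp_sub_exp_le_mul (u : ℝ) (hX : 0 ≤ X) :
    ‖Complex.exp (-(X / (1 - u * I))) - Complex.exp (-X)‖ ≤ 4 * X := by
  rcases le_total X 1 with small | large
  · have sub_one_le {z : ℂ} (hz : ‖z‖ ≤ X) : ‖Complex.exp z - 1‖ ≤ 2 * X :=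
      (Complex.norm_exp_sub_one_le (hz.trans small)).trans (by linarith)
    have norm_left : ‖-((X : ℂ) / (1 - u * I))‖ ≤ X := by
      rw [norm_neg, norm_div, norm_one_sub_mul_I, Complex.norm_real, Real.norm_of_nonneg hX]
      exact div_le_self hX (Real.one_le_sqrt.2 (le_add_of_nonneg_right (sq_nonneg u)))
    have norm_right : ‖(-X : ℂ)‖ ≤ X := by
      rw [norm_neg, Complex.norm_real, Real.norm_of_nonneg hX]
    have triangle := norm_sub_le (Complex.exp (-(X / (1 - u * I))) - 1) (Complex.exp (-X) - 1)
    rw [sub_sub_sub_cancel_right] at triangle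
    linarith [sub_one_le norm_left, sub_one_le norm_right]
  · refine (norm_sub_le _ _).trans ?_
    rw [norm_exp_neg_div_one_sub_mul_I, norm_exp_neg_ofReal]
    have : Real.exp (-(X / (1 + u ^ 2))) ≤ 1 :=
      Real.exp_le_one_iff.2 (neg_nonpos.2 (by positivity))
    have : Real.exp (-X) ≤ 1 := Real.exp_le_one_iff.2 (neg_nonpos.2 hX)
    linarith

theorem norm_exp_sub_exp_le_div (u : ℝ) (hX : 0 < X) :
    ‖Complex.exp (-(X / (1 - u * I))) - Complex.exp (-X)‖ ≤ 4 * ((1 + u ^ 2) / X) := by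
  refine (norm_sub_le _ _).trans ?_
  rw [norm_exp_neg_div_one_sub_mul_I, norm_exp_neg_ofReal]
  have decay := exp_neg_le_one_div (y := X / (1 + u ^ 2)) (by positivity)
  have mono : Real.exp (-X) ≤ Real.exp (-(X / (1 + u ^ 2))) :=
    Real.exp_le_exp.2 (neg_le_neg (div_le_self hX.le (le_add_of_nonneg_right (sq_nonneg u))))
  rw [one_div_div] at decay
  have : 0 ≤ (1 + u ^ 2) / X := by positivity
  linarith

theorem norm_exp_sub_exp_le (u : ℝ) (hX : 0 ≤ X) :
    ‖Complex.exp (-(X / (1 - u * I))) - Complex.exp (-X)‖ ≤ 4 * min X ((1 + u ^ 2) / X) := by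
  rcases hX.eq_or_lt with rfl | pos
  · simp
  rw [mul_min_of_nonneg _ _ (by norm_num : (0 : ℝ) ≤ 4)]
  exact le_min (norm_exp_sub_exp_le_mul u hX) (norm_exp_sub_exp_le_div u pos)

theorem norm_prod_gaussian_sub_le {d : ℕ} {c : Fin d → ℂ} {B σ : ℝ} (hB : 0 ≤ B) (hσ : 0 ≤ σ)
    (hc : ∀ i, ‖c i‖ ≤ B) (u : ℝ) (z : Fin d → ℝ) :
    ‖∏ i, c i * Complex.exp (-(σ / (1 - u * I)) * z i ^ 2) -
        ∏ i, c i * Complex.exp (-σ * z i ^ 2)‖ ≤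
      B ^ d * (4 * min (σ * ∑ i, z i ^ 2) ((1 + u ^ 2) / (σ * ∑ i, z i ^ 2))) := by
  have prod_left : ∏ i, Complex.exp (-(σ / (1 - u * I)) * z i ^ 2) =
      Complex.exp (-((σ * ∑ i, z i ^ 2 : ℝ) / (1 - u * I))) := by
    rw [← Complex.exp_sum, ← Finset.mul_sum]
    push_cast
    ring_nf
  have prod_right : ∏ i, Complex.exp (-σ * z i ^ 2) =
      Complex.exp (-((σ * ∑ i, z i ^ 2 : ℝ) : ℂ)) := by
    rw [← Complex.exp_sum, ← Finset.mul_sum]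
    push_cast
    ring_nf
  rw [Finset.prod_mul_distrib, Finset.prod_mul_distrib, ← mul_sub, norm_mul, prod_left, prod_right]
  gcongr
  · exact norm_prod_le_pow hc
  · exact norm_exp_sub_exp_le u (mul_nonneg hσ (Finset.sum_nonneg fun _ _ => sq_nonneg _))

end ExpComparison

section MajorArc

variable {q : ℕ} [NeZero q] {a : ℤ} {u S : ℝ}

theorem majorBound_sq (q : ℕ) [NeZero q] (u : ℝ) :
    majorBound q u ^ 2 = (q * √(1 + u ^ 2))⁻¹ := by
  have hq : (q : ℝ) ≠ 0 := NeZero.ne _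
  rw [majorBound, mul_pow, div_pow, norm_thetaFactor_sq, Real.sq_sqrt (by positivity)]
  field_simp

theorem norm_majorAmplitude_le (ha : IsCoprime a (q : ℤ)) (u x : ℝ) :
    ‖majorAmplitude q a u x‖ ≤ majorBound q u := by
  rw [majorAmplitude, majorBound, norm_mul, norm_div, Complex.norm_natCast]
  gcongr
  exact norm_quadGaussSum_le_sqrt_of_isCoprime ha _

theorem pos_of_sq_mul_max_le (hS : q ^ 2 * max 1 (u ^ 2) ≤ S) : 0 < S := by
  have : (0 : ℝ) < q := Nat.cast_pos.2 (NeZero.pos q)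
  have : (0 : ℝ) < max 1 (u ^ 2) := lt_max_of_lt_left one_pos
  exact lt_of_lt_of_le (by positivity) hS

theorem pi_div_four_le (hS : q ^ 2 * max 1 (u ^ 2) ≤ S) :
    π / 4 ≤ gaussScale S q / (1 + u ^ 2) := by
  have hq : (0 : ℝ) < q := Nat.cast_pos.2 (NeZero.pos q)
  have : (q : ℝ) ^ 2 * (1 + u ^ 2) ≤ 2 * S :=
    calc (q : ℝ) ^ 2 * (1 + u ^ 2) ≤ q ^ 2 * (max 1 (u ^ 2) + max 1 (u ^ 2)) := by
          gcongr
          · exact le_max_left _ _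
          · exact le_max_right _ _
      _ ≤ 2 * S := by linarith
  rw [gaussScale, div_div, div_le_div_iff₀ (by positivity) (by positivity)]
  nlinarith [Real.pi_pos]

theorem thetaError_nonneg (hS : 0 ≤ S) (q : ℕ) (u : ℝ) : 0 ≤ thetaError S q u := by
  have := intInvSqSum_nonneg
  rw [thetaError, gaussScale]
  positivity

theorem one_add_thetaError_le (hS : q ^ 2 * max 1 (u ^ 2) ≤ S) :
    1 + thetaError S q u ≤ thetaConst := by
  have := intInvSqSum_nonneg
  have inv_le : 4 / (gaussScale S q / (1 + u ^ 2)) ≤ 16 / π :=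
    calc _ ≤ 4 / (π / 4) := by
          have := pi_div_four_le hS
          gcongr
      _ = 16 / π := by field_simp; norm_num
  rw [thetaError, thetaConst, mul_div_right_comm]
  gcongr

theorem norm_thetaMultiplier_sub_majorAmplitude_le (ha : IsCoprime a (q : ℤ)) (hS : 0 < S)
    (u x : ℝ) :
    ‖thetaMultiplier S (a / q + u / S) x - majorAmplitude q a u x *
        Complex.exp (-(gaussScale S q / (1 - u * I)) * (round (q * x) - q * x : ℝ) ^ 2)‖ ≤
      majorBound q u * thetaError S q u := by
  have h := norm_thetaMultiplier_sub_le hS a u x (norm_quadGaussSum_le_sqrt_of_isCoprime ha)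
  rw [← mul_assoc] at h
  convert h using 1
  · rw [majorAmplitude]
    push_cast
    rfl
  · rw [majorBound, thetaError]
    ring

theorem norm_majorCoeff_mul_thetaMultiplier_sub_le (ha : IsCoprime a (q : ℤ)) (hS : 0 < S)
    (u x : ℝ) :
    ‖majorCoeff q a u x * thetaMultiplier (S / q ^ 2) 0 (q * x) - majorAmplitude q a u x *
        Complex.exp (-gaussScale S q * (round (q * x) - q * x : ℝ) ^ 2)‖ ≤
      majorBound q u * thetaError S q u := by
  have hq : (0 : ℝ) < q := Nat.cast_pos.2 (NeZero.pos q)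
  have hσ := gaussScale_pos hS q
  have factor_ne := thetaFactor_ne_zero 0
  have factor_pos : 0 < ‖thetaFactor 0‖ := norm_pos_iff.2 factor_ne
  have hI := intInvSqSum_nonneg
  have scale : π * (S / q ^ 2) / 2 = gaussScale S q := by rw [gaussScale]; field_simp
  have near_zero := norm_thetaMultiplier_zero_sub_le (s := S / q ^ 2) (by positivity) (q * x)
  rw [scale] at near_zero
  set E := Complex.exp (-gaussScale S q * (round (q * x) - q * x : ℝ) ^ 2) with hE
  have eq : majorCoeff q a u x * thetaMultiplier (S / q ^ 2) 0 (q * x) -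
      majorAmplitude q a u x * E =
      majorCoeff q a u x * (thetaMultiplier (S / q ^ 2) 0 (q * x) - thetaFactor 0 * E) := by
    rw [majorCoeff]
    field_simp
  have coeff_eq : ‖majorCoeff q a u x‖ * ‖thetaFactor 0‖ = ‖majorAmplitude q a u x‖ := by
    rw [majorCoeff, norm_div, div_mul_cancel₀ _ factor_pos.ne']
  have near_zero' : ‖thetaMultiplier (S / q ^ 2) 0 (q * x) - thetaFactor 0 * E‖ ≤
      ‖thetaFactor 0‖ * (4 / gaussScale S q * intInvSqSum) := by
    rw [hE]
    push_cast at near_zero ⊢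
    exact near_zero
  rw [eq, norm_mul]
  calc _ ≤ ‖majorCoeff q a u x‖ * (‖thetaFactor 0‖ * (4 / gaussScale S q * intInvSqSum)) := by
        gcongr
    _ = ‖majorAmplitude q a u x‖ * (4 / gaussScale S q * intInvSqSum) := by
        rw [← mul_assoc, coeff_eq]
    _ ≤ majorBound q u * thetaError S q u := by
        rw [thetaError]
        gcongr
        · exact majorBound_nonneg q u
        · exact norm_majorAmplitude_le ha u x
        · exact div_le_self hσ.le (le_add_of_nonneg_right (sq_nonneg u))

theorem norm_gaussian_le_one {z : ℂ} (hz : 0 ≤ z.re) (y : ℝ) :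
    ‖Complex.exp (-z * (y : ℂ) ^ 2)‖ ≤ 1 := by
  rw [norm_exp_neg_mul_ofReal_sq]
  exact Real.exp_le_one_iff.2 (neg_nonpos.2 (by positivity))

-- Keeping one Gaussian for each coordinate, both products on the left are the arithmetic factor
-- times a product of Gaussians, with the exponents `gaussScale S q / (1 - i u)` and
-- `gaussScale S q`.
theorem norm_prod_thetaMultiplier_sub_le {d : ℕ} (ha : IsCoprime a (q : ℤ))
    (hS : q ^ 2 * max 1 (u ^ 2) ≤ S) (x : Fin d → ℝ) :
    ‖∏ i, thetaMultiplier S (a / q + u / S) (x i) -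
      (∏ i, majorCoeff q a u (x i)) * ∏ i, thetaMultiplier (S / q ^ 2) 0 (q * x i)‖ ≤
    majorBound q u ^ d * (2 * (d * thetaConst ^ d * thetaError S q u) +
      4 * min (gaussScale S q * latticeDistSq fun i => q * x i)
        ((1 + u ^ 2) / (gaussScale S q * latticeDistSq fun i => q * x i))) := by
  have hS0 : 0 < S := pos_of_sq_mul_max_le hS
  have hσ := gaussScale_pos hS0 q
  have hB := majorBound_nonneg q u
  have hε := thetaError_nonneg hS0.le q u
  have hD := one_add_thetaError_le hS
  have hc (i) := norm_majorAmplitude_le ha u (x i)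
  have truncate := norm_prod_sub_prod_mul_le hB hε hD hc
    (fun i => norm_gaussian_le_one (re_gaussScale_div_pos hS0 q u).le (round (q * x i) - q * x i))
    fun i => norm_thetaMultiplier_sub_majorAmplitude_le ha hS0 u (x i)
  have truncate_zero := norm_prod_sub_prod_mul_le hB hε hD hc
    (fun i => norm_gaussian_le_one hσ.le (round (q * x i) - q * x i))
    fun i => norm_majorCoeff_mul_thetaMultiplier_sub_le ha hS0 u (x i)
  have exponents := norm_prod_gaussian_sub_le hB hσ.le hc u fun i => round (q * x i) - q * x i
  rw [norm_sub_rev, Finset.prod_mul_distrib (f := fun i => majorCoeff q a u (x i))]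
    at truncate_zero
  refine (norm_sub_le_norm_sub_add_norm_sub _ _ _).trans <| (add_le_add truncate <|
    (norm_sub_le_norm_sub_add_norm_sub _ _ _).trans
      (add_le_add exponents truncate_zero)).trans_eq ?_
  rw [latticeDistSq]
  ring

end MajorArc

/-! ### The square function of the multiplier differences -/

/-- A bounded increasing function on `[0, ∞)`. -/
def cayley (c : ℝ) : ℝ := c / (1 + c)

/-- The increment of `cayley` from `c` to `16 * c`; along a sequence of ratio `16` it telescopes. -/
def cayleyStep (c : ℝ) : ℝ := cayley (16 * c) - cayley c

theorem cayleyStep_eq {c : ℝ} (hc : 0 ≤ c) :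
    cayleyStep c = 15 * c / ((1 + 16 * c) * (1 + c)) := by
  rw [cayleyStep, cayley, cayley]
  field_simp
  ring

theorem cayleyStep_nonneg {c : ℝ} (hc : 0 ≤ c) : 0 ≤ cayleyStep c := by
  rw [cayleyStep_eq hc]
  positivity

theorem tsum_cayleyStep_le {c : ℝ} (hc : 0 ≤ c) :
    ∑' j : ℕ, ENNReal.ofReal (cayleyStep (16 ^ j * c)) ≤ 1 := by
  refine ENNReal.tsum_le_of_sum_range_le fun N => ?_
  have telescope : ∑ j ∈ Finset.range N, cayleyStep (16 ^ j * c) =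
      cayley (16 ^ N * c) - cayley (16 ^ 0 * c) := by
    rw [← Finset.sum_range_sub fun j : ℕ => cayley (16 ^ j * c)]
    refine Finset.sum_congr rfl fun j _ => ?_
    rw [cayleyStep, ← mul_assoc, ← pow_succ']
  have le_one : cayley (16 ^ N * c) ≤ 1 := by
    rw [cayley, div_le_one (by positivity)]
    linarith
  have nonneg : 0 ≤ cayley (16 ^ 0 * c) := by
    rw [cayley]
    positivity
  rw [← ENNReal.ofReal_sum_of_nonneg fun j _ => cayleyStep_nonneg (by positivity),
    ENNReal.ofReal_le_one, telescope]
  linarith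

theorem min_inv_le_cayleyStep {c : ℝ} (hc : 0 < c) : min c (1 / c) ≤ 3 * cayleyStep c := by
  rw [cayleyStep_eq hc.le, ← mul_div_assoc]
  rcases le_total c 1 with h | h
  · refine (min_le_left _ _).trans ?_
    rw [le_div_iff₀ (by positivity)]
    nlinarith [mul_pos hc hc, mul_le_mul_of_nonneg_left h hc.le,
      mul_le_mul_of_nonneg_left h (mul_pos hc hc).le]
  · refine (min_le_right _ _).trans ?_
    rw [div_le_div_iff₀ (by positivity) (by positivity)]
    nlinarith

theorem min_sq_le_cayleyStep {X A : ℝ} (hX : 0 ≤ X) (hA : 0 < A) :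
    min X (A / X) ^ 2 ≤ 3 * A * cayleyStep (X ^ 2 / A) := by
  rcases hX.eq_or_lt with rfl | pos
  · simp [cayleyStep]
  have : 0 ≤ min X (A / X) := le_min hX (by positivity)
  have sq_le : min X (A / X) ^ 2 ≤ A * min (X ^ 2 / A) (1 / (X ^ 2 / A)) := by
    rw [mul_min_of_nonneg _ _ hA.le]
    refine le_min ?_ ?_
    · calc min X (A / X) ^ 2 ≤ X ^ 2 := by gcongr; exact min_le_left _ _
        _ = _ := by field_simp
    · calc min X (A / X) ^ 2 ≤ (A / X) ^ 2 := by gcongr; exact min_le_right _ _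
        _ = _ := by field_simp
  calc _ ≤ A * min (X ^ 2 / A) (1 / (X ^ 2 / A)) := sq_le
    _ ≤ A * (3 * cayleyStep (X ^ 2 / A)) := by
        gcongr
        exact min_inv_le_cayleyStep (by positivity)
    _ = _ := by ring

theorem one_div_sq_le_cayleyStep {R : ℝ} (hR : 0 < R) (h : 1 ≤ 2 * R ^ 2) :
    (1 / R) ^ 2 ≤ 12 * cayleyStep (R ^ 2) := by
  have le_min : 1 / R ≤ 2 * min R (1 / R) := by
    rw [mul_min_of_nonneg _ _ (by norm_num : (0 : ℝ) ≤ 2), le_min_iff]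
    constructor
    · rw [div_le_iff₀ hR]
      nlinarith
    · linarith [one_div_pos.2 hR]
  have min_sq := min_sq_le_cayleyStep hR.le one_pos
  rw [div_one] at min_sq
  calc (1 / R) ^ 2 ≤ (2 * min R (1 / R)) ^ 2 := by gcongr
    _ = 4 * min R (1 / R) ^ 2 := by ring
    _ ≤ _ := by linarith

/-- The coefficient with which the error of keeping one Gaussian enters `squareConst`. -/
def truncationConst (d : ℕ) : ℝ := 1536 * (d * thetaConst ^ d * intInvSqSum) ^ 2

theorem truncationConst_nonneg (d : ℕ) : 0 ≤ truncationConst d := by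
  rw [truncationConst]
  positivity

/-- The constant of the square function estimate for the multiplier differences. -/
def squareConst (d : ℕ) : ℝ := truncationConst d + 96

section SquareFunction

variable {d q : ℕ} [NeZero q] {a : ℤ} {u S : ℝ}

theorem norm_prod_thetaMultiplier_sub_sq_le (ha : IsCoprime a (q : ℤ))
    (hS : q ^ 2 * max 1 (u ^ 2) ≤ S) (x : Fin d → ℝ) :
    ‖∏ i, thetaMultiplier S (a / q + u / S) (x i) -
      (∏ i, majorCoeff q a u (x i)) * ∏ i, thetaMultiplier (S / q ^ 2) 0 (q * x i)‖ ^ 2 ≤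
    (majorBound q u ^ 2) ^ d * (1 + u ^ 2) *
      (truncationConst d * cayleyStep ((gaussScale S q / (1 + u ^ 2)) ^ 2) +
        96 * cayleyStep ((gaussScale S q * latticeDistSq fun i => q * x i) ^ 2 / (1 + u ^ 2))) := by
  have compare := norm_prod_thetaMultiplier_sub_le ha hS x
  have hR := pi_div_four_le hS
  set R := gaussScale S q / (1 + u ^ 2) with hR_def
  set X := gaussScale S q * latticeDistSq fun i => q * x i
  have hX : 0 ≤ X :=
    mul_nonneg (gaussScale_pos (pos_of_sq_mul_max_le hS) q).le (latticeDistSq_nonneg _)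
  have hR0 : 0 < R := lt_of_lt_of_le (by positivity) hR
  have truncation := one_div_sq_le_cayleyStep hR0 (by nlinarith [Real.pi_gt_three])
  have exponents := min_sq_le_cayleyStep hX (A := 1 + u ^ 2) (by positivity)
  have := majorBound_nonneg q u
  have hstep := cayleyStep_nonneg (sq_nonneg R)
  set M := min X ((1 + u ^ 2) / X)
  set b := (d : ℝ) * thetaConst ^ d * intInvSqSum with hb
  have error_eq : 2 * (d * thetaConst ^ d * thetaError S q u) + 4 * M =
      8 * b * (1 / R) + 4 * M := by
    rw [thetaError, ← hR_def, hb]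
    ring
  rw [error_eq] at compare
  have trunc_eq : truncationConst d = 1536 * b ^ 2 := rfl
  calc _ ≤ (majorBound q u ^ d * (8 * b * (1 / R) + 4 * M)) ^ 2 := by gcongr
    _ = (majorBound q u ^ 2) ^ d * (8 * b * (1 / R) + 4 * M) ^ 2 := by ring
    _ ≤ (majorBound q u ^ 2) ^ d * (2 * ((8 * b * (1 / R)) ^ 2 + (4 * M) ^ 2)) := by
        gcongr
        exact add_sq_le
    _ = (majorBound q u ^ 2) ^ d * (128 * b ^ 2 * (1 / R) ^ 2 + 32 * M ^ 2) := by ring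
    _ ≤ (majorBound q u ^ 2) ^ d * (128 * b ^ 2 * (12 * cayleyStep (R ^ 2)) +
          32 * (3 * (1 + u ^ 2) * cayleyStep (X ^ 2 / (1 + u ^ 2)))) := by gcongr
    _ ≤ (majorBound q u ^ 2) ^ d * ((1 + u ^ 2) * (truncationConst d * cayleyStep (R ^ 2)) +
          32 * (3 * (1 + u ^ 2) * cayleyStep (X ^ 2 / (1 + u ^ 2)))) := by
        refine mul_le_mul_of_nonneg_left ?_ (by positivity)
        rw [trunc_eq]
        nlinarith [mul_nonneg (mul_nonneg (sq_nonneg u) (sq_nonneg b)) hstep]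
    _ = _ := by ring

theorem gaussScale_four_pow_mul_sq (q : ℕ) (j : ℕ) (y : ℝ) :
    (gaussScale (4 ^ j) q * y) ^ 2 = 16 ^ j * (gaussScale 1 q * y) ^ 2 := by
  have : (16 : ℝ) ^ j = (4 ^ j) ^ 2 := by
    rw [← pow_mul, mul_comm, pow_mul]
    norm_num
  rw [gaussScale, gaussScale, this]
  ring

/-- The indices `j` for which the scale `4 ^ j` is admissible on the arc `a / q + u / 4 ^ j`. -/
def arcScales (q : ℕ) (u : ℝ) : Set ℕ := {j | (q : ℝ) ^ 2 * max 1 (u ^ 2) ≤ 4 ^ j}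

theorem tsum_enorm_multiplier_sub_sq_le (ha : IsCoprime a (q : ℤ)) (u : ℝ) (x : Fin d → ℝ) :
    ∑' j : arcScales q u, ‖∏ i, thetaMultiplier (4 ^ (j : ℕ)) (a / q + u / 4 ^ (j : ℕ)) (x i) -
      (∏ i, majorCoeff q a u (x i)) * ∏ i, thetaMultiplier (4 ^ (j : ℕ) / q ^ 2) 0 (q * x i)‖ₑ ^ 2
    ≤ ENNReal.ofReal (squareConst d * ((majorBound q u ^ 2) ^ d * (1 + u ^ 2))) := by
  set B := (majorBound q u ^ 2) ^ d * (1 + u ^ 2)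
  set K := truncationConst d
  have hK := truncationConst_nonneg d
  set c₁ := (gaussScale 1 q * (1 + u ^ 2)⁻¹) ^ 2
  set c₂ := (gaussScale 1 q * latticeDistSq fun i => q * x i) ^ 2 / (1 + u ^ 2)
  have hc₁ : 0 ≤ c₁ := by positivity
  have hc₂ : 0 ≤ c₂ := by positivity
  have pointwise (j : arcScales q u) := norm_prod_thetaMultiplier_sub_sq_le ha j.2 x
  simp_rw [div_eq_mul_inv (gaussScale _ q), gaussScale_four_pow_mul_sq, mul_div_assoc]
    at pointwise
  have hstep₁ (j : ℕ) := cayleyStep_nonneg (c := 16 ^ j * c₁) (by positivity)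
  have hstep₂ (j : ℕ) := cayleyStep_nonneg (c := 16 ^ j * c₂) (by positivity)
  calc _ ≤ ∑' j : arcScales q u, ENNReal.ofReal B *
        (ENNReal.ofReal K * ENNReal.ofReal (cayleyStep (16 ^ (j : ℕ) * c₁)) +
          ENNReal.ofReal 96 * ENNReal.ofReal (cayleyStep (16 ^ (j : ℕ) * c₂))) := by
        refine ENNReal.tsum_le_tsum fun j => ?_
        rw [← ofReal_norm, ← ENNReal.ofReal_pow (norm_nonneg _), ← ENNReal.ofReal_mul hK,
          ← ENNReal.ofReal_mul (by norm_num),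
          ← ENNReal.ofReal_add (mul_nonneg hK (hstep₁ j)) (mul_nonneg (by norm_num) (hstep₂ j)),
          ← ENNReal.ofReal_mul (by positivity)]
        exact ENNReal.ofReal_le_ofReal (pointwise j)
    _ ≤ ∑' j : ℕ, ENNReal.ofReal B *
        (ENNReal.ofReal K * ENNReal.ofReal (cayleyStep (16 ^ j * c₁)) +
          ENNReal.ofReal 96 * ENNReal.ofReal (cayleyStep (16 ^ j * c₂))) :=
        ENNReal.tsum_comp_le_tsum_of_injective Subtype.val_injective _
    _ = ENNReal.ofReal B * (ENNReal.ofReal K * ∑' j, ENNReal.ofReal (cayleyStep (16 ^ j * c₁)) +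
          ENNReal.ofReal 96 * ∑' j, ENNReal.ofReal (cayleyStep (16 ^ j * c₂))) := by
        simp_rw [ENNReal.tsum_mul_left, ENNReal.tsum_add, ENNReal.tsum_mul_left]
    _ ≤ ENNReal.ofReal B * (ENNReal.ofReal K * 1 + ENNReal.ofReal 96 * 1) := by
        gcongr
        · exact tsum_cayleyStep_le hc₁
        · exact tsum_cayleyStep_le hc₂
    _ = _ := by
        rw [mul_one, mul_one, ← ENNReal.ofReal_add hK (by norm_num),
          ← ENNReal.ofReal_mul (by positivity), mul_comm]
        rfl

end SquareFunction

/-! ### The maximal inequality near a fixed rational -/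

/-- Convolution with `thetaKernelPi S t`. -/
def thetaConv {d : ℕ} (S t : ℝ) (f : (Fin d → ℤ) → ℂ) (x : Fin d → ℤ) : ℂ :=
  ∑' m, thetaKernelPi S t m * f (x - m)

/-- The maximal function of the theta kernels at the points `a / q + u / 4 ^ j`, over the
admissible scales. -/
def arcMaximal {d : ℕ} (q : ℕ) (a : ℤ) (u : ℝ) (f : (Fin d → ℤ) → ℂ) (x : Fin d → ℤ) : ℝ≥0∞ :=
  ⨆ j : arcScales q u, ‖thetaConv (4 ^ (j : ℕ)) (a / q + u / 4 ^ (j : ℕ)) f x‖ₑ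

theorem ennreal_add_sq_le (a b : ℝ≥0∞) : (a + b) ^ 2 ≤ 2 * (a ^ 2 + b ^ 2) := by
  rcases eq_or_ne a ∞ with rfl | ha
  · simp
  rcases eq_or_ne b ∞ with rfl | hb
  · simp
  lift a to ℝ≥0 using ha
  lift b to ℝ≥0 using hb
  have h : ((a : ℝ) + b) ^ 2 ≤ 2 * ((a : ℝ) ^ 2 + (b : ℝ) ^ 2) := add_sq_le
  exact_mod_cast h

theorem norm_majorCoeff_sq_le {q : ℕ} [NeZero q] {a : ℤ} (ha : IsCoprime a (q : ℤ)) (u x : ℝ) :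
    ‖majorCoeff q a u x‖ ^ 2 ≤ 2 * majorBound q u ^ 2 := by
  have factor_zero : ‖thetaFactor 0‖ ^ 2 = 1 / 2 := by rw [norm_thetaFactor_sq]; simp
  have : ‖majorAmplitude q a u x‖ ^ 2 ≤ majorBound q u ^ 2 := by
    gcongr
    exact norm_majorAmplitude_le ha u x
  rw [majorCoeff, norm_div, div_pow, factor_zero]
  linarith

theorem measurable_majorCoeff (q : ℕ) [NeZero q] (a : ℤ) (u : ℝ) :
    Measurable (majorCoeff q a u) := by
  have measurable_round : Measurable fun x : ℝ => (round (q * x) : ℤ) := by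
    simp_rw [round_eq]
    fun_prop
  unfold majorCoeff majorAmplitude
  exact ((measurable_from_top (f := fun n : ℤ => quadGaussSum q a n)).comp
    measurable_round).const_mul _ |>.div_const _

section ArcMaximal

open UnitAddTorus

attribute [local instance] instMeasureSpaceUnitAddCircle
attribute [local instance] instIsProbabilityMeasureUnitAddCircleVolume

variable {d : ℕ}

theorem lintegral_enorm_mul_sq_le {g F : UnitAddTorus (Fin d) → ℂ} {C : ℝ≥0∞}
    (hg : ∀ ξ, ‖g ξ‖ₑ ^ 2 ≤ C) (hF : Measurable F) :
    ∫⁻ ξ, ‖g ξ * F ξ‖ₑ ^ 2 ≤ C * ∫⁻ ξ, ‖F ξ‖ₑ ^ 2 := by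
  rw [← lintegral_const_mul _ (by fun_prop)]
  refine lintegral_mono fun ξ => ?_
  rw [enorm_mul, mul_pow]
  exact mul_le_mul' (hg ξ) le_rfl

theorem tsum_tsum_enorm_mFourierCoeff_mul_sq_le {ι : Type*} [Countable ι]
    {Δ : ι → UnitAddTorus (Fin d) → ℂ} {F : UnitAddTorus (Fin d) → ℂ}
    (hΔ : ∀ j, IsBoundedMeasurable (Δ j)) (hF : IsBoundedMeasurable F) {C : ℝ≥0∞}
    (hC : ∀ ξ, ∑' j, ‖Δ j ξ‖ₑ ^ 2 ≤ C) :
    ∑' x, ∑' j, ‖mFourierCoeff (fun ξ => Δ j ξ * F ξ) x‖ₑ ^ 2 ≤ C * ∫⁻ ξ, ‖F ξ‖ₑ ^ 2 := by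
  have hFm := hF.measurable
  have measurable_term (j) : Measurable fun ξ => ‖Δ j ξ * F ξ‖ₑ ^ 2 := by
    have := (hΔ j).measurable
    fun_prop
  rw [ENNReal.tsum_comm]
  simp_rw [((hΔ _).mul hF).tsum_enorm_mFourierCoeff_sq]
  rw [← lintegral_tsum fun j => (measurable_term j).aemeasurable,
    ← lintegral_const_mul _ (by fun_prop)]
  refine lintegral_mono fun ξ => ?_
  simp_rw [enorm_mul, mul_pow]
  rw [ENNReal.tsum_mul_right]
  exact mul_le_mul' (hC ξ) le_rfl

/-- The arithmetic factor of the multiplier near `a / q`, as a function on the torus. -/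
def majorMultiplier (q : ℕ) [NeZero q] (a : ℤ) (u : ℝ) (ξ : UnitAddTorus (Fin d)) : ℂ :=
  ∏ i, majorCoeff q a u (circleRep (ξ i))

/-- The Fourier multiplier of the kernel `thetaKernelPi S t` placed on the lattice `q ℤ^d`. -/
def thetaSymbol (S t : ℝ) (q : ℤ) (ξ : UnitAddTorus (Fin d)) : ℂ :=
  ∑' m, thetaKernelPi S t m * mFourier (q • m) ξ

/-- The difference of the two multipliers compared in `norm_prod_thetaMultiplier_sub_le`. -/
def symbolError (q : ℕ) [NeZero q] (a : ℤ) (u S : ℝ) (ξ : UnitAddTorus (Fin d)) : ℂ :=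
  thetaSymbol S (a / q + u / S) 1 ξ - majorMultiplier q a u ξ * thetaSymbol (S / q ^ 2) 0 q ξ

theorem isBoundedMeasurable_thetaSymbol {S : ℝ} (hS : 0 < S) (t : ℝ) (q : ℤ) :
    IsBoundedMeasurable (thetaSymbol (d := d) S t q) :=
  .of_continuous (continuous_tsum_mFourier (summable_norm_thetaKernelPi hS t) q)

variable {q : ℕ} [NeZero q] {a : ℤ} {u S : ℝ} {F : UnitAddTorus (Fin d) → ℂ}

theorem norm_majorMultiplier_sq_le (ha : IsCoprime a (q : ℤ)) (u : ℝ)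
    (ξ : UnitAddTorus (Fin d)) :
    ‖majorMultiplier q a u ξ‖ ^ 2 ≤ 2 ^ d * (majorBound q u ^ 2) ^ d := by
  rw [majorMultiplier, norm_prod, ← Finset.prod_pow, ← mul_pow]
  calc _ ≤ ∏ _i : Fin d, 2 * majorBound q u ^ 2 :=
        Finset.prod_le_prod (fun i _ => by positivity) fun i _ => norm_majorCoeff_sq_le ha u _
    _ = _ := by rw [Finset.prod_const, Finset.card_univ, Fintype.card_fin]

theorem isBoundedMeasurable_majorMultiplier (ha : IsCoprime a (q : ℤ)) (u : ℝ) :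
    IsBoundedMeasurable (majorMultiplier (d := d) q a u) where
  measurable := Finset.measurable_fun_prod _ fun i _ =>
    (measurable_majorCoeff q a u).comp (measurable_circleRep.comp (measurable_pi_apply i))
  bounded := ⟨_, fun ξ => Real.le_sqrt_of_sq_le (norm_majorMultiplier_sq_le ha u ξ)⟩

theorem isBoundedMeasurable_symbolError (ha : IsCoprime a (q : ℤ)) (hS : 0 < S) (u : ℝ) :
    IsBoundedMeasurable (symbolError (d := d) q a u S) := by
  have : (0 : ℝ) < q := Nat.cast_pos.2 (NeZero.pos q)
  exact (isBoundedMeasurable_thetaSymbol hS _ _).sub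
    ((isBoundedMeasurable_majorMultiplier ha u).mul
      (isBoundedMeasurable_thetaSymbol (by positivity) _ _))

theorem thetaConv_mFourierCoeff (ha : IsCoprime a (q : ℤ)) (hS : 0 < S) (u : ℝ)
    (hF : IsBoundedMeasurable F) (x : Fin d → ℤ) :
    thetaConv S (a / q + u / S) (mFourierCoeff F) x =
      mFourierCoeff (fun ξ => symbolError q a u S ξ * F ξ) x +
        ∑' m, thetaKernelPi (S / q ^ 2) 0 m *
          mFourierCoeff (fun ξ => majorMultiplier q a u ξ * F ξ) (x - (q : ℤ) • m) := by
  have hq : (0 : ℝ) < q := Nat.cast_pos.2 (NeZero.pos q)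
  have hS' : 0 < S / q ^ 2 := by positivity
  have hMF := (isBoundedMeasurable_majorMultiplier ha u).mul hF
  have smul_integrable {g : UnitAddTorus (Fin d) → ℂ} (hg : IsBoundedMeasurable g) :
      Integrable fun ξ => mFourier (-x) ξ • g ξ :=
    ((IsBoundedMeasurable.of_continuous (by fun_prop)).mul hg).integrable
  have full : ∑' m, thetaKernelPi S (a / q + u / S) m * mFourierCoeff F (x - (1 : ℤ) • m) =
      mFourierCoeff (fun ξ => thetaSymbol S (a / q + u / S) 1 ξ * F ξ) x :=
    (hasSum_mul_mFourierCoeff (summable_norm_thetaKernelPi hS _) hF.integrable 1 x).tsum_eq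
  have model : ∑' m, thetaKernelPi (S / q ^ 2) 0 m *
        mFourierCoeff (fun ξ => majorMultiplier q a u ξ * F ξ) (x - (q : ℤ) • m) =
      mFourierCoeff (fun ξ => thetaSymbol (S / q ^ 2) 0 q ξ * (majorMultiplier q a u ξ * F ξ)) x :=
    (hasSum_mul_mFourierCoeff (summable_norm_thetaKernelPi hS' 0) hMF.integrable q x).tsum_eq
  simp only [one_smul] at full
  rw [thetaConv, full, model]
  simp only [mFourierCoeff]
  rw [← integral_add
    (smul_integrable ((isBoundedMeasurable_symbolError ha hS u).mul hF))
    (smul_integrable ((isBoundedMeasurable_thetaSymbol hS' 0 q).mul hMF))]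
  refine integral_congr_ae (Filter.Eventually.of_forall fun ξ => ?_)
  simp only [symbolError, smul_eq_mul]
  ring

theorem tsum_enorm_symbolError_sq_le (ha : IsCoprime a (q : ℤ)) (u : ℝ)
    (ξ : UnitAddTorus (Fin d)) :
    ∑' j : arcScales q u, ‖symbolError q a u (4 ^ (j : ℕ)) ξ‖ₑ ^ 2 ≤
      ENNReal.ofReal (squareConst d * ((majorBound q u ^ 2) ^ d * (1 + u ^ 2))) := by
  have hq : (0 : ℝ) < q := Nat.cast_pos.2 (NeZero.pos q)
  refine le_of_eq_of_le (tsum_congr fun j => ?_)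
    (tsum_enorm_multiplier_sub_sq_le ha u fun i => circleRep (ξ i))
  rw [symbolError, thetaSymbol, thetaSymbol, tsum_thetaKernelPi_mul_mFourier (by positivity),
    tsum_thetaKernelPi_mul_mFourier (by positivity), majorMultiplier]
  simp only [Int.cast_one, one_mul, Int.cast_natCast]

/-- The maximal function left after the square function of the errors has been removed: it
averages over the lattice `q ℤ^d` with tent kernels. -/
def modelMaximal (q : ℕ) (u : ℝ) (G : (Fin d → ℤ) → ℂ) (x : Fin d → ℤ) : ℝ≥0∞ :=
  ⨆ j : arcScales q u, ∑' m, tentKernelPi √(4 ^ (j : ℕ) / q ^ 2) m * ‖G (x - (q : ℤ) • m)‖ₑ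

theorem tsum_modelMaximal_sq_le (q : ℕ) [NeZero q] (u : ℝ) (G : (Fin d → ℤ) → ℂ) :
    ∑' x, modelMaximal q u G x ^ 2 ≤ 4 * ((2 * 96 ^ d) ^ 2 * ∑' y, ‖G y‖ₑ ^ 2) := by
  have hq : (0 : ℝ) < q := Nat.cast_pos.2 (NeZero.pos q)
  refine tsum_iSup_tentKernelPi_smul_sq_le q (fun j => ?_) fun y => ‖G y‖ₑ
  rw [Real.one_le_sqrt, one_le_div (by positivity)]
  exact (le_mul_of_one_le_right (by positivity) (le_max_left _ _)).trans j.2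

theorem enorm_tsum_thetaKernelPi_smul_le (q : ℕ) [NeZero q] {u : ℝ} (j : arcScales q u)
    (G : (Fin d → ℤ) → ℂ) (x : Fin d → ℤ) :
    ‖∑' m, thetaKernelPi (4 ^ (j : ℕ) / q ^ 2) 0 m * G (x - (q : ℤ) • m)‖ₑ ≤
      2 ^ d * modelMaximal q u G x := by
  have hq : (0 : ℝ) < q := Nat.cast_pos.2 (NeZero.pos q)
  calc _ ≤ ∑' m, ‖thetaKernelPi (4 ^ (j : ℕ) / q ^ 2) 0 m * G (x - (q : ℤ) • m)‖ₑ :=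
        enorm_tsum_le_tsum_enorm
    _ ≤ ∑' m, 2 ^ d * (tentKernelPi √(4 ^ (j : ℕ) / q ^ 2) m * ‖G (x - (q : ℤ) • m)‖ₑ) := by
        refine ENNReal.tsum_le_tsum fun m => ?_
        rw [enorm_mul, ← mul_assoc]
        exact mul_le_mul' (enorm_thetaKernelPi_le_tentKernelPi (by positivity) _ _) le_rfl
    _ ≤ _ := by
        rw [ENNReal.tsum_mul_left]
        gcongr
        exact le_iSup (fun j : arcScales q u =>
          ∑' m, tentKernelPi √(4 ^ (j : ℕ) / q ^ 2) m * ‖G (x - (q : ℤ) • m)‖ₑ) j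

theorem arcMaximal_sq_le (ha : IsCoprime a (q : ℤ)) (u : ℝ) (hF : IsBoundedMeasurable F)
    (x : Fin d → ℤ) :
    arcMaximal q a u (mFourierCoeff F) x ^ 2 ≤
      2 * (∑' j : arcScales q u,
          ‖mFourierCoeff (fun ξ => symbolError q a u (4 ^ (j : ℕ)) ξ * F ξ) x‖ₑ ^ 2 +
        (2 ^ d) ^ 2 *
          modelMaximal q u (mFourierCoeff fun ξ => majorMultiplier q a u ξ * F ξ) x ^ 2) := by
  rw [arcMaximal, ENNReal.iSup_pow_of_ne_zero two_ne_zero]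
  refine iSup_le fun j => ?_
  rw [thetaConv_mFourierCoeff ha (by positivity) u hF, ← mul_pow]
  calc _ ≤ (‖mFourierCoeff (fun ξ => symbolError q a u (4 ^ (j : ℕ)) ξ * F ξ) x‖ₑ + 2 ^ d *
          modelMaximal q u (mFourierCoeff fun ξ => majorMultiplier q a u ξ * F ξ) x) ^ 2 := by
        gcongr
        exact (enorm_add_le _ _).trans
          (add_le_add le_rfl (enorm_tsum_thetaKernelPi_smul_le q j _ x))
    _ ≤ _ := (ennreal_add_sq_le _ _).trans (by
        gcongr
        exact ENNReal.le_tsum (f := fun j : arcScales q u =>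
          ‖mFourierCoeff (fun ξ => symbolError q a u (4 ^ (j : ℕ)) ξ * F ξ) x‖ₑ ^ 2) j)

/-- The constant of the maximal inequality near a fixed rational. -/
def arcConst (d : ℕ) : ℝ≥0 :=
  2 * ((squareConst d).toNNReal + (2 ^ d) ^ 2 * (4 * ((2 * 96 ^ d) ^ 2 * 2 ^ d)))

theorem tsum_arcMaximal_mFourierCoeff_sq_le (ha : IsCoprime a (q : ℤ)) (u : ℝ)
    (hF : IsBoundedMeasurable F) :
    ∑' x, arcMaximal q a u (mFourierCoeff F) x ^ 2 ≤
      arcConst d * ENNReal.ofReal ((majorBound q u ^ 2) ^ d * (1 + u ^ 2)) *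
        ∑' x, ‖mFourierCoeff F x‖ₑ ^ 2 := by
  set β := (majorBound q u ^ 2) ^ d
  have hβ : 0 ≤ β := by positivity
  set N := ∫⁻ ξ, ‖F ξ‖ₑ ^ 2
  set G := mFourierCoeff fun ξ => majorMultiplier q a u ξ * F ξ
  have hsquare : 0 ≤ squareConst d := add_nonneg (truncationConst_nonneg d) (by norm_num)
  have errors : ∑' x, ∑' j : arcScales q u,
      ‖mFourierCoeff (fun ξ => symbolError q a u (4 ^ (j : ℕ)) ξ * F ξ) x‖ₑ ^ 2 ≤
      ENNReal.ofReal (squareConst d * (β * (1 + u ^ 2))) * N :=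
    tsum_tsum_enorm_mFourierCoeff_mul_sq_le
      (fun j => isBoundedMeasurable_symbolError ha (by positivity) u) hF
      (tsum_enorm_symbolError_sq_le ha u)
  have model : ∑' x, ‖G x‖ₑ ^ 2 ≤ 2 ^ d * ENNReal.ofReal (β * (1 + u ^ 2)) * N := by
    have two_pow : (2 : ℝ≥0∞) ^ d = ENNReal.ofReal (2 ^ d) := by
      rw [ENNReal.ofReal_pow (by norm_num), ENNReal.ofReal_ofNat]
    rw [((isBoundedMeasurable_majorMultiplier ha u).mul hF).tsum_enorm_mFourierCoeff_sq]
    refine lintegral_enorm_mul_sq_le (fun ξ => ?_) hF.measurable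
    rw [← ofReal_norm, ← ENNReal.ofReal_pow (norm_nonneg _), two_pow,
      ← ENNReal.ofReal_mul (by positivity)]
    refine ENNReal.ofReal_le_ofReal ((norm_majorMultiplier_sq_le ha u ξ).trans ?_)
    gcongr
    exact le_mul_of_one_le_right hβ (le_add_of_nonneg_right (sq_nonneg u))
  rw [hF.tsum_enorm_mFourierCoeff_sq]
  calc _ ≤ ∑' x, 2 * (∑' j : arcScales q u,
          ‖mFourierCoeff (fun ξ => symbolError q a u (4 ^ (j : ℕ)) ξ * F ξ) x‖ₑ ^ 2 +
          (2 ^ d) ^ 2 * modelMaximal q u G x ^ 2) :=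
        ENNReal.tsum_le_tsum (arcMaximal_sq_le ha u hF)
    _ = 2 * (∑' x, ∑' j : arcScales q u,
          ‖mFourierCoeff (fun ξ => symbolError q a u (4 ^ (j : ℕ)) ξ * F ξ) x‖ₑ ^ 2 +
          (2 ^ d) ^ 2 * ∑' x, modelMaximal q u G x ^ 2) := by
        simp_rw [ENNReal.tsum_mul_left, ENNReal.tsum_add, ENNReal.tsum_mul_left]
    _ ≤ 2 * (ENNReal.ofReal (squareConst d * (β * (1 + u ^ 2))) * N + (2 ^ d) ^ 2 *
          (4 * ((2 * 96 ^ d) ^ 2 * (2 ^ d * ENNReal.ofReal (β * (1 + u ^ 2)) * N)))) := by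
        gcongr
        exact (tsum_modelMaximal_sq_le q u G).trans (by gcongr)
    _ = _ := by
        rw [ENNReal.ofReal_mul hsquare, arcConst, ← ENNReal.ofNNReal_toNNReal]
        push_cast
        ring

theorem tsum_arcMaximal_sq_le (ha : IsCoprime a (q : ℤ)) (u : ℝ) {s : Finset (Fin d → ℤ)}
    {f : (Fin d → ℤ) → ℂ} (hf : ∀ n ∉ s, f n = 0) :
    ∑' x, arcMaximal q a u f x ^ 2 ≤
      arcConst d * ENNReal.ofReal ((majorBound q u ^ 2) ^ d * (1 + u ^ 2)) * ∑' x, ‖f x‖ₑ ^ 2 := by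
  have f_eq : mFourierCoeff (fun t => ∑ n ∈ s, f n * mFourier n t) = f :=
    funext (mFourierCoeff_sum s f hf)
  have h := tsum_arcMaximal_mFourierCoeff_sq_le ha u
    (F := fun t => ∑ n ∈ s, f n * mFourier n t) (.of_continuous (by fun_prop))
  rwa [f_eq] at h

end ArcMaximal

/-! ### Covering the circle by arcs around rationals -/

theorem abs_le_one_of_abs_cast_lt {r : ℚ} (hr : |(r : ℝ)| < 1 + 1 / r.den) : |r| ≤ 1 := by
  have hden : (0 : ℝ) < r.den := Nat.cast_pos.2 r.pos
  have num_eq : |(r : ℝ)| * r.den = ((|r|.num : ℤ) : ℝ) := by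
    rw [← Rat.cast_abs, Rat.cast_def |r|, Rat.den_abs_eq_den, div_mul_cancel₀ _ hden.ne']
  have num_lt : ((|r|.num : ℤ) : ℝ) < r.den + 1 := by
    have := mul_lt_mul_of_pos_right hr hden
    rwa [num_eq, add_mul, one_mul, one_div_mul_cancel hden.ne'] at this
  rw [← Rat.num_le_denom_iff, Rat.den_abs_eq_den]
  exact Int.lt_add_one_iff.1 (by exact_mod_cast num_lt)

theorem exists_rat_den_sq_mul_le {S : ℝ} (hS : 1 ≤ S) {t : ℝ} (ht : |t| ≤ 1) :
    ∃ r : ℚ, |r| ≤ 1 ∧ (r.den : ℝ) ^ 2 * max 1 ((S * (t - r)) ^ 2) ≤ S := by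
  have hS0 : 0 < S := by linarith
  have one_le_sqrt : 1 ≤ √S := Real.one_le_sqrt.2 hS
  obtain ⟨r, hr, hden⟩ := Real.exists_rat_abs_sub_le_and_den_le t (Nat.floor_pos.2 one_le_sqrt)
  have hden0 : (0 : ℝ) < r.den := Nat.cast_pos.2 r.pos
  have den_le : (r.den : ℝ) ≤ √S := (Nat.cast_le.2 hden).trans (Nat.floor_le (by linarith))
  have dist_le : |t - r| ≤ 1 / (√S * r.den) := by
    refine hr.trans (one_div_le_one_div_of_le (by positivity) ?_)
    gcongr
    exact (Nat.lt_floor_add_one _).le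
  refine ⟨r, abs_le_one_of_abs_cast_lt ?_, ?_⟩
  · have dist_lt : |t - r| < 1 / r.den := by
      refine hr.trans_lt (one_div_lt_one_div_of_lt hden0 (lt_mul_of_one_lt_left hden0 ?_))
      exact lt_add_of_pos_left 1 (Nat.cast_pos.2 (Nat.floor_pos.2 one_le_sqrt))
    have : |(r : ℝ)| ≤ |t| + |t - r| := by simpa only [sub_sub_cancel] using abs_sub t (t - r)
    linarith
  rw [mul_max_of_nonneg _ _ (by positivity), max_le_iff, mul_one]
  constructor
  · calc (r.den : ℝ) ^ 2 ≤ √S ^ 2 := by gcongr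
      _ = S := Real.sq_sqrt hS0.le
  · calc (r.den : ℝ) ^ 2 * (S * (t - r)) ^ 2 = (r.den * S) ^ 2 * |t - r| ^ 2 := by
          rw [sq_abs]; ring
      _ ≤ (r.den * S) ^ 2 * (1 / (√S * r.den)) ^ 2 := by gcongr
      _ = S ^ 2 / √S ^ 2 := by field_simp
      _ = S := by rw [Real.sq_sqrt hS0.le]; field_simp

/-- The measure space of all arcs around rationals in `[-1, 1]`: the pair `(r, u)` stands for the
point `r + u / S` of the circle at scale `S`. -/
def arcMeasure : Measure (ℚ × ℝ) :=
  ((Measure.count : Measure ℚ).restrict {r | |r| ≤ 1}).prod volume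

/-- The arcs of height `S`. By Dirichlet's theorem their images `r + u / S` cover `[-1, 1]`. -/
def arcRegion (S : ℝ) : Set (ℚ × ℝ) := {p | (p.1.den : ℝ) ^ 2 * max 1 (p.2 ^ 2) ≤ S}

theorem measurable_rat_prod {β : Type*} [MeasurableSpace β] {g : ℚ × ℝ → β}
    (hg : ∀ r, Measurable fun u => g (r, u)) : Measurable g :=
  measurable_from_prod_countable_right hg

theorem measurable_den_fst : Measurable fun p : ℚ × ℝ => (p.1.den : ℝ) :=
  (measurable_of_countable fun r : ℚ => (r.den : ℝ)).comp measurable_fst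

theorem measurableSet_arcRegion (S : ℝ) : MeasurableSet (arcRegion S) := by
  have := measurable_den_fst
  exact measurableSet_le (by fun_prop) measurable_const

theorem lintegral_comp_add_div {g : ℝ → ℝ≥0∞} (hg : Measurable g) (r : ℝ) {S : ℝ} (hS : 0 < S) :
    ∫⁻ u, g (r + u / S) = ENNReal.ofReal S * ∫⁻ t, g t := by
  have as_map : ∫⁻ u, g (r + u / S) =
      ∫⁻ t, g (r + t) ∂(Measure.map (fun x => S⁻¹ * x) volume) := by
    rw [lintegral_map (by fun_prop) (by fun_prop)]
    simp_rw [div_eq_inv_mul]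
  rw [as_map, Real.map_volume_mul_left (inv_ne_zero hS.ne'), lintegral_smul_measure,
    lintegral_add_left_eq_self (fun t => g t) r, inv_inv, abs_of_pos hS]
  rfl

theorem setLIntegral_arcRegion {S : ℝ} (hS : 0 < S) {φ : ℝ → ℝ≥0∞} (hφ : Measurable φ) :
    ∫⁻ p in arcRegion S, φ (p.1 + p.2 / S) ∂arcMeasure =
      ENNReal.ofReal S * ∫⁻ p, (arcRegion S).indicator 1 (p.1, S * (p.2 - p.1)) * φ p.2
        ∂arcMeasure := by
  have indicator_measurable : Measurable ((arcRegion S).indicator (1 : ℚ × ℝ → ℝ≥0∞)) :=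
    measurable_const.indicator (measurableSet_arcRegion S)
  have slice_measurable (r : ℚ) : Measurable fun t : ℝ =>
      (arcRegion S).indicator (1 : ℚ × ℝ → ℝ≥0∞) (r, S * (t - r)) * φ t :=
    (indicator_measurable.comp (by fun_prop)).mul hφ
  have slice_measurable' (r : ℚ) : Measurable fun u : ℝ =>
      (arcRegion S).indicator (fun p : ℚ × ℝ => φ (p.1 + p.2 / S)) (r, u) :=
    (Measurable.indicator (measurable_rat_prod fun r => hφ.comp (by fun_prop))
      (measurableSet_arcRegion S)).comp (by fun_prop)
  rw [← lintegral_indicator (measurableSet_arcRegion S), arcMeasure,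
    lintegral_prod _ (measurable_rat_prod slice_measurable').aemeasurable,
    lintegral_prod _ (measurable_rat_prod slice_measurable).aemeasurable,
    ← lintegral_const_mul _ (measurable_of_countable _)]
  refine lintegral_congr fun r => ?_
  simp only
  rw [← lintegral_comp_add_div (slice_measurable r) r hS]
  refine lintegral_congr fun u => ?_
  have unscale : S * ((r + u / S) - r) = u := by field_simp; ring
  rw [unscale]
  by_cases hu : (r, u) ∈ arcRegion S <;> simp [hu]

theorem lintegral_le_setLIntegral_arcRegion {S : ℝ} (hS : 1 ≤ S) {φ : ℝ → ℝ≥0∞}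
    (hφ : Measurable φ) :
    ENNReal.ofReal S * ∫⁻ t in Set.Icc (-1 : ℝ) 1, φ t ≤
      ∫⁻ p in arcRegion S, φ (p.1 + p.2 / S) ∂arcMeasure := by
  have integrand_measurable : Measurable fun p : ℚ × ℝ =>
      (arcRegion S).indicator (1 : ℚ × ℝ → ℝ≥0∞) (p.1, S * (p.2 - p.1)) * φ p.2 :=
    measurable_rat_prod fun r => ((measurable_const.indicator
      (measurableSet_arcRegion S)).comp (by fun_prop)).mul hφ
  rw [setLIntegral_arcRegion (by linarith) hφ, arcMeasure,
    lintegral_prod_symm _ integrand_measurable.aemeasurable,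
    ← lintegral_indicator measurableSet_Icc]
  gcongr with t
  by_cases ht : t ∈ Set.Icc (-1 : ℝ) 1
  · obtain ⟨r, hr, hmem⟩ := exists_rat_den_sq_mul_le hS (abs_le.2 ht)
    have mem_region : (r, S * (t - r)) ∈ arcRegion S := hmem
    rw [Set.indicator_of_mem ht, ← lintegral_indicator (Set.to_countable _).measurableSet,
      lintegral_count]
    refine le_trans ?_ (ENNReal.le_tsum r)
    rw [Set.indicator_of_mem (by exact hr), Set.indicator_of_mem mem_region, Pi.one_apply, one_mul]
  · rw [Set.indicator_of_notMem ht]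
    exact zero_le

/-! ### The weights of the arcs -/

/-- The weight `q^(-5/2) (1 + u²)^(-3/4)` of the point at rescaled distance `u` from a rational of
denominator `q`. It dominates the multiplier there in every dimension `d ≥ 5`, and it is
summable over all arcs. -/
def arcWeight (q : ℕ) (u : ℝ) : ℝ := (q : ℝ) ^ (-(5 / 2) : ℝ) * (1 + u ^ 2) ^ (-(3 / 4) : ℝ)

theorem arcWeight_pos (q : ℕ) [NeZero q] (u : ℝ) : 0 < arcWeight q u := by
  have : (0 : ℝ) < q := Nat.cast_pos.2 (NeZero.pos q)
  rw [arcWeight]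
  positivity

theorem majorBound_le_one (q : ℕ) [NeZero q] (u : ℝ) : majorBound q u ≤ 1 := by
  have one_le_den : (1 : ℝ) ≤ q := Nat.one_le_cast.2 (NeZero.pos q)
  have one_le_sqrt : 1 ≤ √(1 + u ^ 2) := Real.one_le_sqrt.2 (le_add_of_nonneg_right (sq_nonneg u))
  rw [← sq_le_one_iff₀ (majorBound_nonneg q u), majorBound_sq]
  exact inv_le_one_of_one_le₀ (one_le_mul_of_one_le_of_one_le one_le_den one_le_sqrt)

theorem majorBound_pow_five (q : ℕ) [NeZero q] (u : ℝ) :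
    majorBound q u ^ 5 = (q : ℝ) ^ (-(5 / 2) : ℝ) * (1 + u ^ 2) ^ (-(5 / 4) : ℝ) := by
  have hu : 0 < 1 + u ^ 2 := by positivity
  calc majorBound q u ^ 5 = (majorBound q u ^ 2) ^ (5 / 2 : ℝ) := by
        rw [← Real.rpow_natCast, ← Real.rpow_natCast, ← Real.rpow_mul (majorBound_nonneg q u)]
        norm_num
    _ = (q : ℝ) ^ (-(5 / 2) : ℝ) * ((1 + u ^ 2) ^ (1 / 2 : ℝ)) ^ (-(5 / 2) : ℝ) := by
        rw [majorBound_sq, Real.inv_rpow (by positivity), ← Real.rpow_neg (by positivity),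
          Real.mul_rpow (by positivity) (by positivity), Real.sqrt_eq_rpow]
    _ = _ := by
        rw [← Real.rpow_mul hu.le]
        norm_num

theorem majorBound_pow_le_arcWeight {d : ℕ} (hd : 5 ≤ d) (q : ℕ) [NeZero q] (u : ℝ) :
    majorBound q u ^ d ≤ arcWeight q u := by
  refine (pow_le_pow_of_le_one (majorBound_nonneg q u) (majorBound_le_one q u) hd).trans ?_
  rw [majorBound_pow_five, arcWeight]
  gcongr
  · exact le_add_of_nonneg_right (sq_nonneg u)
  · norm_num

theorem majorBound_sq_pow_mul_le_arcWeight_sq {d : ℕ} (hd : 5 ≤ d) (q : ℕ) [NeZero q] (u : ℝ) :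
    (majorBound q u ^ 2) ^ d * (1 + u ^ 2) ≤ arcWeight q u ^ 2 := by
  have hu : 0 < 1 + u ^ 2 := by positivity
  have exponents : ((1 + u ^ 2) ^ (-(5 / 4) : ℝ)) ^ 2 * (1 + u ^ 2) =
      ((1 + u ^ 2) ^ (-(3 / 4) : ℝ)) ^ 2 := by
    rw [← Real.rpow_mul_natCast hu.le, ← Real.rpow_mul_natCast hu.le, ← Real.rpow_add_one hu.ne']
    norm_num
  calc (majorBound q u ^ 2) ^ d * (1 + u ^ 2) ≤ (majorBound q u ^ 5) ^ 2 * (1 + u ^ 2) := by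
        rw [← pow_mul, ← pow_mul]
        gcongr ?_ * _
        exact pow_le_pow_of_le_one (majorBound_nonneg q u) (majorBound_le_one q u) (by omega)
    _ = _ := by rw [majorBound_pow_five, arcWeight, mul_pow, mul_pow, mul_assoc, exponents]

theorem tsum_int_abs_le (q : ℕ) (c : ℝ≥0∞) :
    ∑' a : ℤ, (if |a| ≤ q then c else 0) = ((2 * q + 1 : ℕ) : ℝ≥0∞) * c := by
  rw [tsum_eq_sum (s := Finset.Icc (-(q : ℤ)) q) fun a ha => if_neg (by
      rwa [Finset.mem_Icc, ← abs_le] at ha),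
    Finset.sum_congr rfl fun a ha => if_pos (abs_le.2 (Finset.mem_Icc.1 ha)),
    Finset.sum_const, Int.card_Icc, nsmul_eq_mul,
    show ((q : ℤ) + 1 - -(q : ℤ)).toNat = 2 * q + 1 by omega]

theorem summable_two_mul_add_one_rpow :
    Summable fun q : ℕ => ((2 * q + 1 : ℕ) : ℝ) * (q : ℝ) ^ (-(5 / 2) : ℝ) := by
  have dominating : Summable fun q : ℕ => 3 * (q : ℝ) ^ (-(3 / 2) : ℝ) :=
    (Real.summable_nat_rpow.2 (by norm_num)).mul_left 3
  refine dominating.of_nonneg_of_le (fun q => by positivity) fun q => ?_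
  rcases Nat.eq_zero_or_pos q with rfl | hq
  · norm_num [Real.zero_rpow]
  have hq1 : (1 : ℝ) ≤ q := Nat.one_le_cast.2 hq
  calc ((2 * q + 1 : ℕ) : ℝ) * (q : ℝ) ^ (-(5 / 2) : ℝ)
      ≤ 3 * q * (q : ℝ) ^ (-(5 / 2) : ℝ) := by
        gcongr
        push_cast
        linarith
    _ = 3 * (q : ℝ) ^ (-(3 / 2) : ℝ) := by
        rw [mul_assoc, mul_comm (q : ℝ), ← Real.rpow_add_one (by positivity)]
        norm_num

theorem tsum_rat_den_rpow_ne_top :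
    ∑' r : ℚ, (if |r| ≤ 1 then ENNReal.ofReal ((r.den : ℝ) ^ (-(5 / 2) : ℝ)) else 0) ≠ ∞ := by
  have injective_den_num : Function.Injective fun r : ℚ => (r.den, r.num) := fun r s h =>
    Rat.ext (Prod.ext_iff.1 h).2 (Prod.ext_iff.1 h).1
  have num_le {r : ℚ} (hr : |r| ≤ 1) : |r.num| ≤ r.den := by
    rwa [← Rat.num_abs_eq_abs_num, ← Rat.den_abs_eq_den, Rat.num_le_denom_iff]
  refine ne_top_of_le_ne_top ?_ (calc
    _ ≤ ∑' r : ℚ, (if |r.num| ≤ r.den then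
          ENNReal.ofReal ((r.den : ℝ) ^ (-(5 / 2) : ℝ)) else 0) := by
        refine ENNReal.tsum_le_tsum fun r => ?_
        split_ifs with hr hr'
        exacts [le_rfl, absurd (num_le hr) hr', zero_le, le_rfl]
    _ ≤ ∑' p : ℕ × ℤ, (if |p.2| ≤ p.1 then
          ENNReal.ofReal ((p.1 : ℝ) ^ (-(5 / 2) : ℝ)) else 0) :=
        ENNReal.tsum_comp_le_tsum_of_injective injective_den_num _
    _ = ∑' q : ℕ, ENNReal.ofReal (((2 * q + 1 : ℕ) : ℝ) * (q : ℝ) ^ (-(5 / 2) : ℝ)) := by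
        rw [ENNReal.tsum_prod']
        refine tsum_congr fun q => ?_
        simp only
        rw [tsum_int_abs_le, ENNReal.ofReal_mul (by positivity), ENNReal.ofReal_natCast])
  rw [← ENNReal.ofReal_tsum_of_nonneg (fun q => by positivity) summable_two_mul_add_one_rpow]
  exact ENNReal.ofReal_ne_top

theorem lintegral_one_add_sq_rpow_ne_top :
    ∫⁻ u : ℝ, ENNReal.ofReal ((1 + u ^ 2) ^ (-(3 / 4) : ℝ)) ≠ ∞ := by
  have h := integrable_rpow_neg_one_add_norm_sq (E := ℝ) (μ := volume) (r := 3 / 2)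
    (by rw [Module.finrank_self]; norm_num)
  have integrable_rpow : Integrable fun u : ℝ => (1 + u ^ 2) ^ (-(3 / 4) : ℝ) := by
    refine h.congr (Filter.Eventually.of_forall fun u => ?_)
    simp only [Real.norm_eq_abs, sq_abs]
    norm_num
  exact integrable_rpow.lintegral_lt_top.ne

theorem measurable_arcWeight : Measurable fun p : ℚ × ℝ => arcWeight p.1.den p.2 :=
  measurable_rat_prod fun r => by unfold arcWeight; fun_prop

theorem lintegral_arcWeight_ne_top :
    ∫⁻ p, ENNReal.ofReal (arcWeight p.1.den p.2) ∂arcMeasure ≠ ∞ := by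
  simp only [arcWeight, ENNReal.ofReal_mul (Real.rpow_nonneg (Nat.cast_nonneg _) _)]
  rw [arcMeasure, lintegral_prod_mul
    (f := fun r : ℚ => ENNReal.ofReal ((r.den : ℝ) ^ (-(5 / 2) : ℝ)))
    (g := fun u : ℝ => ENNReal.ofReal ((1 + u ^ 2) ^ (-(3 / 4) : ℝ)))
    (measurable_of_countable _).aemeasurable (by fun_prop),
    ← lintegral_indicator (Set.to_countable _).measurableSet, lintegral_count]
  simp only [Set.indicator_apply, Set.mem_ofPred_eq]
  exact ENNReal.mul_ne_top tsum_rat_den_rpow_ne_top lintegral_one_add_sq_rpow_ne_top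

/-! ### The maximal function of the whole circle -/

theorem tsum_lintegral_sq_le {α ι : Type*} [MeasurableSpace α] [Countable ι] {μ : Measure α}
    {w : α → ℝ} (hw : Measurable w) (hw0 : ∀ p, 0 < w p) {g : ι → α → ℝ≥0∞}
    (hg : ∀ x, Measurable (g x)) {C : ℝ≥0∞}
    (hC : ∀ p, ∑' x, g x p ^ 2 ≤ C * ENNReal.ofReal (w p ^ 2)) :
    ∑' x, (∫⁻ p, g x p ∂μ) ^ 2 ≤ C * (∫⁻ p, ENNReal.ofReal (w p) ∂μ) ^ 2 := by
  have sqrt_pos (p) : 0 < √(w p) := Real.sqrt_pos.2 (hw0 p)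
  set v : α → ℝ≥0∞ := fun p => ENNReal.ofReal √(w p) with hv
  have v_measurable : Measurable v := by fun_prop
  have v_sq (p) : v p ^ 2 = ENNReal.ofReal (w p) := by
    rw [hv, ← ENNReal.ofReal_pow (sqrt_pos p).le, Real.sq_sqrt (hw0 p).le]
  have v_mul_inv (p) : v p * (v p)⁻¹ = 1 :=
    ENNReal.mul_inv_cancel (ENNReal.ofReal_pos.2 (sqrt_pos p)).ne' ENNReal.ofReal_ne_top
  have quotient_measurable (x) : Measurable fun p => ((v p)⁻¹ * g x p) ^ 2 :=
    (v_measurable.inv.mul (hg x)).pow_const 2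
  have cauchy_schwarz (x) : (∫⁻ p, g x p ∂μ) ^ 2 ≤
      (∫⁻ p, ENNReal.ofReal (w p) ∂μ) * ∫⁻ p, ((v p)⁻¹ * g x p) ^ 2 ∂μ := by
    calc (∫⁻ p, g x p ∂μ) ^ 2 = (∫⁻ p, v p * ((v p)⁻¹ * g x p) ∂μ) ^ 2 := by
          simp_rw [← mul_assoc, v_mul_inv, one_mul]
      _ ≤ (∫⁻ p, v p ^ 2 ∂μ) * ∫⁻ p, ((v p)⁻¹ * g x p) ^ 2 ∂μ :=
          ennreal_lintegral_mul_sq_le μ v_measurable.aemeasurable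
            (v_measurable.inv.mul (hg x)).aemeasurable
      _ = _ := by simp_rw [v_sq]
  have weighted_norm (p) : ∑' x, ((v p)⁻¹ * g x p) ^ 2 ≤ C * ENNReal.ofReal (w p) := by
    calc ∑' x, ((v p)⁻¹ * g x p) ^ 2 = (v p)⁻¹ ^ 2 * ∑' x, g x p ^ 2 := by
          simp_rw [mul_pow, ENNReal.tsum_mul_left]
      _ ≤ (v p)⁻¹ ^ 2 * (C * (v p ^ 2) ^ 2) := by
          gcongr
          rw [v_sq, ← ENNReal.ofReal_pow (hw0 p).le]
          exact hC p
      _ = (v p * (v p)⁻¹) ^ 2 * (C * v p ^ 2) := by ring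
      _ = C * ENNReal.ofReal (w p) := by rw [v_mul_inv, v_sq, one_pow, one_mul]
  calc _ ≤ ∑' x, (∫⁻ p, ENNReal.ofReal (w p) ∂μ) * ∫⁻ p, ((v p)⁻¹ * g x p) ^ 2 ∂μ :=
        ENNReal.tsum_le_tsum cauchy_schwarz
    _ = (∫⁻ p, ENNReal.ofReal (w p) ∂μ) * ∫⁻ p, ∑' x, ((v p)⁻¹ * g x p) ^ 2 ∂μ := by
        rw [ENNReal.tsum_mul_left, lintegral_tsum fun x => (quotient_measurable x).aemeasurable]
    _ ≤ (∫⁻ p, ENNReal.ofReal (w p) ∂μ) * ∫⁻ p, C * ENNReal.ofReal (w p) ∂μ := by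
        gcongr with p
        exact weighted_norm p
    _ = _ := by
        rw [lintegral_const_mul _ hw.ennreal_ofReal]
        ring

theorem tsum_mul_sub_eq_sum {G R : Type*} [AddCommGroup G] [NonUnitalNonAssocSemiring R]
    [TopologicalSpace R] (k : G → R) {s : Finset G} {f : G → R} (hf : ∀ n ∉ s, f n = 0) (x : G) :
    ∑' m, k m * f (x - m) = ∑ y ∈ s, k (x - y) * f y := by
  rw [← (Equiv.subLeft x).tsum_eq, tsum_eq_sum (s := s)]
  · simp only [Equiv.subLeft_apply, sub_sub_cancel]
  · intro y hy
    rw [Equiv.subLeft_apply, sub_sub_cancel, hf y hy, mul_zero]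

section CircleMaximal

variable {d : ℕ} {s : Finset (Fin d → ℤ)} {f : (Fin d → ℤ) → ℂ}

theorem continuous_thetaKernelPi (S : ℝ) (m : Fin d → ℤ) :
    Continuous fun t => thetaKernelPi S t m := by
  unfold thetaKernelPi thetaKernel
  fun_prop

theorem continuous_thetaConv (hf : ∀ n ∉ s, f n = 0) (S : ℝ) (x : Fin d → ℤ) :
    Continuous fun t => thetaConv S t f x := by
  simp only [thetaConv, tsum_mul_sub_eq_sum _ hf]
  exact continuous_finsetSum _ fun y _ =>
    (continuous_thetaKernelPi S (x - y)).mul continuous_const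

/-- The integral of the maximal functions of all arcs. It dominates the spherical sums of `f` at
all radii. -/
def circleMaximal (f : (Fin d → ℤ) → ℂ) (x : Fin d → ℤ) : ℝ≥0∞ :=
  ∫⁻ p, arcMaximal p.1.den p.1.num p.2 f x ∂arcMeasure

theorem measurable_arcMaximal (hf : ∀ n ∉ s, f n = 0) (x : Fin d → ℤ) :
    Measurable fun p : ℚ × ℝ => arcMaximal p.1.den p.1.num p.2 f x := by
  refine measurable_rat_prod fun r => ?_
  have as_iSup : (fun u => arcMaximal r.den r.num u f x) = fun u => ⨆ j : ℕ,
      {u : ℝ | (r, u) ∈ arcRegion (4 ^ j)}.indicator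
        (fun u => ‖thetaConv (4 ^ j) (r.num / r.den + u / 4 ^ j) f x‖ₑ) u := by
    ext u
    rw [arcMaximal, iSup_subtype]
    refine iSup_congr fun j => ?_
    by_cases h : (r, u) ∈ arcRegion (4 ^ j)
    · rw [Set.indicator_of_mem (by exact h), iSup_pos (by exact h)]
    · rw [Set.indicator_of_notMem (by exact h), iSup_neg (by exact h), bot_eq_zero]
  rw [as_iSup]
  exact Measurable.iSup fun j => Measurable.indicator
    (((continuous_thetaConv hf _ x).comp (by fun_prop)).measurable.enorm)
    ((measurableSet_arcRegion _).preimage (by fun_prop))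

theorem tsum_circleMaximal_sq_le (hd : 5 ≤ d) (hf : ∀ n ∉ s, f n = 0) :
    ∑' x, circleMaximal f x ^ 2 ≤
      arcConst d * (∫⁻ p, ENNReal.ofReal (arcWeight p.1.den p.2) ∂arcMeasure) ^ 2 *
        ∑' x, ‖f x‖ₑ ^ 2 := by
  have neZero_den (r : ℚ) : NeZero r.den := ⟨r.den_nz⟩
  rw [mul_right_comm]
  refine tsum_lintegral_sq_le measurable_arcWeight (fun p => arcWeight_pos p.1.den p.2)
    (fun x => measurable_arcMaximal hf x) fun p => ?_
  refine (tsum_arcMaximal_sq_le p.1.isCoprime_num_den p.2 hf).trans ?_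
  rw [mul_right_comm]
  gcongr
  exact majorBound_sq_pow_mul_le_arcWeight_sq hd p.1.den p.2

end CircleMaximal

/-! ### Spherical sums by the circle method -/

section SphericalSum

variable {d : ℕ}

theorem mem_discreteSphereFinset {n : ℕ} (m : Fin d → ℤ) :
    m ∈ discreteSphereFinset d √n ↔ ∑ i, m i ^ 2 = n := by
  rw [discreteSphereFinset, Set.Finite.mem_toFinset, discreteSphere, Set.mem_ofPred_eq,
    Real.sqrt_inj (Finset.sum_nonneg fun i _ => sq_nonneg _) (by positivity)]
  norm_cast

theorem thetaKernelPi_eq (S t : ℝ) (m : Fin d → ℤ) :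
    thetaKernelPi S t m = ((√S)⁻¹ : ℝ) ^ d *
      Complex.exp (2 * π * I * (∑ i, m i ^ 2 : ℤ) * (t + I / S)) := by
  simp only [thetaKernelPi, thetaKernel]
  rw [Finset.prod_mul_distrib, Finset.prod_const, Finset.card_univ, Fintype.card_fin,
    ← Complex.exp_sum]
  congr 2
  push_cast
  rw [Finset.mul_sum, Finset.sum_mul]

theorem intervalIntegral_exp_two_pi_I_mul (k : ℤ) :
    ∫ t in (0 : ℝ)..1, Complex.exp (2 * π * I * k * t) = if k = 0 then 1 else 0 := by
  split_ifs with hk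
  · simp [hk]
  have frequency_ne_zero : (2 * π * I * k : ℂ) ≠ 0 :=
    mul_ne_zero Complex.two_pi_I_ne_zero (Int.cast_ne_zero.2 hk)
  have exp_eq_one : Complex.exp (2 * π * I * k * (1 : ℝ)) = 1 :=
    Complex.exp_eq_one_iff.2 ⟨k, by push_cast; ring⟩
  rw [integral_exp_mul_complex frequency_ne_zero, exp_eq_one]
  simp

theorem norm_exp_neg_two_pi_I_mul (n : ℕ) (t : ℝ) :
    ‖Complex.exp (-(2 * π * I * n * t))‖ = 1 := by
  simpa only [Int.cast_neg, Int.cast_natCast, mul_neg, neg_mul] using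
    norm_exp_two_pi_I_mul (-(n : ℤ)) t

/-- The factor with which a point of the sphere of radius `√n` enters the `n`-th Fourier
coefficient of the theta kernel at scale `S`. -/
def sphereFactor (d : ℕ) (S : ℝ) (n : ℕ) : ℝ := (√S)⁻¹ ^ d * Real.exp (-(2 * π * n / S))

theorem sphereFactor_pos (d : ℕ) {S : ℝ} (hS : 0 < S) (n : ℕ) : 0 < sphereFactor d S n := by
  rw [sphereFactor]
  positivity

theorem one_le_mul_sphereFactor (d : ℕ) {S : ℝ} (hS : 0 < S) {n : ℕ} (hn : n ≤ 4 * S) :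
    1 ≤ Real.exp (8 * π) * √S ^ d * sphereFactor d S n := by
  have : 0 < √S := Real.sqrt_pos.2 hS
  have exponent_le : 2 * π * n / S ≤ 8 * π := by
    rw [div_le_iff₀ hS]
    nlinarith [Real.pi_pos]
  calc 1 ≤ Real.exp (8 * π + -(2 * π * n / S)) := Real.one_le_exp_iff.2 (by linarith)
    _ = _ := by
        rw [sphereFactor, Real.exp_add, inv_pow]
        field_simp

theorem integral_exp_mul_thetaKernelPi (S : ℝ) (n : ℕ) (m : Fin d → ℤ) :
    ∫ t in (0 : ℝ)..1, Complex.exp (-(2 * π * I * n * t)) * thetaKernelPi S t m =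
      if m ∈ discreteSphereFinset d √n then (sphereFactor d S n : ℂ) else 0 := by
  have separate (t : ℝ) : Complex.exp (-(2 * π * I * n * t)) * thetaKernelPi S t m =
      (((√S)⁻¹ : ℝ) ^ d * Real.exp (-(2 * π * (∑ i, m i ^ 2 : ℤ) / S)) : ℝ) *
        Complex.exp (2 * π * I * (∑ i, m i ^ 2 - n : ℤ) * t) := by
    rw [thetaKernelPi_eq, mul_left_comm, Complex.ofReal_mul, Complex.ofReal_pow,
      Complex.ofReal_exp, mul_assoc (_ ^ d), ← Complex.exp_add, ← Complex.exp_add]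
    congr 2
    push_cast
    linear_combination (2 * π * (∑ i, (m i : ℂ) ^ 2) / S) * Complex.I_sq
  simp_rw [separate]
  rw [intervalIntegral.integral_const_mul, intervalIntegral_exp_two_pi_I_mul, mul_ite, mul_one,
    mul_zero]
  refine if_ctx_congr ?_ (fun hm => ?_) fun _ => rfl
  · rw [mem_discreteSphereFinset, sub_eq_zero]
  · rw [(mem_discreteSphereFinset m).1 hm, sphereFactor, Int.cast_natCast]

variable {s : Finset (Fin d → ℤ)} {f : (Fin d → ℤ) → ℂ}

theorem integral_exp_mul_thetaConv (hf : ∀ n ∉ s, f n = 0) (S : ℝ) (n : ℕ) (x : Fin d → ℤ) :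
    ∫ t in (0 : ℝ)..1, Complex.exp (-(2 * π * I * n * t)) * thetaConv S t f x =
      sphereFactor d S n * ∑ m ∈ discreteSphereFinset d √n, f (x - m) := by
  have sphere_sum_eq : ∑ m ∈ discreteSphereFinset d √n, (sphereFactor d S n : ℂ) * f (x - m) =
      ∑' m, (if m ∈ discreteSphereFinset d √n then (sphereFactor d S n : ℂ) else 0) *
        f (x - m) := by
    rw [tsum_eq_sum (s := discreteSphereFinset d √n) fun m hm => by rw [if_neg hm, zero_mul]]
    exact Finset.sum_congr rfl fun m hm => by rw [if_pos hm]
  rw [Finset.mul_sum, sphere_sum_eq]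
  simp only [thetaConv, tsum_mul_sub_eq_sum _ hf, Finset.mul_sum, ← mul_assoc]
  rw [intervalIntegral.integral_finsetSum]
  · simp_rw [intervalIntegral.integral_mul_const, integral_exp_mul_thetaKernelPi]
  · intro y _
    have := continuous_thetaKernelPi S (x - y)
    exact Continuous.intervalIntegrable (by fun_prop) _ _

theorem enorm_sum_sphere_mul_le (hf : ∀ n ∉ s, f n = 0) {S : ℝ} (hS : 0 < S) (n : ℕ)
    (x : Fin d → ℤ) :
    ‖∑ m ∈ discreteSphereFinset d √n, f (x - m)‖ₑ * ENNReal.ofReal (sphereFactor d S n) ≤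
      ∫⁻ t in Set.Icc (-1 : ℝ) 1, ‖thetaConv S t f x‖ₑ := by
  calc _ = ‖∫ t in (0 : ℝ)..1, Complex.exp (-(2 * π * I * n * t)) * thetaConv S t f x‖ₑ := by
        rw [integral_exp_mul_thetaConv hf, enorm_mul, mul_comm,
          ← ofReal_norm (sphereFactor d S n : ℂ), Complex.norm_real,
          Real.norm_of_nonneg (sphereFactor_pos d hS n).le]
    _ ≤ ∫⁻ t in Set.Ioc (0 : ℝ) 1, ‖Complex.exp (-(2 * π * I * n * t)) * thetaConv S t f x‖ₑ := by
        rw [intervalIntegral.integral_of_le zero_le_one]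
        exact enorm_integral_le_lintegral_enorm _
    _ = ∫⁻ t in Set.Ioc (0 : ℝ) 1, ‖thetaConv S t f x‖ₑ := by
        refine lintegral_congr fun t => ?_
        rw [← ofReal_norm, norm_mul, norm_exp_neg_two_pi_I_mul, one_mul, ofReal_norm]
    _ ≤ _ := lintegral_mono_set
        (Set.Ioc_subset_Icc_self.trans (Set.Icc_subset_Icc (by norm_num) le_rfl))

theorem setLIntegral_arcRegion_thetaConv_le (f : (Fin d → ℤ) → ℂ) (j : ℕ) (x : Fin d → ℤ) :
    ∫⁻ p in arcRegion (4 ^ j), ‖thetaConv (4 ^ j) (p.1 + p.2 / 4 ^ j) f x‖ₑ ∂arcMeasure ≤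
      circleMaximal f x := by
  rw [circleMaximal, ← lintegral_indicator (measurableSet_arcRegion _)]
  refine lintegral_mono fun p => Set.indicator_apply_le' (fun hp => ?_) fun _ => zero_le
  rw [Rat.cast_def]
  exact le_iSup (fun j : arcScales p.1.den p.2 =>
    ‖thetaConv (4 ^ (j : ℕ)) (p.1.num / p.1.den + p.2 / 4 ^ (j : ℕ)) f x‖ₑ) ⟨j, hp⟩

theorem enorm_sum_sphere_le (hf : ∀ n ∉ s, f n = 0) {n j : ℕ} (hn : n ≤ 4 ^ (j + 1))
    (x : Fin d → ℤ) :
    ‖∑ m ∈ discreteSphereFinset d √n, f (x - m)‖ₑ * ENNReal.ofReal (4 ^ j) ≤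
      ENNReal.ofReal (Real.exp (8 * π) * √(4 ^ j) ^ d) * circleMaximal f x := by
  set S : ℝ := 4 ^ j with hS
  set σ := ‖∑ m ∈ discreteSphereFinset d √n, f (x - m)‖ₑ
  have one_le_scale : 1 ≤ S := one_le_pow₀ (by norm_num)
  have scale_pos : 0 < S := by linarith
  have n_le : (n : ℝ) ≤ 4 * S := by
    rw [hS, ← pow_succ']
    exact_mod_cast hn
  calc σ * ENNReal.ofReal S
      ≤ σ * ENNReal.ofReal S *
        ENNReal.ofReal (Real.exp (8 * π) * √S ^ d * sphereFactor d S n) :=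
        le_mul_of_one_le_right zero_le
          (ENNReal.one_le_ofReal.2 (one_le_mul_sphereFactor d scale_pos n_le))
    _ = ENNReal.ofReal (Real.exp (8 * π) * √S ^ d) *
        (ENNReal.ofReal S * (σ * ENNReal.ofReal (sphereFactor d S n))) := by
        rw [ENNReal.ofReal_mul (q := sphereFactor d S n) (by positivity)]
        ring
    _ ≤ ENNReal.ofReal (Real.exp (8 * π) * √S ^ d) *
        (ENNReal.ofReal S * ∫⁻ t in Set.Icc (-1 : ℝ) 1, ‖thetaConv S t f x‖ₑ) := by
        gcongr
        exact enorm_sum_sphere_mul_le hf scale_pos n x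
    _ ≤ _ := by
        gcongr
        exact (lintegral_le_setLIntegral_arcRegion one_le_scale
          (continuous_thetaConv hf S x).measurable.enorm).trans
          (setLIntegral_arcRegion_thetaConv_le f j x)

end SphericalSum

/-! ### The density of solutions modulo `Q` -/

/-- The number of solutions of `x₁² + ⋯ + x_d² = n` modulo `Q`, normalised by its mean `Q ^ (d - 1)`
over `n`; it approximates the singular series of sums of `d` squares. -/
def localDensity (d Q : ℕ) [NeZero Q] (n : ℕ) : ℝ :=
  Fintype.card {x : Fin d → ZMod Q // ∑ i, x i ^ 2 = (n : ZMod Q)} * (Q : ℝ) / Q ^ d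

theorem stdAddChar_sum {ι : Type*} {q : ℕ} [NeZero q] (s : Finset ι) (b : ι → ZMod q) :
    (ZMod.stdAddChar (∑ i ∈ s, b i) : ℂ) = ∏ i ∈ s, ZMod.stdAddChar (b i) := by
  induction s using Finset.cons_induction with
  | empty => simp
  | cons i s hi ih => rw [Finset.prod_cons, Finset.sum_cons, AddChar.map_add_eq_mul, ih]

theorem quadGaussSum_pow (d : ℕ) {Q : ℕ} [NeZero Q] (b : ZMod Q) :
    quadGaussSum Q b 0 ^ d = ∑ x : Fin d → ZMod Q, (ZMod.stdAddChar (b * ∑ i, x i ^ 2) : ℂ) := by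
  rw [quadGaussSum, Fintype.sum_pow]
  refine Finset.sum_congr rfl fun x _ => ?_
  rw [Finset.mul_sum, stdAddChar_sum]
  simp only [zero_mul, add_zero]

theorem localDensity_eq_sum (d Q : ℕ) [NeZero Q] (n : ℕ) :
    (localDensity d Q n : ℂ) =
      ∑ b : ZMod Q, ZMod.stdAddChar (-(b * (n : ZMod Q))) * (quadGaussSum Q b 0 / Q) ^ d := by
  have expand (b : ZMod Q) :
      ZMod.stdAddChar (-(b * (n : ZMod Q))) * (quadGaussSum Q b 0 / Q) ^ d =
        (∑ x : Fin d → ZMod Q, ZMod.stdAddChar (b * (∑ i, x i ^ 2 - (n : ZMod Q)))) / Q ^ d := by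
    rw [div_pow, quadGaussSum_pow, ← mul_div_assoc, Finset.mul_sum]
    congr 1
    refine Finset.sum_congr rfl fun x _ => ?_
    rw [← AddChar.map_add_eq_mul]
    congr 1
    ring
  have orthogonality (x : Fin d → ZMod Q) :
      ∑ b : ZMod Q, (ZMod.stdAddChar (b * (∑ i, x i ^ 2 - (n : ZMod Q))) : ℂ) =
        if ∑ i, x i ^ 2 = (n : ZMod Q) then (Q : ℂ) else 0 := by
    rw [AddChar.sum_mulShift _ (ZMod.isPrimitive_stdAddChar Q), ZMod.card]
    simp only [sub_eq_zero]
    split_ifs <;> simp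
  simp_rw [expand]
  rw [← Finset.sum_div, Finset.sum_comm]
  simp_rw [orthogonality]
  rw [← Finset.sum_filter, Finset.sum_const, nsmul_eq_mul, localDensity, Fintype.card_subtype]
  push_cast
  rfl

theorem localDensity_mul (d : ℕ) {Q R : ℕ} [NeZero Q] [NeZero R] (h : Nat.Coprime Q R) (n : ℕ) :
    localDensity d (Q * R) n = localDensity d Q n * localDensity d R n := by
  let E : (Fin d → ZMod (Q * R)) ≃ (Fin d → ZMod Q) × (Fin d → ZMod R) :=
    (Equiv.piCongrRight fun _ => (ZMod.chineseRemainder h).toEquiv).trans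
      (Equiv.arrowProdEquivProdArrow (Fin d) (fun _ => ZMod Q) fun _ => ZMod R)
  have hE (x : Fin d → ZMod (Q * R)) : ∑ i, x i ^ 2 = (n : ZMod (Q * R)) ↔
      (∑ i, (E x).1 i ^ 2 = (n : ZMod Q)) ∧ (∑ i, (E x).2 i ^ 2 = (n : ZMod R)) := by
    rw [← (ZMod.chineseRemainder h).injective.eq_iff, map_sum, map_natCast, Prod.ext_iff]
    simp [E, Prod.fst_sum, Prod.snd_sum, Equiv.arrowProdEquivProdArrow]
  have card_eq : Fintype.card {x : Fin d → ZMod (Q * R) // ∑ i, x i ^ 2 = (n : ZMod (Q * R))} =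
      Fintype.card {x : Fin d → ZMod Q // ∑ i, x i ^ 2 = (n : ZMod Q)} *
      Fintype.card {x : Fin d → ZMod R // ∑ i, x i ^ 2 = (n : ZMod R)} := by
    rw [← Fintype.card_prod]
    exact Fintype.card_congr ((Equiv.subtypeEquiv E hE).trans
      (Equiv.subtypeProdEquivProd (p := fun x : Fin d → ZMod Q => ∑ i, x i ^ 2 = (n : ZMod Q))
        (q := fun x : Fin d → ZMod R => ∑ i, x i ^ 2 = (n : ZMod R))))
  rw [localDensity, localDensity, localDensity, card_eq]
  push_cast
  ring

theorem abs_localDensity_sub_one_le {d : ℕ} (hd : 5 ≤ d) (Q : ℕ) [NeZero Q] (n : ℕ) :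
    |localDensity d Q n - 1| ≤
      ∑ b ∈ Finset.univ.erase (0 : ZMod Q), ‖quadGaussSum Q b 0 / Q‖ ^ 5 := by
  have Q_ne_zero : (Q : ℂ) ≠ 0 := NeZero.ne _
  have sub_one_eq : (localDensity d Q n : ℂ) - 1 = ∑ b ∈ Finset.univ.erase (0 : ZMod Q),
      ZMod.stdAddChar (-(b * (n : ZMod Q))) * (quadGaussSum Q b 0 / Q) ^ d := by
    have gauss_zero : quadGaussSum Q 0 0 = Q := by simp [quadGaussSum, ZMod.card]
    rw [localDensity_eq_sum, ← Finset.add_sum_erase _ _ (Finset.mem_univ (0 : ZMod Q)), gauss_zero]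
    simp [Q_ne_zero]
  rw [← Real.norm_eq_abs, ← Complex.norm_real, Complex.ofReal_sub, Complex.ofReal_one, sub_one_eq]
  refine (norm_sum_le _ _).trans (Finset.sum_le_sum fun b _ => ?_)
  have norm_le_one : ‖quadGaussSum Q b 0 / Q‖ ≤ 1 := by
    rw [norm_div, Complex.norm_natCast]
    exact div_le_one_of_le₀ (norm_quadGaussSum_le b 0) Q.cast_nonneg
  rw [norm_mul, norm_pow, ZMod.stdAddChar_apply, Circle.norm_coe, one_mul]
  exact pow_le_pow_of_le_one (norm_nonneg _) norm_le_one hd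

theorem sum_zmod_eq_sum_range {M : Type*} [AddCommMonoid M] (q : ℕ) [NeZero q] (F : ZMod q → M) :
    ∑ b, F b = ∑ b ∈ Finset.range q, F b := by
  refine Finset.sum_nbij' ZMod.val Nat.cast
    (fun b _ => Finset.mem_range.2 (ZMod.val_lt b)) (fun _ _ => Finset.mem_univ _)
    (fun b _ => ZMod.natCast_zmod_val b)
    (fun b hb => ZMod.val_cast_of_lt (Finset.mem_range.1 hb)) fun b _ => ?_
  rw [ZMod.natCast_zmod_val]

theorem sum_range_div_gcd {M : Type*} [AddCommMonoid M] {Q : ℕ} (hQ : Q ≠ 0) (g : ℕ → M) :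
    ∑ b ∈ Finset.range Q, g (Q / Q.gcd b) = ∑ q ∈ Q.divisors, q.totient • g q := by
  have maps_to : ∀ b ∈ Finset.range Q, Q.gcd b ∈ Q.divisors := fun b _ =>
    Nat.mem_divisors.2 ⟨Nat.gcd_dvd_left Q b, hQ⟩
  rw [← Finset.sum_fiberwise_of_maps_to maps_to,
    ← Nat.sum_div_divisors Q fun q => q.totient • g q]
  refine Finset.sum_congr rfl fun e he => ?_
  rw [Nat.totient_div_of_dvd (Nat.dvd_of_mem_divisors he), ← Finset.sum_const]
  exact Finset.sum_congr rfl fun b hb => by rw [(Finset.mem_filter.1 hb).2]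

theorem sum_range_erase_zero_div_gcd {Q : ℕ} (hQ : Q ≠ 0) (g : ℕ → ℝ) :
    ∑ b ∈ (Finset.range Q).erase 0, g (Q / Q.gcd b) =
      ∑ q ∈ Q.divisors.erase 1, q.totient * g q := by
  have total := sum_range_div_gcd hQ g
  rw [← Finset.add_sum_erase _ _ (Finset.mem_range.2 (Nat.pos_of_ne_zero hQ)),
    ← Finset.add_sum_erase _ _ (Nat.one_mem_divisors.2 hQ)] at total
  simpa [Nat.div_self (Nat.pos_of_ne_zero hQ)] using total

theorem le_localDensity {d : ℕ} (hd : 5 ≤ d) (Q : ℕ) [NeZero Q] (n : ℕ) (g : ℕ → ℝ)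
    (hg : ∀ b < Q, b ≠ 0 → ‖quadGaussSum Q (b : ZMod Q) 0 / Q‖ ^ 5 ≤ g (Q / Q.gcd b)) :
    1 - ∑ q ∈ Q.divisors.erase 1, q.totient * g q ≤ localDensity d Q n := by
  have sum_erase_zero : ∑ b ∈ Finset.univ.erase (0 : ZMod Q), ‖quadGaussSum Q b 0 / Q‖ ^ 5 =
      ∑ b ∈ (Finset.range Q).erase 0, ‖quadGaussSum Q (b : ZMod Q) 0 / Q‖ ^ 5 := by
    have total := sum_zmod_eq_sum_range Q fun b => ‖quadGaussSum Q b 0 / Q‖ ^ 5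
    rw [← Finset.add_sum_erase _ _ (Finset.mem_univ (0 : ZMod Q)),
      ← Finset.add_sum_erase _ _ (Finset.mem_range.2 (NeZero.pos Q)), Nat.cast_zero] at total
    exact add_left_cancel total
  have deviation_le : |localDensity d Q n - 1| ≤ ∑ q ∈ Q.divisors.erase 1, q.totient * g q := by
    rw [← sum_range_erase_zero_div_gcd (NeZero.ne Q)]
    refine (abs_localDensity_sub_one_le hd Q n).trans (sum_erase_zero.trans_le ?_)
    refine Finset.sum_le_sum fun b hb => ?_
    rw [Finset.mem_erase, Finset.mem_range] at hb
    exact hg b hb.2 hb.1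
  linarith [neg_le_of_abs_le deviation_le]

theorem norm_quadGaussSum_div_pow_five_le (Q : ℕ) [NeZero Q] (b : ℕ) {q : ℝ} (hq : 0 < q)
    (h : ((2 * b).gcd Q : ℝ) ≤ Q / q) :
    ‖quadGaussSum Q (b : ZMod Q) 0 / Q‖ ^ 5 ≤ (√q ^ 5)⁻¹ := by
  have Q_pos : (0 : ℝ) < Q := Nat.cast_pos.2 (NeZero.pos Q)
  rw [← inv_pow, ← Real.sqrt_inv]
  gcongr
  refine Real.le_sqrt_of_sq_le ?_
  rw [norm_div, Complex.norm_natCast, div_pow, div_le_iff₀ (by positivity)]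
  calc ‖quadGaussSum Q (b : ZMod Q) 0‖ ^ 2 ≤ Q * ((2 * b).gcd Q : ℕ) :=
        norm_quadGaussSum_natCast_sq_le b 0
    _ ≤ Q * (Q / q) := by gcongr
    _ = q⁻¹ * Q ^ 2 := by field_simp

theorem mul_inv_sqrt_pow_five_le_sub {x : ℝ} (hx : 1 < x) :
    x * (√x ^ 5)⁻¹ ≤ (√(x - 1))⁻¹ - (√(x + 1))⁻¹ := by
  have sq_b : √x ^ 2 = x := Real.sq_sqrt (by linarith)
  have sq_a : √(x - 1) ^ 2 = x - 1 := Real.sq_sqrt (by linarith)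
  have sq_c : √(x + 1) ^ 2 = x + 1 := Real.sq_sqrt (by linarith)
  have b_pos : 0 < √x := Real.sqrt_pos.2 (by linarith)
  have a_pos : 0 < √(x - 1) := Real.sqrt_pos.2 (by linarith)
  have c_pos : 0 < √(x + 1) := Real.sqrt_pos.2 (by linarith)
  set a := √(x - 1)
  set b := √x
  set c := √(x + 1)
  have mul_le_sq : a * c ≤ b ^ 2 := by nlinarith [sq_nonneg (a - c)]
  have add_le_two_mul : a + c ≤ 2 * b := by nlinarith [sq_nonneg (a - c)]
  calc x * (b ^ 5)⁻¹ = 2 / (b ^ 2 * (2 * b)) := by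
        rw [← sq_b]
        field_simp
    _ ≤ 2 / (a * c * (a + c)) := by gcongr
    _ = a⁻¹ - c⁻¹ := by
        field_simp
        nlinarith

theorem sum_odd_mul_inv_sqrt_pow_five_le (K : ℕ) :
    ∑ k ∈ Finset.range K, (2 * k + 3 : ℝ) * (√(2 * k + 3) ^ 5)⁻¹ ≤ 3 / 4 := by
  have term_le (k : ℕ) : (2 * k + 3 : ℝ) * (√(2 * k + 3) ^ 5)⁻¹ ≤
      (√(2 * k + 2))⁻¹ - (√(2 * (k + 1 : ℕ) + 2))⁻¹ := by
    convert mul_inv_sqrt_pow_five_le_sub (x := 2 * k + 3) (by linarith [k.cast_nonneg (α := ℝ)])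
      using 4 <;> push_cast <;> ring
  refine (Finset.sum_le_sum fun k _ => term_le k).trans ?_
  rw [Finset.sum_range_sub' (fun k : ℕ => (√(2 * k + 2 : ℝ))⁻¹)]
  have tail_nonneg : 0 ≤ (√(2 * K + 2 : ℝ))⁻¹ := by positivity
  have inv_sqrt_two_le : (√(2 * (0 : ℕ) + 2 : ℝ))⁻¹ ≤ 3 / 4 := by
    norm_num
    rw [inv_le_comm₀ (by positivity) (by norm_num)]
    exact Real.le_sqrt_of_sq_le (by norm_num)
  linarith

theorem sum_divisors_of_odd_le {Q : ℕ} (hQ : Odd Q) :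
    ∑ q ∈ Q.divisors.erase 1, (q.totient : ℝ) * (√q ^ 5)⁻¹ ≤ 3 / 4 := by
  calc ∑ q ∈ Q.divisors.erase 1, (q.totient : ℝ) * (√q ^ 5)⁻¹
      ≤ ∑ q ∈ Q.divisors.erase 1, (q : ℝ) * (√q ^ 5)⁻¹ := by
        gcongr
        exact Nat.totient_le _
    _ ≤ ∑ q ∈ (Finset.range Q).image (fun k : ℕ => 2 * k + 3),
          ((q : ℕ) : ℝ) * (√(q : ℕ) ^ 5)⁻¹ := by
        refine Finset.sum_le_sum_of_subset_of_nonneg (fun q hq => ?_) fun q _ _ => by positivity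
        rw [Finset.mem_erase, Nat.mem_divisors] at hq
        obtain ⟨k, hk⟩ := Odd.of_dvd_nat hQ hq.2.1
        have q_le := Nat.le_of_dvd hQ.pos hq.2.1
        exact Finset.mem_image.2 ⟨k - 1, Finset.mem_range.2 (by omega), by omega⟩
    _ = ∑ k ∈ Finset.range Q, (2 * k + 3 : ℝ) * (√(2 * k + 3) ^ 5)⁻¹ := by
        rw [Finset.sum_image fun a _ b _ h => by omega]
        push_cast
        rfl
    _ ≤ 3 / 4 := sum_odd_mul_inv_sqrt_pow_five_le Q

theorem quarter_le_localDensity_odd {d : ℕ} (hd : 5 ≤ d) (Q : ℕ) [NeZero Q] (hQ : Odd Q) (n : ℕ) :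
    1 / 4 ≤ localDensity d Q n := by
  have gauss_le : ∀ b < Q, b ≠ 0 → ‖quadGaussSum Q (b : ZMod Q) 0 / Q‖ ^ 5 ≤
      (√(Q / Q.gcd b : ℕ) ^ 5)⁻¹ := by
    intro b _ _
    have gcd_pos : 0 < Q.gcd b := Nat.gcd_pos_of_pos_left b hQ.pos
    have div_pos : 0 < Q / Q.gcd b := Nat.div_pos (Nat.gcd_le_left b hQ.pos) gcd_pos
    have gcd_two_mul : (2 * b).gcd Q = Q.gcd b := by
      rw [Nat.gcd_comm, Nat.Coprime.gcd_mul_left_cancel_right]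
      exact Nat.coprime_two_left.2 hQ
    refine norm_quadGaussSum_div_pow_five_le Q b (by exact_mod_cast div_pos) ?_
    rw [gcd_two_mul, Nat.cast_div (Nat.gcd_dvd_left Q b) (by exact_mod_cast gcd_pos.ne'),
      div_div_cancel₀ (NeZero.ne _)]
  linarith [le_localDensity hd Q n (fun q => (√q ^ 5)⁻¹) gauss_le, sum_divisors_of_odd_le hQ]

theorem quadGaussSum_eq_zero_of_two_mul_eq_zero {Q : ℕ} [NeZero Q] {b : ZMod Q} (hb : b ≠ 0)
    (two_mul_b : 2 * b = 0) : quadGaussSum Q b 0 = 0 := by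
  have shift : quadGaussSum Q b 0 = ZMod.stdAddChar b * quadGaussSum Q b 0 := by
    conv_lhs => rw [quadGaussSum, ← Equiv.sum_comp (Equiv.addRight (1 : ZMod Q))]
    rw [quadGaussSum, Finset.mul_sum]
    refine Finset.sum_congr rfl fun x _ => ?_
    rw [← AddChar.map_add_eq_mul, Equiv.coe_addRight]
    congr 1
    linear_combination x * two_mul_b
  have char_ne_one : (ZMod.stdAddChar b : ℂ) ≠ 1 := by
    rwa [Ne, (ZMod.isPrimitive_stdAddChar Q).zmod_char_eq_one_iff]
  exact not_imp_comm.1 (fun h => (mul_eq_right₀ h).1 shift.symm) char_ne_one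

/-- Bound for the fifth power of a normalised Gauss sum modulo a power of two with reduced
denominator `q`. The value at `q = 2` is `0`, which is what makes the sum over all `q` less than
`1`. -/
def dyadicGaussBound (q : ℕ) : ℝ :=
  if q = 2 then 0 else (√(q / 2) ^ 5)⁻¹

theorem two_pow_mul_inv_sqrt_pow_five_le (j : ℕ) :
    (2 ^ j : ℝ) * (√(2 ^ j) ^ 5)⁻¹ ≤ (2 / 5) ^ j := by
  have sqrt_two_pow_five : √2 ^ 5 = 4 * √2 := by
    calc √2 ^ 5 = (√2 ^ 2) ^ 2 * √2 := by ring
      _ = 4 * √2 := by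
        rw [Real.sq_sqrt zero_le_two]
        ring
  have base_le : 2 * (√2 ^ 5)⁻¹ ≤ 2 / 5 := by
    have le_sqrt_two : 5 / 4 ≤ √2 := Real.le_sqrt_of_sq_le (by norm_num)
    rw [sqrt_two_pow_five, ← div_eq_mul_inv, div_le_div_iff₀ (by positivity) (by norm_num)]
    linarith
  have sqrt_two_pow : √(2 ^ j) = √2 ^ j := by
    rw [Real.sqrt_eq_iff_mul_self_eq_of_pos (by positivity), ← mul_pow,
      Real.mul_self_sqrt zero_le_two]
  calc (2 ^ j : ℝ) * (√(2 ^ j) ^ 5)⁻¹ = (2 * (√2 ^ 5)⁻¹) ^ j := by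
        rw [sqrt_two_pow, mul_pow, inv_pow, ← pow_mul, ← pow_mul, mul_comm j]
    _ ≤ (2 / 5) ^ j := by gcongr

theorem totient_mul_dyadicGaussBound_le (j : ℕ) :
    ((2 ^ (j + 1)).totient : ℝ) * dyadicGaussBound (2 ^ (j + 1)) ≤
      if j = 0 then 0 else (2 / 5) ^ j := by
  rw [Nat.totient_prime_pow_succ Nat.prime_two, dyadicGaussBound]
  rcases eq_or_ne j 0 with rfl | hj
  · simp
  · have ne_two : 2 ^ (j + 1) ≠ 2 := by simpa [pow_succ] using hj
    have half : ((2 ^ (j + 1) : ℕ) : ℝ) / 2 = 2 ^ j := by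
      push_cast
      ring
    rw [if_neg ne_two, if_neg hj, half]
    simpa using two_pow_mul_inv_sqrt_pow_five_le j

theorem sum_divisors_two_pow_le (k : ℕ) :
    ∑ q ∈ (2 ^ k).divisors.erase 1, (q.totient : ℝ) * dyadicGaussBound q ≤ 3 / 4 := by
  have partial_sum_le (k : ℕ) : ∑ j ∈ Finset.range (k + 1), (if j = 0 then 0 else (2 / 5 : ℝ) ^ j) ≤
      2 / 3 - 2 / 3 * (2 / 5) ^ k := by
    induction k with
    | zero => simp
    | succ k ih =>
      rw [Finset.sum_range_succ, if_neg k.succ_ne_zero]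
      linarith [pow_succ (2 / 5 : ℝ) k]
  calc ∑ q ∈ (2 ^ k).divisors.erase 1, (q.totient : ℝ) * dyadicGaussBound q
      = ∑ j ∈ Finset.range k, ((2 ^ (j + 1)).totient : ℝ) * dyadicGaussBound (2 ^ (j + 1)) := by
        have total := Nat.sum_divisors_prime_pow (k := k)
          (f := fun q => (q.totient : ℝ) * dyadicGaussBound q) Nat.prime_two
        rw [Finset.sum_range_succ', pow_zero, ← Finset.add_sum_erase _ _
          (Nat.one_mem_divisors.2 (NeZero.ne _)), add_comm] at total
        exact add_right_cancel total
    _ ≤ ∑ j ∈ Finset.range k, if j = 0 then 0 else (2 / 5 : ℝ) ^ j :=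
        Finset.sum_le_sum fun j _ => totient_mul_dyadicGaussBound_le j
    _ ≤ ∑ j ∈ Finset.range (k + 1), if j = 0 then 0 else (2 / 5 : ℝ) ^ j :=
        Finset.sum_le_sum_of_subset_of_nonneg (Finset.range_mono k.le_succ)
          fun j _ _ => by positivity
    _ ≤ 3 / 4 := by linarith [partial_sum_le k, pow_pos (by norm_num : (0 : ℝ) < 2 / 5) k]

theorem norm_quadGaussSum_two_pow_div_pow_five_le {k b : ℕ} (hb : b < 2 ^ k) (hb0 : b ≠ 0) :
    ‖quadGaussSum (2 ^ k) (b : ZMod (2 ^ k)) 0 / (2 ^ k : ℕ)‖ ^ 5 ≤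
      dyadicGaussBound (2 ^ k / (2 ^ k).gcd b) := by
  obtain ⟨j, hj, gcd_eq⟩ := (Nat.dvd_prime_pow Nat.prime_two).1 (Nat.gcd_dvd_left (2 ^ k) b)
  have dvd_b : 2 ^ j ∣ b := gcd_eq ▸ Nat.gcd_dvd_right (2 ^ k) b
  have not_dvd_b : ¬2 ^ k ∣ b := fun h => hb0 (Nat.eq_zero_of_dvd_of_lt h hb)
  have hjk : j < k := hj.lt_of_ne fun h => not_dvd_b (h ▸ dvd_b)
  obtain ⟨i, rfl⟩ := Nat.exists_eq_add_of_lt hjk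
  have denominator : 2 ^ (j + i + 1) / (2 ^ (j + i + 1)).gcd b = 2 ^ (i + 1) := by
    rw [gcd_eq, add_assoc, pow_add, Nat.mul_div_cancel_left _ (by positivity)]
  rw [denominator, dyadicGaussBound]
  split_ifs with h2
  · obtain rfl : i = 0 := by simpa using Nat.pow_right_injective le_rfl (h2.trans (pow_one 2).symm)
    have two_mul_b : ((2 * b : ℕ) : ZMod (2 ^ (j + 0 + 1))) = 0 := by
      rw [ZMod.natCast_eq_zero_iff, add_zero, pow_succ, mul_comm]
      exact Nat.mul_dvd_mul_left 2 dvd_b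
    rw [quadGaussSum_eq_zero_of_two_mul_eq_zero _ (by exact_mod_cast two_mul_b)]
    · simp
    · rwa [Ne, ZMod.natCast_eq_zero_iff]
  · refine norm_quadGaussSum_div_pow_five_le _ b (by positivity) ?_
    have gcd_dvd : (2 * b).gcd (2 ^ (j + i + 1)) ∣ 2 * 2 ^ j := by
      rw [← gcd_eq, ← Nat.gcd_mul_left, Nat.gcd_comm (2 * b)]
      exact Nat.gcd_dvd_gcd_of_dvd_left _ (Nat.dvd_mul_left _ _)
    calc (((2 * b).gcd (2 ^ (j + i + 1)) : ℕ) : ℝ) ≤ ((2 * 2 ^ j : ℕ) : ℝ) := by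
          exact_mod_cast Nat.le_of_dvd (by positivity) gcd_dvd
      _ = _ := by
          push_cast
          rw [pow_add, pow_add, pow_add]
          field_simp

theorem quarter_le_localDensity_two_pow {d : ℕ} (hd : 5 ≤ d) (k n : ℕ) :
    1 / 4 ≤ localDensity d (2 ^ k) n := by
  linarith [sum_divisors_two_pow_le k, le_localDensity hd (2 ^ k) n dyadicGaussBound
    fun b => norm_quadGaussSum_two_pow_div_pow_five_le]

theorem localDensity_lower_bound {d : ℕ} (hd : 5 ≤ d) (Q : ℕ) [NeZero Q] (n : ℕ) :
    1 / 16 ≤ localDensity d Q n := by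
  obtain ⟨k, R, hR, rfl⟩ := Nat.exists_eq_two_pow_mul_odd (NeZero.ne Q)
  have : NeZero R := ⟨hR.pos.ne'⟩
  rw [localDensity_mul d (Nat.Coprime.pow_left k (Nat.coprime_two_left.2 hR))]
  nlinarith [quarter_le_localDensity_two_pow hd k n, quarter_le_localDensity_odd hd R hR n]

/-! ### The singular integral -/

theorem integrableOn_rpow_mul_exp_neg_mul_Ioi {s b : ℝ} (hs : -1 < s) (hb : 0 < b) :
    IntegrableOn (fun x : ℝ => x ^ s * Real.exp (-(b * x))) (Set.Ioi 0) := by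
  simpa only [Real.rpow_one, neg_mul] using integrableOn_rpow_mul_exp_neg_mul_rpow hs one_pos hb

theorem norm_rpow_mul_cexp {s x : ℝ} (hx : 0 < x) (z : ℂ) :
    ‖((x ^ s : ℝ) : ℂ) * Complex.exp (-(z * x))‖ = x ^ s * Real.exp (-(z.re * x)) := by
  rw [norm_mul, Complex.norm_real, Real.norm_of_nonneg (Real.rpow_nonneg hx.le s),
    Complex.norm_exp, Complex.neg_re, Complex.re_mul_ofReal]

theorem integrableOn_rpow_mul_cexp {s : ℝ} (hs : -1 < s) {z : ℂ} (hz : 0 < z.re) :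
    IntegrableOn (fun x : ℝ => ((x ^ s : ℝ) : ℂ) * Complex.exp (-(z * x))) (Set.Ioi 0) := by
  refine (integrableOn_rpow_mul_exp_neg_mul_Ioi hs hz).mono'
    (Measurable.aestronglyMeasurable (by fun_prop)) ?_
  filter_upwards [ae_restrict_mem measurableSet_Ioi] with x hx
  exact (norm_rpow_mul_cexp hx z).le

theorem differentiableAt_integral_rpow_mul_cexp {s : ℝ} (hs : -1 < s) {z : ℂ} (hz : 0 < z.re) :
    DifferentiableAt ℂ
      (fun z : ℂ => ∫ x in Set.Ioi (0 : ℝ), ((x ^ s : ℝ) : ℂ) * Complex.exp (-(z * x))) z := by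
  have nhds_half_plane : {w : ℂ | z.re / 2 < w.re} ∈ nhds z :=
    (isOpen_lt continuous_const Complex.continuous_re).mem_nhds
      (show z.re / 2 < z.re by linarith)
  refine (hasDerivAt_integral_of_dominated_loc_of_deriv_le
    (μ := volume.restrict (Set.Ioi (0 : ℝ)))
    (F := fun (w : ℂ) (x : ℝ) => ((x ^ s : ℝ) : ℂ) * Complex.exp (-(w * x)))
    (F' := fun (w : ℂ) (x : ℝ) => ((x ^ s : ℝ) : ℂ) * (Complex.exp (-(w * x)) * (-x)))
    (bound := fun x : ℝ => x ^ (s + 1) * Real.exp (-(z.re / 2 * x))) nhds_half_plane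
    (Filter.Eventually.of_forall fun w => Measurable.aestronglyMeasurable (by fun_prop))
    (integrableOn_rpow_mul_cexp hs hz) (Measurable.aestronglyMeasurable (by fun_prop)) ?_
    (integrableOn_rpow_mul_exp_neg_mul_Ioi (by linarith) (by linarith)) ?_).2.differentiableAt
  · filter_upwards [ae_restrict_mem measurableSet_Ioi] with x hx w (hw : z.re / 2 < w.re)
    have x_pos : (0 : ℝ) < x := hx
    rw [← mul_assoc, norm_mul, norm_rpow_mul_cexp hx w, norm_neg, Complex.norm_real,
      Real.norm_of_nonneg x_pos.le, Real.rpow_add_one x_pos.ne']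
    calc x ^ s * Real.exp (-(w.re * x)) * x = x ^ s * x * Real.exp (-(w.re * x)) := by ring
      _ ≤ x ^ s * x * Real.exp (-(z.re / 2 * x)) := by gcongr
  · refine Filter.Eventually.of_forall fun x w _ => ?_
    exact ((hasDerivAt_mul_const (x : ℂ)).neg.cexp).const_mul _

theorem integral_rpow_mul_cexp_ofReal {a : ℝ} (ha : 0 < a) {r : ℝ} (hr : 0 < r) :
    ∫ x in Set.Ioi (0 : ℝ), ((x ^ (a - 1) : ℝ) : ℂ) * Complex.exp (-(r * x)) =
      Real.Gamma a * ((r : ℂ) ^ (a : ℂ))⁻¹ := by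
  have real_laplace := Real.integral_rpow_mul_exp_neg_mul_Ioi ha hr
  rw [one_div, Real.inv_rpow hr.le, mul_comm] at real_laplace
  rw [← Complex.ofReal_cpow hr.le, ← Complex.ofReal_inv, ← Complex.ofReal_mul, ← real_laplace,
    ← integral_complex_ofReal]
  push_cast
  rfl

-- Both sides are holomorphic in the right half-plane and agree on the positive reals.
theorem integral_rpow_mul_cexp {a : ℝ} (ha : 0 < a) {z : ℂ} (hz : 0 < z.re) :
    ∫ x in Set.Ioi (0 : ℝ), ((x ^ (a - 1) : ℝ) : ℂ) * Complex.exp (-(z * x)) =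
      Real.Gamma a * (z ^ (a : ℂ))⁻¹ := by
  have isOpen_half_plane : IsOpen {w : ℂ | 0 < w.re} :=
    isOpen_lt continuous_const Complex.continuous_re
  have analytic_integral : AnalyticOnNhd ℂ (fun z : ℂ =>
      ∫ x in Set.Ioi (0 : ℝ), ((x ^ (a - 1) : ℝ) : ℂ) * Complex.exp (-(z * x)))
      {w : ℂ | 0 < w.re} :=
    DifferentiableOn.analyticOnNhd (fun w hw => (differentiableAt_integral_rpow_mul_cexp
      (by linarith) hw).differentiableWithinAt) isOpen_half_plane
  have analytic_cpow : AnalyticOnNhd ℂ (fun z : ℂ => Real.Gamma a * (z ^ (a : ℂ))⁻¹)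
      {w : ℂ | 0 < w.re} := by
    refine DifferentiableOn.analyticOnNhd (fun w hw => ?_) isOpen_half_plane
    have mem_slitPlane : w ∈ Complex.slitPlane := Or.inl hw
    have cpow_ne_zero : w ^ (a : ℂ) ≠ 0 :=
      (Complex.cpow_ne_zero_iff).2 (Or.inl (Complex.slitPlane_ne_zero mem_slitPlane))
    exact (((differentiableAt_id.cpow_const mem_slitPlane).inv
      cpow_ne_zero).const_mul _).differentiableWithinAt
  have tendsto_one : Filter.Tendsto (fun r : ℝ => (r : ℂ)) (nhdsWithin 1 {1}ᶜ)
      (nhdsWithin 1 {1}ᶜ) := by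
    refine tendsto_nhdsWithin_iff.2 ⟨?_, ?_⟩
    · exact (Complex.continuous_ofReal.tendsto' 1 1 (by simp)).mono_left nhdsWithin_le_nhds
    · filter_upwards [self_mem_nhdsWithin] with r hr
      simpa using hr
  refine analytic_integral.eqOn_of_preconnected_of_frequently_eq analytic_cpow
    (convex_halfSpace_re_gt 0).isPreconnected (z₀ := 1) (by simp)
    (tendsto_one.frequently (Filter.Eventually.frequently ?_)) hz
  filter_upwards [nhdsWithin_le_nhds (lt_mem_nhds (zero_lt_one' ℝ))] with r hr
  exact integral_rpow_mul_cexp_ofReal ha hr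

theorem continuous_thetaFactor : Continuous thetaFactor := by
  have mem_slitPlane (u : ℝ) : 2 * (1 - u * I) ∈ Complex.slitPlane := Or.inl (by simp)
  refine Continuous.inv₀ (continuous_iff_continuousAt.2 fun u => ?_) fun u => ?_
  · exact ContinuousAt.cpow (by fun_prop) continuousAt_const (mem_slitPlane u)
  · rw [Complex.cpow_ne_zero_iff]
    exact Or.inl (Complex.slitPlane_ne_zero (mem_slitPlane u))

theorem norm_thetaFactor_pow_four_le (u : ℝ) : ‖thetaFactor u‖ ^ 4 ≤ (1 + u ^ 2)⁻¹ := by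
  calc ‖thetaFactor u‖ ^ 4 = (‖thetaFactor u‖ ^ 2) ^ 2 := by ring
    _ = (4 * (1 + u ^ 2))⁻¹ := by
      rw [norm_thetaFactor_sq, inv_pow, mul_pow, Real.sq_sqrt (by positivity)]
      norm_num
    _ ≤ (1 + u ^ 2)⁻¹ := by
      gcongr
      nlinarith [sq_nonneg u]

theorem norm_thetaFactor_le_one (u : ℝ) : ‖thetaFactor u‖ ≤ 1 := by
  refine (pow_le_one_iff_of_nonneg (norm_nonneg _) four_ne_zero).1
    ((norm_thetaFactor_pow_four_le u).trans (inv_le_one_of_one_le₀ ?_))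
  nlinarith [sq_nonneg u]

theorem integrable_thetaFactor_pow {d : ℕ} (hd : 4 ≤ d) :
    Integrable fun u : ℝ => thetaFactor u ^ d := by
  refine integrable_inv_one_add_sq.mono' (continuous_thetaFactor.pow d).aestronglyMeasurable
    (Filter.Eventually.of_forall fun u => ?_)
  rw [norm_pow]
  exact (pow_le_pow_of_le_one (norm_nonneg _) (norm_thetaFactor_le_one u) hd).trans
    (norm_thetaFactor_pow_four_le u)

/-- The complex-valued density `x ↦ x ^ (a - 1) e ^ (-2πx)` of a Gamma distribution on `(0, ∞)`, not
normalised. For `a = d / 2` its Fourier transform is essentially `thetaFactor ^ d`. -/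
def gammaDensity (a x : ℝ) : ℂ :=
  (Set.Ioi (0 : ℝ)).indicator
    (fun x => ((x ^ (a - 1) : ℝ) : ℂ) * Complex.exp (-((2 * π : ℝ) * x))) x

theorem integrable_gammaDensity {a : ℝ} (ha : 0 < a) : Integrable (gammaDensity a) := by
  refine (integrable_indicator_iff measurableSet_Ioi).2
    (integrableOn_rpow_mul_cexp (by linarith) ?_)
  rw [Complex.ofReal_re]
  positivity

theorem continuousAt_gammaDensity_one (a : ℝ) : ContinuousAt (gammaDensity a) 1 := by
  have continuousAt_power : ContinuousAt (fun x : ℝ => ((x ^ (a - 1) : ℝ) : ℂ)) 1 :=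
    Complex.continuous_ofReal.continuousAt.comp
      (Real.continuousAt_rpow_const 1 _ (Or.inl one_ne_zero))
  refine (continuousAt_power.mul (by fun_prop :
    ContinuousAt (fun x : ℝ => Complex.exp (-((2 * π : ℝ) * x))) 1)).congr ?_
  filter_upwards [lt_mem_nhds (zero_lt_one' ℝ)] with x hx
  exact (Set.indicator_of_mem (Set.mem_Ioi.2 hx) _).symm

theorem gammaDensity_one (a : ℝ) : gammaDensity a 1 = Real.exp (-(2 * π)) := by
  rw [gammaDensity, Set.indicator_of_mem (Set.mem_Ioi.2 one_pos)]
  simp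

open scoped FourierTransform in
theorem fourier_gammaDensity {d : ℕ} (hd : 0 < d) (w : ℝ) :
    𝓕 (gammaDensity (d / 2)) w =
      (Real.Gamma (d / 2) / π ^ (d / 2 : ℝ) : ℝ) * thetaFactor (-w) ^ d := by
  have re_pos : 0 < (2 * π * (1 - (-w : ℝ) * I) : ℂ).re := by
    simp [Real.pi_pos]
  have laplace := integral_rpow_mul_cexp (a := d / 2) (by positivity) re_pos
  have scale : (2 * π * (1 - (-w : ℝ) * I) : ℂ) = (π : ℝ) * (2 * (1 - (-w : ℝ) * I)) := by ring
  have cpow_eq : ((2 * π * (1 - (-w : ℝ) * I) : ℂ) ^ ((d / 2 : ℝ) : ℂ))⁻¹ =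
      ((π ^ (d / 2 : ℝ) : ℝ) : ℂ)⁻¹ * thetaFactor (-w) ^ d := by
    rw [scale, ofReal_mul_cpow Real.pi_pos, mul_inv, thetaFactor_pow, Complex.ofReal_div,
      Complex.ofReal_natCast, Complex.ofReal_ofNat]
  rw [cpow_eq, ← mul_assoc, ← div_eq_mul_inv, ← Complex.ofReal_div] at laplace
  rw [Real.fourier_eq', ← laplace]
  rw [← integral_indicator measurableSet_Ioi]
  refine integral_congr_ae (Filter.Eventually.of_forall fun x => ?_)
  simp only [gammaDensity, Set.indicator_apply]
  split_ifs
  · rw [smul_eq_mul, mul_left_comm, ← Complex.exp_add]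
    congr 2
    simp only [RCLike.inner_apply, conj_trivial]
    push_cast
    ring
  · simp

/-- The singular integral of the equation `x₁² + ⋯ + x_d² = n` with the Gaussian weight
`exp (-2π |x|² / n)`. -/
def singularIntegral (d : ℕ) : ℝ :=
  π ^ (d / 2 : ℝ) / Real.Gamma (d / 2) * Real.exp (-(2 * π))

theorem singularIntegral_pos {d : ℕ} (hd : 0 < d) : 0 < singularIntegral d := by
  have : 0 < Real.Gamma (d / 2) := Real.Gamma_pos_of_pos (by positivity)
  rw [singularIntegral]
  positivity

open scoped FourierTransform in
theorem integral_thetaFactor_pow {d : ℕ} (hd : 4 ≤ d) :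
    ∫ u : ℝ, Complex.exp (-(2 * π * I * u)) * thetaFactor u ^ d = singularIntegral d := by
  have d_pos : 0 < d := by omega
  set a : ℝ := d / 2
  set K : ℝ := Real.Gamma a / π ^ a with hK
  have K_pos : 0 < K := div_pos (Real.Gamma_pos_of_pos (by positivity)) (by positivity)
  have K_ne_zero : (K : ℂ) ≠ 0 := by exact_mod_cast K_pos.ne'
  have fourier_eq : 𝓕 (gammaDensity a) = fun w => (K : ℂ) * thetaFactor (-w) ^ d :=
    funext (fourier_gammaDensity d_pos)
  have integrable_fourier : Integrable (𝓕 (gammaDensity a)) := by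
    rw [fourier_eq]
    exact ((integrable_thetaFactor_pow hd).comp_neg).const_mul _
  have inversion := (integrable_gammaDensity (by positivity)).fourierInv_fourier_eq
    integrable_fourier (continuousAt_gammaDensity_one a)
  rw [Real.fourierInv_eq', gammaDensity_one] at inversion
  have substitution : ∫ u : ℝ, Complex.exp (-(2 * π * I * u)) * thetaFactor u ^ d =
      (K : ℂ)⁻¹ * ∫ v : ℝ, Complex.exp ((2 * π * inner ℝ v 1 : ℝ) * I) • 𝓕 (gammaDensity a) v := by
    rw [← integral_const_mul, ← integral_neg_eq_self]
    refine integral_congr_ae (Filter.Eventually.of_forall fun v => ?_)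
    simp only [fourier_eq, RCLike.inner_apply, conj_trivial, smul_eq_mul]
    rw [mul_left_comm, inv_mul_cancel_left₀ K_ne_zero, one_mul]
    congr 2
    push_cast
    ring
  rw [substitution, inversion, ← Complex.ofReal_inv, ← Complex.ofReal_mul, singularIntegral, hK,
    inv_div]

/-! ### The circle method for the number of points on a sphere -/

theorem thetaMultiplier_zero (S t : ℝ) : thetaMultiplier S t 0 = ∑' m : ℤ, thetaKernel S t m := by
  simp [thetaMultiplier]

theorem continuous_thetaKernel (S : ℝ) (m : ℤ) : Continuous fun t => thetaKernel S t m := by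
  unfold thetaKernel
  fun_prop

theorem continuous_thetaMultiplier_zero {S : ℝ} (hS : 0 < S) :
    Continuous fun t => thetaMultiplier S t 0 := by
  simp_rw [thetaMultiplier_zero]
  refine continuous_tsum (continuous_thetaKernel S) (summable_norm_thetaKernel hS 0) fun m t => ?_
  rw [norm_thetaKernel, norm_thetaKernel]

theorem thetaKernel_add_one (S t : ℝ) (m : ℤ) : thetaKernel S (t + 1) m = thetaKernel S t m := by
  rw [thetaKernel, thetaKernel]
  congr 1
  rw [Complex.exp_eq_exp_iff_exists_int]
  exact ⟨m ^ 2, by push_cast; ring⟩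

theorem norm_thetaKernelPi_eq {d : ℕ} (S t t' : ℝ) (m : Fin d → ℤ) :
    ‖thetaKernelPi S t m‖ = ‖thetaKernelPi S t' m‖ := by
  simp only [thetaKernelPi, norm_prod, norm_thetaKernel]

theorem tsum_thetaKernelPi (d : ℕ) {S : ℝ} (hS : 0 < S) (t : ℝ) :
    ∑' m : Fin d → ℤ, thetaKernelPi S t m = thetaMultiplier S t 0 ^ d := by
  simp only [thetaKernelPi]
  rw [tsum_prod_fin (f := fun _ => thetaKernel S t) fun _ => summable_norm_thetaKernel hS t,
    Finset.prod_const, Finset.card_univ, Fintype.card_fin, thetaMultiplier_zero]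

/-- The integrand of the circle method for the number of representations of `n` as a sum of `d`
squares. -/
def circleIntegrand (d n : ℕ) (t : ℝ) : ℂ :=
  Complex.exp (-(2 * π * I * n * t)) * thetaMultiplier n t 0 ^ d

theorem continuous_circleIntegrand (d : ℕ) {n : ℕ} (hn : 0 < n) :
    Continuous (circleIntegrand d n) := by
  have := continuous_thetaMultiplier_zero (S := n) (Nat.cast_pos.2 hn)
  unfold circleIntegrand
  fun_prop

theorem norm_circleIntegrand (d n : ℕ) (t : ℝ) :
    ‖circleIntegrand d n t‖ = ‖thetaMultiplier n t 0‖ ^ d := by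
  rw [circleIntegrand, norm_mul, norm_exp_neg_two_pi_I_mul, one_mul, norm_pow]

theorem periodic_circleIntegrand (d n : ℕ) : Function.Periodic (circleIntegrand d n) 1 := by
  intro t
  rw [circleIntegrand, circleIntegrand, thetaMultiplier_zero, thetaMultiplier_zero]
  congr 1
  · rw [Complex.exp_eq_exp_iff_exists_int]
    exact ⟨-n, by push_cast; ring⟩
  · simp_rw [thetaKernel_add_one]

theorem integral_tsum_exp_mul_thetaKernelPi {d : ℕ} {S : ℝ} (hS : 0 < S) (n : ℕ) :
    ∫ t in (0 : ℝ)..1, ∑' m : Fin d → ℤ, Complex.exp (-(2 * π * I * n * t)) * thetaKernelPi S t m =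
      ∑' m : Fin d → ℤ, ∫ t in (0 : ℝ)..1,
        Complex.exp (-(2 * π * I * n * t)) * thetaKernelPi S t m := by
  have continuous_term (m : Fin d → ℤ) :
      Continuous fun t : ℝ => Complex.exp (-(2 * π * I * n * t)) * thetaKernelPi S t m := by
    have := continuous_thetaKernelPi S m
    fun_prop
  have norm_term (m : Fin d → ℤ) (t : ℝ) :
      ‖Complex.exp (-(2 * π * I * n * t)) * thetaKernelPi S t m‖ = ‖thetaKernelPi S 0 m‖ := by
    rw [norm_mul, norm_exp_neg_two_pi_I_mul, one_mul, norm_thetaKernelPi_eq]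
  simp only [intervalIntegral.integral_of_le zero_le_one]
  refine (integral_tsum_of_summable_integral_norm
    (fun m => (continuous_term m).integrableOn_Ioc) ?_).symm
  refine (summable_norm_thetaKernelPi hS 0).congr fun m => ?_
  simp only [norm_term]
  simp

theorem integral_circleIntegrand (d : ℕ) {n : ℕ} (hn : 0 < n) (a : ℝ) :
    ∫ t in a..a + 1, circleIntegrand d n t =
      ((discreteSphereFinset d √n).card * ((√n)⁻¹ ^ d * Real.exp (-(2 * π))) : ℝ) := by
  have hn' : (0 : ℝ) < n := Nat.cast_pos.2 hn
  have sphereFactor_self : sphereFactor d n n = (√n)⁻¹ ^ d * Real.exp (-(2 * π)) := by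
    rw [sphereFactor, mul_div_cancel_right₀ _ hn'.ne']
  rw [(periodic_circleIntegrand d n).intervalIntegral_add_eq a 0, zero_add]
  simp only [circleIntegrand, ← tsum_thetaKernelPi d hn', ← tsum_mul_left]
  rw [integral_tsum_exp_mul_thetaKernelPi hn']
  simp only [integral_exp_mul_thetaKernelPi, sphereFactor_self]
  rw [tsum_eq_sum (s := discreteSphereFinset d √n) fun m hm => if_neg hm,
    Finset.sum_congr rfl fun m hm => if_pos hm, Finset.sum_const, nsmul_eq_mul]
  push_cast
  rfl

/-! ### Minor arcs -/

theorem norm_thetaMultiplier_le {q : ℕ} [NeZero q] {a : ℤ} (ha : IsCoprime a (q : ℤ)) {u S : ℝ}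
    (hS : q ^ 2 * max 1 (u ^ 2) ≤ S) (x : ℝ) :
    ‖thetaMultiplier S (a / q + u / S) x‖ ≤ thetaConst * majorBound q u := by
  have hS' : 0 < S := pos_of_sq_mul_max_le hS
  have hB := majorBound_nonneg q u
  have gaussian_le :=
    norm_gaussian_le_one (re_gaussScale_div_pos hS' q u).le (round (q * x) - q * x)
  calc ‖thetaMultiplier S (a / q + u / S) x‖
      ≤ majorBound q u * 1 + majorBound q u * thetaError S q u := by
        refine (norm_le_norm_add_norm_sub' _ _).trans
          (add_le_add ?_ (norm_thetaMultiplier_sub_majorAmplitude_le ha hS' u x))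
        rw [norm_mul]
        exact mul_le_mul (norm_majorAmplitude_le ha u x) gaussian_le (norm_nonneg _) hB
    _ = (1 + thetaError S q u) * majorBound q u := by ring
    _ ≤ thetaConst * majorBound q u := by
        gcongr
        exact one_add_thetaError_le hS

/-- The points of the arcs that are far from all centres of denominator at most `M`. -/
def farArcs (M : ℕ) : Set (ℚ × ℝ) := {p | M < p.1.den ∨ (M : ℝ) < |p.2|}

theorem measurableSet_farArcs (M : ℕ) : MeasurableSet (farArcs M) := by
  have farArcs_eq : farArcs M =
      {p | (M : ℝ) < p.1.den} ∪ {p : ℚ × ℝ | (M : ℝ) < |p.2|} := by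
    ext p
    simp [farArcs]
  rw [farArcs_eq]
  exact (measurableSet_lt measurable_const measurable_den_fst).union
    (measurableSet_lt measurable_const (by fun_prop))

theorem antitone_farArcs : Antitone farArcs := fun _ _ hMN _ hp =>
  Or.imp hMN.trans_lt (Nat.cast_le.2 hMN).trans_lt hp

theorem iInter_farArcs : ⋂ M, farArcs M = ∅ := by
  refine Set.eq_empty_of_forall_notMem fun p hp => ?_
  rcases Set.mem_iInter.1 hp (max p.1.den ⌈|p.2|⌉₊) with h | h
  · exact (le_max_left _ _).not_gt h
  · exact (Nat.ceil_le.1 (le_max_right _ _)).not_gt h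

/-- The total weight of the arcs far from all centres of denominator at most `M`. -/
def arcTail (M : ℕ) : ℝ≥0∞ :=
  ∫⁻ p in farArcs M, ENNReal.ofReal (arcWeight p.1.den p.2) ∂arcMeasure

theorem arcTail_ne_top (M : ℕ) : arcTail M ≠ ∞ :=
  ne_top_of_le_ne_top lintegral_arcWeight_ne_top (setLIntegral_le_lintegral _ _)

theorem tendsto_arcTail : Filter.Tendsto arcTail Filter.atTop (nhds 0) := by
  have arcTail_eq (M : ℕ) : arcTail M = (arcMeasure.withDensity fun p =>
      ENNReal.ofReal (arcWeight p.1.den p.2)) (farArcs M) :=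
    (withDensity_apply _ (measurableSet_farArcs M)).symm
  have continuity_from_above := tendsto_measure_iInter_atTop
    (fun M => (measurableSet_farArcs M).nullMeasurableSet) antitone_farArcs
    ⟨0, (arcTail_eq 0).symm.trans_ne (arcTail_ne_top 0)⟩
  rw [iInter_farArcs, measure_empty] at continuity_from_above
  exact continuity_from_above.congr fun M => (arcTail_eq M).symm

theorem mem_farArcs_of_forall_lt {n M Q : ℕ} (hn : 0 < n) (hQ : Q ≠ 0)
    (hM : ∀ q : ℕ, 0 < q → q ≤ M → q ∣ Q) {r : ℚ} {u : ℝ}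
    (hru : ∀ b : ℤ, (M : ℝ) / n < |r + u / n - b / Q|) : (r, u) ∈ farArcs M := by
  refine or_iff_not_imp_left.2 fun hden => ?_
  have hn' : (0 : ℝ) < n := Nat.cast_pos.2 hn
  obtain ⟨k, hk⟩ := hM r.den r.den_pos (not_lt.1 hden)
  have hk' : (k : ℝ) ≠ 0 := Nat.cast_ne_zero.2 (right_ne_zero_of_mul (hk ▸ hQ))
  have center_eq : ((r.num * k : ℤ) : ℝ) / Q = r := by
    rw [hk, Rat.cast_def]
    push_cast
    exact mul_div_mul_right _ _ hk'
  have far := hru (r.num * k)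
  rwa [center_eq, add_sub_cancel_left, abs_div, abs_of_pos hn', div_lt_div_iff_of_pos_right hn']
    at far

theorem enorm_circleIntegrand_le {d : ℕ} (hd : 5 ≤ d) {n : ℕ} {r : ℚ} {u : ℝ}
    (hru : (r, u) ∈ arcRegion n) :
    ‖circleIntegrand d n (r + u / n)‖ₑ ≤
      ENNReal.ofReal (thetaConst ^ d) * ENNReal.ofReal (arcWeight r.den u) := by
  have : NeZero r.den := ⟨r.den_nz⟩
  have := one_le_thetaConst
  have norm_le := norm_thetaMultiplier_le r.isCoprime_num_den hru 0
  rw [← Rat.cast_def] at norm_le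
  rw [← ofReal_norm, ← ENNReal.ofReal_mul (by positivity), norm_circleIntegrand]
  refine ENNReal.ofReal_le_ofReal ?_
  calc ‖thetaMultiplier n (r + u / n) 0‖ ^ d ≤ (thetaConst * majorBound r.den u) ^ d := by gcongr
    _ = thetaConst ^ d * majorBound r.den u ^ d := mul_pow _ _ _
    _ ≤ thetaConst ^ d * arcWeight r.den u := by
        gcongr
        exact majorBound_pow_le_arcWeight hd r.den u

theorem lintegral_minorArcs_le {d : ℕ} (hd : 5 ≤ d) {n M Q : ℕ} (hn : 0 < n) (hQ : Q ≠ 0)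
    (hM : ∀ q : ℕ, 0 < q → q ≤ M → q ∣ Q) {V : Set ℝ} (hV : MeasurableSet V)
    (hV1 : V ⊆ Set.Icc (-1) 1) (hVQ : ∀ t ∈ V, ∀ b : ℤ, (M : ℝ) / n < |t - b / Q|) :
    ENNReal.ofReal n * ∫⁻ t in V, ‖circleIntegrand d n t‖ₑ ≤
      ENNReal.ofReal (thetaConst ^ d) * arcTail M := by
  set φ : ℝ → ℝ≥0∞ := V.indicator fun t => ‖circleIntegrand d n t‖ₑ
  have φ_measurable : Measurable φ :=
    (continuous_circleIntegrand d hn).measurable.enorm.indicator hV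
  have φ_le {p : ℚ × ℝ} (hp : p ∈ arcRegion n) : φ (p.1 + p.2 / n) ≤
      (farArcs M).indicator
        (fun p => ENNReal.ofReal (thetaConst ^ d) * ENNReal.ofReal (arcWeight p.1.den p.2)) p := by
    by_cases ht : (p.1 + p.2 / n : ℝ) ∈ V
    · rw [Set.indicator_of_mem (mem_farArcs_of_forall_lt hn hQ hM (hVQ _ ht))]
      exact (Set.indicator_of_mem ht _).trans_le (enorm_circleIntegrand_le hd hp)
    · exact (Set.indicator_of_notMem ht _).trans_le zero_le
  calc ENNReal.ofReal n * ∫⁻ t in V, ‖circleIntegrand d n t‖ₑ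
      = ENNReal.ofReal n * ∫⁻ t in Set.Icc (-1) 1, φ t := by
        rw [setLIntegral_indicator hV, Set.inter_eq_left.2 hV1]
    _ ≤ ∫⁻ p in arcRegion n, φ (p.1 + p.2 / n) ∂arcMeasure :=
        lintegral_le_setLIntegral_arcRegion (Nat.one_le_cast.2 hn) φ_measurable
    _ ≤ ∫⁻ p, (farArcs M).indicator (fun p => ENNReal.ofReal (thetaConst ^ d) *
          ENNReal.ofReal (arcWeight p.1.den p.2)) p ∂arcMeasure :=
        (setLIntegral_mono' (measurableSet_arcRegion n) fun _ hp => φ_le hp).trans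
          (setLIntegral_le_lintegral _ _)
    _ = ENNReal.ofReal (thetaConst ^ d) * arcTail M := by
        rw [lintegral_indicator (measurableSet_farArcs M),
          lintegral_const_mul' _ _ ENNReal.ofReal_ne_top, arcTail]

/-! ### Major arcs -/

theorem thetaError_le {S : ℝ} (hS : 0 < S) (q : ℕ) [NeZero q] {u v : ℝ} (huv : |u| ≤ v) :
    thetaError S q u ≤ thetaError 1 q v / S := by
  have hq : (0 : ℝ) < q := Nat.cast_pos.2 (NeZero.pos q)
  have := intInvSqSum_nonneg
  calc thetaError S q u = 8 * q ^ 2 * (1 + |u| ^ 2) / (π * S) * intInvSqSum := by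
        rw [thetaError, gaussScale, sq_abs]
        field_simp
        ring
    _ ≤ 8 * q ^ 2 * (1 + v ^ 2) / (π * S) * intInvSqSum := by gcongr
    _ = thetaError 1 q v / S := by
        rw [thetaError, gaussScale]
        field_simp
        ring

theorem norm_thetaMultiplier_sub_quadGaussSum_le {S : ℝ} (hS : 0 < S) (q : ℕ) [NeZero q] (a : ℤ)
    (u : ℝ) :
    ‖thetaMultiplier S (a / q + u / S) 0 - thetaFactor u * (quadGaussSum q a 0 / q)‖ ≤
      thetaError S q u := by
  have hq : (q : ℝ) ≠ 0 := NeZero.ne _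
  have expansion := norm_thetaMultiplier_sub_le hS a u 0 (norm_quadGaussSum_le (a : ZMod q))
  simp only [mul_zero, round_zero, Int.cast_zero, Complex.ofReal_zero, sub_self, ne_eq,
    OfNat.ofNat_ne_zero, not_false_eq_true, zero_pow, Complex.exp_zero, mul_one] at expansion
  rw [← mul_comm_div]
  refine expansion.trans ?_
  calc ‖thetaFactor u‖ / q * (q * (4 / (gaussScale S q / (1 + u ^ 2))) * intInvSqSum)
      = ‖thetaFactor u‖ * thetaError S q u := by
        rw [thetaError]
        field_simp
    _ ≤ thetaError S q u :=
        mul_le_of_le_one_left (thetaError_nonneg hS.le q u) (norm_thetaFactor_le_one u)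

theorem norm_pow_sub_pow_le {α β : ℂ} {ε : ℝ} (hβ : ‖β‖ ≤ 1) (hαβ : ‖α - β‖ ≤ ε) (d : ℕ) :
    ‖α ^ d - β ^ d‖ ≤ d * (1 + ε) ^ d * ε := by
  have hε : 0 ≤ ε := (norm_nonneg _).trans hαβ
  have norm_le : ‖α‖ ≤ 1 + ε := (norm_le_norm_add_norm_sub' α β).trans (add_le_add hβ hαβ)
  simpa using norm_prod_sub_prod_le (d := d) (a := fun _ => α) (b := fun _ => β) (by positivity)
    (fun _ => norm_le) (fun _ => hβ.trans (by linarith))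
    fun _ => hαβ.trans (le_mul_of_one_le_left hε (by linarith))

theorem exp_neg_two_pi_I_mul_rat_add {Q n : ℕ} [NeZero Q] (hn : 0 < n) (b : ℤ) (u : ℝ) :
    Complex.exp (-(2 * π * I * n * (b / Q + u / n : ℝ))) =
      ZMod.stdAddChar (-((b : ZMod Q) * (n : ZMod Q))) * Complex.exp (-(2 * π * I * u)) := by
  have cast_eq : -((b : ZMod Q) * (n : ZMod Q)) = ((-(b * n) : ℤ) : ZMod Q) := by push_cast; ring
  rw [cast_eq, ZMod.stdAddChar_coe, ← Complex.exp_add]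
  congr 1
  have : (n : ℂ) ≠ 0 := Nat.cast_ne_zero.2 hn.ne'
  push_cast
  field_simp
  ring

/-- The arithmetic factor `e(-bn / Q) (G(b, 0) / Q)^d` of the circle integrand near `b / Q`. -/
def arithmeticFactor (d n : ℕ) {Q : ℕ} [NeZero Q] (b : ZMod Q) : ℂ :=
  ZMod.stdAddChar (-(b * (n : ZMod Q))) * (quadGaussSum Q b 0 / Q) ^ d

/-- The constant in the approximation of the circle integrand at distance at most `M / n` from the
rationals of denominator `Q`. -/
def majorArcConst (d M Q : ℕ) : ℝ := d * (1 + thetaError 1 Q M) ^ d * thetaError 1 Q M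

theorem norm_circleIntegrand_sub_le (d : ℕ) {n M Q : ℕ} [NeZero Q] (hn : 0 < n) (b : ℤ) {u : ℝ}
    (hu : |u| ≤ M) :
    ‖circleIntegrand d n (b / Q + u / n) - arithmeticFactor d n (b : ZMod Q) *
        (Complex.exp (-(2 * π * I * u)) * thetaFactor u ^ d)‖ ≤ majorArcConst d M Q / n := by
  have hQ : (0 : ℝ) < Q := Nat.cast_pos.2 (NeZero.pos Q)
  have hn' : (0 : ℝ) < n := Nat.cast_pos.2 hn
  set E := thetaError 1 Q M
  have hE : 0 ≤ E := thetaError_nonneg zero_le_one Q M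
  set α := thetaMultiplier n (b / Q + u / n) 0
  set β := thetaFactor u * (quadGaussSum Q b 0 / Q)
  have norm_β_le : ‖β‖ ≤ 1 := by
    rw [norm_mul, norm_div, Complex.norm_natCast]
    exact mul_le_one₀ (norm_thetaFactor_le_one u) (by positivity)
      (div_le_one_of_le₀ (norm_quadGaussSum_le _ 0) hQ.le)
  have norm_sub_le : ‖α - β‖ ≤ E / n :=
    (norm_thetaMultiplier_sub_quadGaussSum_le hn' Q b u).trans (thetaError_le hn' Q hu)
  have factor_out : circleIntegrand d n (b / Q + u / n) - arithmeticFactor d n (b : ZMod Q) *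
      (Complex.exp (-(2 * π * I * u)) * thetaFactor u ^ d) =
      Complex.exp (-(2 * π * I * n * (b / Q + u / n : ℝ))) * (α ^ d - β ^ d) := by
    rw [circleIntegrand, arithmeticFactor, mul_sub, exp_neg_two_pi_I_mul_rat_add hn, mul_pow]
    ring
  rw [factor_out, norm_mul, norm_exp_neg_two_pi_I_mul, one_mul]
  calc ‖α ^ d - β ^ d‖
      ≤ d * (1 + E / n) ^ d * (E / n) := norm_pow_sub_pow_le norm_β_le norm_sub_le d
    _ ≤ d * (1 + E) ^ d * (E / n) := by
        gcongr
        exact div_le_self hE (Nat.one_le_cast.2 hn)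
    _ = majorArcConst d M Q / n := (mul_div_assoc _ _ _).symm

/-- The singular integral truncated at height `M`. -/
def truncatedIntegral (d M : ℕ) : ℂ :=
  ∫ u in -(M : ℝ)..M, Complex.exp (-(2 * π * I * u)) * thetaFactor u ^ d

theorem tendsto_truncatedIntegral {d : ℕ} (hd : 4 ≤ d) :
    Filter.Tendsto (truncatedIntegral d) Filter.atTop (nhds (singularIntegral d)) := by
  rw [← integral_thetaFactor_pow hd]
  refine intervalIntegral_tendsto_integral ?_
    (Filter.tendsto_neg_atTop_atBot.comp tendsto_natCast_atTop_atTop) tendsto_natCast_atTop_atTop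
  refine (integrable_thetaFactor_pow hd).bdd_mul (c := 1)
    (Continuous.aestronglyMeasurable (by fun_prop)) (Filter.Eventually.of_forall fun u => ?_)
  simpa using (norm_exp_neg_two_pi_I_mul 1 u).le

theorem norm_integral_majorArc_sub_le (d : ℕ) {n Q : ℕ} [NeZero Q] (hn : 0 < n) (M : ℕ) (b : ℤ) :
    ‖n * (∫ t in (b / Q - M / n : ℝ)..(b / Q + M / n), circleIntegrand d n t) -
      arithmeticFactor d n (b : ZMod Q) * truncatedIntegral d M‖ ≤
      majorArcConst d M Q / n * (2 * M) := by
  have hn' : (n : ℝ) ≠ 0 := Nat.cast_ne_zero.2 hn.ne'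
  have := continuous_circleIntegrand d hn
  have := continuous_thetaFactor
  have rescale : (n : ℂ) * (∫ t in (b / Q - M / n : ℝ)..(b / Q + M / n), circleIntegrand d n t) =
      ∫ u in -(M : ℝ)..M, circleIntegrand d n (b / Q + u / n) := by
    rw [intervalIntegral.integral_comp_add_div _ hn', neg_div, ← sub_eq_add_neg, Complex.real_smul,
      Complex.ofReal_natCast]
  rw [rescale, truncatedIntegral, ← intervalIntegral.integral_const_mul,
    ← intervalIntegral.integral_sub (Continuous.intervalIntegrable (by fun_prop) _ _)
      (Continuous.intervalIntegrable (by fun_prop) _ _)]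
  refine (intervalIntegral.norm_integral_le_of_norm_le_const fun u hu =>
    norm_circleIntegrand_sub_le d (M := M) hn b ?_).trans_eq ?_
  · rw [Set.uIoc_of_le (neg_le_self (Nat.cast_nonneg M))] at hu
    exact abs_le.2 ⟨hu.1.le, hu.2⟩
  · rw [sub_neg_eq_add, ← two_mul, abs_of_nonneg (by positivity)]

theorem norm_sum_integral_majorArc_sub_le (d : ℕ) {n : ℕ} (hn : 0 < n) (M Q : ℕ) [NeZero Q] :
    ‖n * (∑ b ∈ Finset.range Q,
        ∫ t in (b / Q - M / n : ℝ)..(b / Q + M / n), circleIntegrand d n t) -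
      localDensity d Q n * truncatedIntegral d M‖ ≤ Q * (majorArcConst d M Q * (2 * M)) / n := by
  have density_eq : (localDensity d Q n : ℂ) =
      ∑ b ∈ Finset.range Q, arithmeticFactor d n (b : ZMod Q) :=
    (localDensity_eq_sum d Q n).trans (sum_zmod_eq_sum_range Q (arithmeticFactor d n))
  rw [density_eq, Finset.mul_sum, Finset.sum_mul, ← Finset.sum_sub_distrib]
  refine (norm_sum_le_of_le (n := fun _ => majorArcConst d M Q / n * (2 * M)) _
    fun b _ => ?_).trans_eq ?_
  · simpa only [Int.cast_natCast] using norm_integral_majorArc_sub_le d (Q := Q) hn M b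
  · rw [Finset.sum_const, Finset.card_range, nsmul_eq_mul]
    ring

/-! ### Splitting the circle -/

/-- The arc of radius `x` around `b / Q`. -/
def majorArc (Q : ℕ) (x : ℝ) (b : ℕ) : Set ℝ := Set.Icc (b / Q - x) (b / Q + x)

/-- The union of the arcs of radius `x` around the fractions `b / Q` in `[0, 1)`. -/
def majorArcs (Q : ℕ) (x : ℝ) : Set ℝ := ⋃ b ∈ Finset.range Q, majorArc Q x b

/-- A fundamental domain of the circle `ℝ / ℤ`, shifted so that it contains the short arcs around
the fractions `b / Q` in `[0, 1)`. -/
def circleWindow (Q : ℕ) : Set ℝ := Set.Ioc (-(1 / (2 * Q))) (-(1 / (2 * Q)) + 1)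

section Splitting

variable {Q : ℕ} [NeZero Q] {x t : ℝ}

theorem abs_sub_div_le_iff (c : ℝ) : |t - c / Q| ≤ x ↔ |Q * t - c| ≤ Q * x := by
  have hQ : (0 : ℝ) < Q := Nat.cast_pos.2 (NeZero.pos Q)
  have factor : Q * t - c = Q * (t - c / Q) := by field_simp
  rw [factor, abs_mul, abs_of_pos hQ, mul_le_mul_iff_right₀ hQ]

theorem mem_majorArc {b : ℕ} : t ∈ majorArc Q x b ↔ |Q * t - b| ≤ Q * x := by
  rw [← abs_sub_div_le_iff, majorArc, Set.mem_Icc, abs_le]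
  constructor <;> rintro ⟨_, _⟩ <;> constructor <;> linarith

theorem mem_circleWindow : t ∈ circleWindow Q ↔ -(1 / 2) < Q * t ∧ Q * t ≤ Q - 1 / 2 := by
  have hQ : (0 : ℝ) < Q := Nat.cast_pos.2 (NeZero.pos Q)
  have left_eq : (-(1 / (2 * Q)) : ℝ) = -(1 / 2) / Q := by field_simp
  have right_eq : (-(1 / 2) / Q + 1 : ℝ) = (Q - 1 / 2) / Q := by field_simp; ring
  rw [circleWindow, Set.mem_Ioc, left_eq, right_eq, div_lt_iff₀ hQ, le_div_iff₀ hQ, mul_comm t]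

theorem circleWindow_subset_Icc : circleWindow Q ⊆ Set.Icc (-1) 1 := by
  have one_le : (1 : ℝ) ≤ Q := Nat.one_le_cast.2 (NeZero.pos Q)
  intro t ht
  have ⟨left, right⟩ := mem_circleWindow.1 ht
  constructor <;> by_contra! <;> nlinarith

theorem majorArcs_subset_circleWindow (hx : Q * x < 1 / 2) : majorArcs Q x ⊆ circleWindow Q := by
  refine Set.iUnion₂_subset fun b hb t ht => ?_
  have b_add_one_le : (b : ℝ) + 1 ≤ Q := by exact_mod_cast Finset.mem_range.1 hb
  have : (0 : ℝ) ≤ b := Nat.cast_nonneg b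
  have ⟨left, right⟩ := abs_le.1 (mem_majorArc.1 ht)
  exact mem_circleWindow.2 ⟨by linarith, by linarith⟩

theorem pairwise_disjoint_majorArc (hx : Q * x < 1 / 2) :
    Pairwise (Function.onFun Disjoint (majorArc Q x)) := by
  refine (pairwise_disjoint_on _).2 fun b c hbc => Set.disjoint_left.2 fun t hb hc => ?_
  have b_add_one_le : (b : ℝ) + 1 ≤ c := by exact_mod_cast hbc
  have ⟨_, _⟩ := abs_le.1 (mem_majorArc.1 hb)
  have ⟨_, _⟩ := abs_le.1 (mem_majorArc.1 hc)
  linarith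

theorem measurableSet_majorArc (Q : ℕ) (x : ℝ) (b : ℕ) : MeasurableSet (majorArc Q x b) :=
  measurableSet_Icc

theorem measurableSet_majorArcs (Q : ℕ) (x : ℝ) : MeasurableSet (majorArcs Q x) :=
  Finset.measurableSet_biUnion _ fun b _ => measurableSet_majorArc Q x b

theorem lt_abs_sub_of_mem_circleWindow (hx : Q * x < 1 / 2) (ht : t ∈ circleWindow Q)
    (ht' : t ∉ majorArcs Q x) (b : ℤ) : x < |t - b / Q| := by
  by_contra! h
  rw [abs_sub_div_le_iff] at h
  have ⟨_, _⟩ := mem_circleWindow.1 ht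
  have ⟨_, _⟩ := abs_le.1 h
  have neg_one_lt : (-1 : ℝ) < b := by linarith
  have b_nonneg : 0 ≤ b := Int.lt_iff_add_one_le.1 (by exact_mod_cast neg_one_lt)
  have b_lt : (b : ℝ) < Q := by linarith
  lift b to ℕ using b_nonneg
  rw [Int.cast_natCast] at h b_lt
  exact ht' (Set.mem_iUnion₂.2 ⟨b, Finset.mem_range.2 (Nat.cast_lt.1 b_lt), mem_majorArc.2 h⟩)

theorem setIntegral_majorArcs {F : ℝ → ℂ} (hF : Continuous F) (hx0 : 0 ≤ x)
    (hx : Q * x < 1 / 2) :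
    ∫ t in majorArcs Q x, F t = ∑ b ∈ Finset.range Q, ∫ t in (b / Q - x)..(b / Q + x), F t := by
  have integrableOn (b : ℕ) : IntegrableOn F (majorArc Q x b) := hF.integrableOn_Icc
  rw [majorArcs, integral_biUnion_finset _ (fun b _ => measurableSet_majorArc Q x b)
    ((pairwise_disjoint_majorArc hx).set_pairwise _) fun b _ => integrableOn b]
  refine Finset.sum_congr rfl fun b _ => ?_
  rw [majorArc, intervalIntegral.integral_of_le (by linarith), integral_Icc_eq_integral_Ioc]

theorem integral_circleWindow_eq_add {F : ℝ → ℂ} (hF : Continuous F) (hx : Q * x < 1 / 2) :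
    ∫ t in (-(1 / (2 * Q)) : ℝ)..-(1 / (2 * Q)) + 1, F t =
      (∫ t in majorArcs Q x, F t) + ∫ t in circleWindow Q \ majorArcs Q x, F t := by
  have integrableOn : IntegrableOn F (circleWindow Q) := hF.integrableOn_Ioc
  rw [intervalIntegral.integral_of_le (by linarith), ← circleWindow,
    ← integral_inter_add_sdiff (measurableSet_majorArcs Q x) integrableOn,
    Set.inter_eq_right.2 (majorArcs_subset_circleWindow hx)]

end Splitting

theorem norm_integral_minorArcs_le {d : ℕ} (hd : 5 ≤ d) {n M Q : ℕ} [NeZero Q] (hn : 0 < n)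
    (hM : ∀ q : ℕ, 0 < q → q ≤ M → q ∣ Q) (hMn : Q * ((M : ℝ) / n) < 1 / 2) :
    ‖n * ∫ t in circleWindow Q \ majorArcs Q (M / n), circleIntegrand d n t‖ ≤
      thetaConst ^ d * (arcTail M).toReal := by
  have := one_le_thetaConst
  have minor_le := lintegral_minorArcs_le hd hn (NeZero.ne Q) hM
    (measurableSet_Ioc.diff (measurableSet_majorArcs Q (M / n)))
    (Set.sdiff_subset.trans circleWindow_subset_Icc)
    fun t ht => lt_abs_sub_of_mem_circleWindow hMn ht.1 ht.2
  have enorm_le : ‖n * ∫ t in circleWindow Q \ majorArcs Q (M / n), circleIntegrand d n t‖ₑ ≤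
      ENNReal.ofReal (thetaConst ^ d) * arcTail M := by
    refine le_trans ?_ minor_le
    rw [enorm_mul, ← ofReal_norm (n : ℂ), Complex.norm_natCast]
    gcongr
    exact enorm_integral_le_lintegral_enorm _
  rw [← toReal_enorm]
  refine (ENNReal.toReal_mono (ENNReal.mul_ne_top ENNReal.ofReal_ne_top (arcTail_ne_top M))
    enorm_le).trans_eq ?_
  rw [ENNReal.toReal_mul, ENNReal.toReal_ofReal (by positivity)]

/-! ### The number of lattice points on a sphere -/

theorem exists_truncation_error_lt {d : ℕ} (hd : 5 ≤ d) {ε : ℝ} (hε : 0 < ε) :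
    ∃ M : ℕ, ‖truncatedIntegral d M - singularIntegral d‖ < ε ∧
      thetaConst ^ d * (arcTail M).toReal < ε := by
  have central : ∀ᶠ M in Filter.atTop, ‖truncatedIntegral d M - singularIntegral d‖ < ε := by
    simpa only [Metric.mem_ball, dist_eq_norm] using
      (tendsto_truncatedIntegral (by lia)).eventually (Metric.ball_mem_nhds _ hε)
  have tail_tendsto := ((ENNReal.tendsto_toReal ENNReal.zero_ne_top).comp
    tendsto_arcTail).const_mul (thetaConst ^ d)
  rw [ENNReal.toReal_zero, mul_zero] at tail_tendsto
  exact (central.and (tail_tendsto.eventually_lt_const hε)).exists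

theorem norm_integral_circleIntegrand_sub_le {d : ℕ} (hd : 5 ≤ d) {n M Q : ℕ} [NeZero Q]
    (hn : 0 < n) (hM : ∀ q : ℕ, 0 < q → q ≤ M → q ∣ Q) (hMn : Q * ((M : ℝ) / n) < 1 / 2) :
    ‖((n * ((discreteSphereFinset d √n).card * ((√n)⁻¹ ^ d * Real.exp (-(2 * π)))) : ℝ) : ℂ) -
        localDensity d Q n * truncatedIntegral d M‖ ≤
      thetaConst ^ d * (arcTail M).toReal + Q * (majorArcConst d M Q * (2 * M)) / n := by
  have continuous_integrand := continuous_circleIntegrand d hn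
  have split := integral_circleWindow_eq_add continuous_integrand hMn
  rw [integral_circleIntegrand d hn,
    setIntegral_majorArcs continuous_integrand (by positivity) hMn] at split
  rw [Complex.ofReal_mul, Complex.ofReal_natCast, split, mul_add, add_comm, add_sub_assoc]
  exact norm_add_le_of_le (norm_integral_minorArcs_le hd hn hM hMn)
    (norm_sum_integral_majorArc_sub_le d hn M Q)

theorem eventually_singularIntegral_le {d : ℕ} (hd : 5 ≤ d) :
    ∀ᶠ n : ℕ in Filter.atTop, singularIntegral d / 32 ≤
      n * ((discreteSphereFinset d √n).card * ((√n)⁻¹ ^ d * Real.exp (-(2 * π)))) := by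
  have J_pos := singularIntegral_pos (d := d) (by lia)
  set J := singularIntegral d
  obtain ⟨M, central_lt, tail_lt⟩ := exists_truncation_error_lt hd (by positivity : 0 < J / 128)
  set Q := M.factorial
  have : NeZero Q := ⟨M.factorial_ne_zero⟩
  have major_lt : ∀ᶠ n : ℕ in Filter.atTop,
      Q * (majorArcConst d M Q * (2 * M)) / (n : ℝ) < J / 128 :=
    (tendsto_const_div_atTop_nhds_zero_nat _).eventually_lt_const (by positivity)
  have arcs_short : ∀ᶠ n : ℕ in Filter.atTop, Q * (M : ℝ) / (n : ℝ) < 1 / 2 :=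
    (tendsto_const_div_atTop_nhds_zero_nat _).eventually_lt_const (by positivity)
  filter_upwards [major_lt, arcs_short, Filter.eventually_gt_atTop 0] with n major_lt short n_pos
  have circle_le := norm_integral_circleIntegrand_sub_le hd (Q := Q) n_pos
    (fun q hq hqM => Nat.dvd_factorial hq hqM) ((mul_div_assoc _ _ _).symm.trans_lt short)
  have density_ge := localDensity_lower_bound hd Q n
  set L := localDensity d Q n
  set X : ℝ := n * ((discreteSphereFinset d √n).card * ((√n)⁻¹ ^ d * Real.exp (-(2 * π))))
  have central_le : ‖(L : ℂ) * (truncatedIntegral d M - J)‖ ≤ L * (J / 128) := by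
    rw [norm_mul, Complex.norm_real, Real.norm_of_nonneg (by linarith)]
    gcongr
  have total_le : ‖((X - L * J : ℝ) : ℂ)‖ ≤ J / 128 + J / 128 + L * (J / 128) := by
    have telescope : ((X - L * J : ℝ) : ℂ) =
        (X - L * truncatedIntegral d M) + L * (truncatedIntegral d M - J) := by
      push_cast
      ring
    rw [telescope]
    exact norm_add_le_of_le (circle_le.trans (add_le_add tail_lt.le major_lt.le)) central_le
  rw [Complex.norm_real, Real.norm_eq_abs] at total_le
  have := (abs_le.1 total_le).1
  nlinarith

theorem exists_eventually_le_card_discreteSphereFinset {d : ℕ} (hd : 5 ≤ d) :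
    ∃ c : ℝ, 0 < c ∧ ∀ᶠ n : ℕ in Filter.atTop,
      c * √n ^ d ≤ n * (discreteSphereFinset d √n).card := by
  have J_pos := singularIntegral_pos (d := d) (by lia)
  refine ⟨singularIntegral d / 32 * Real.exp (2 * π), by positivity, ?_⟩
  filter_upwards [eventually_singularIntegral_le hd, Filter.eventually_gt_atTop 0] with n hJ hn
  have : 0 < √(n : ℝ) := Real.sqrt_pos.2 (Nat.cast_pos.2 hn)
  calc singularIntegral d / 32 * Real.exp (2 * π) * √n ^ d
      ≤ n * ((discreteSphereFinset d √n).card * ((√n)⁻¹ ^ d * Real.exp (-(2 * π)))) *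
          Real.exp (2 * π) * √n ^ d := by gcongr
    _ = n * (discreteSphereFinset d √n).card := by
        rw [Real.exp_neg, inv_pow]
        field_simp

theorem exists_le_card_discreteSphereFinset {d : ℕ} (hd : 5 ≤ d) :
    ∃ c : ℝ, 0 < c ∧ ∀ n : ℕ, 0 < n → (discreteSphereFinset d √n).card ≠ 0 →
      c * √n ^ d ≤ n * (discreteSphereFinset d √n).card := by
  obtain ⟨c, hc, large⟩ := exists_eventually_le_card_discreteSphereFinset hd
  obtain ⟨n₀, hn₀⟩ := Filter.eventually_atTop.1 large
  refine ⟨min c (√n₀ ^ d + 1)⁻¹, lt_min hc (by positivity), fun n hn hcard => ?_⟩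
  obtain n₀_le | n_lt := le_or_gt n₀ n
  · exact (mul_le_mul_of_nonneg_right (min_le_left _ _) (by positivity)).trans (hn₀ n n₀_le)
  have pow_le : √(n : ℝ) ^ d ≤ √n₀ ^ d + 1 := by
    have : √(n : ℝ) ^ d ≤ √n₀ ^ d := by gcongr
    linarith
  calc min c (√n₀ ^ d + 1)⁻¹ * √n ^ d
      ≤ (√n₀ ^ d + 1)⁻¹ * (√n₀ ^ d + 1) := by
        gcongr
        exact min_le_right _ _
    _ = 1 := inv_mul_cancel₀ (by positivity)
    _ ≤ n * (discreteSphereFinset d √n).card := by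
        exact_mod_cast Nat.mul_pos hn (Nat.pos_of_ne_zero hcard)

/-! ### Functions of finite support -/

theorem ofReal_abs_sphericalAverage {d : ℕ} (lam : ℝ) (f : (Fin d → ℤ) → ℝ) (x : Fin d → ℤ) :
    ENNReal.ofReal |sphericalAverage lam f x| =
      ENNReal.ofReal ((discreteSphereFinset d lam).card : ℝ)⁻¹ *
        ‖∑ m ∈ discreteSphereFinset d lam, (f (x - m) : ℂ)‖ₑ := by
  rw [sphericalAverage, abs_mul, abs_of_nonneg (by positivity),
    ENNReal.ofReal_mul (by positivity), ← Complex.ofReal_sum, ← ofReal_norm, Complex.norm_real,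
    Real.norm_eq_abs]

theorem discreteSphereFinset_zero (d : ℕ) : discreteSphereFinset d 0 = {0} := by
  ext m
  have mem_iff := mem_discreteSphereFinset (n := 0) m
  rw [Nat.cast_zero, Real.sqrt_zero, Nat.cast_zero,
    Finset.sum_eq_zero_iff_of_nonneg fun i _ => sq_nonneg _] at mem_iff
  simp [mem_iff, funext_iff]

theorem sphericalAverage_zero {d : ℕ} (f : (Fin d → ℤ) → ℝ) (x : Fin d → ℤ) :
    sphericalAverage 0 f x = f x := by
  simp [sphericalAverage, discreteSphereFinset_zero]

theorem inv_mul_inv_mul_exp_mul_sqrt_pow_le {c n N S : ℝ} {d : ℕ} (hc : 0 < c) (hN : 0 < N)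
    (hS : 0 < S) (hSn : S ≤ n) (hnS : n ≤ 4 * S) (hcN : c * √n ^ d ≤ n * N) (a : ℝ) :
    N⁻¹ * S⁻¹ * (Real.exp a * √S ^ d) ≤ 4 * Real.exp a / c := by
  have volume_le : c * √S ^ d ≤ 4 * S * N :=
    calc c * √S ^ d ≤ c * √n ^ d := by gcongr
      _ ≤ n * N := hcN
      _ ≤ 4 * S * N := by gcongr
  calc N⁻¹ * S⁻¹ * (Real.exp a * √S ^ d)
      = Real.exp a / (N * S * c) * (c * √S ^ d) := by field_simp
    _ ≤ Real.exp a / (N * S * c) * (4 * S * N) := by gcongr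
    _ = 4 * Real.exp a / c := by field_simp

theorem exists_sphericalAverage_le {d : ℕ} (hd : 5 ≤ d) :
    ∃ C : ℝ≥0, ∀ (s : Finset (Fin d → ℤ)) (f : (Fin d → ℤ) → ℝ), (∀ n ∉ s, f n = 0) →
      ∀ n : ℕ, 0 < n → ∀ x, ENNReal.ofReal |sphericalAverage √n f x| ≤
        C * circleMaximal (fun y => (f y : ℂ)) x := by
  obtain ⟨c, hc, card_ge⟩ := exists_le_card_discreteSphereFinset hd
  refine ⟨(4 * Real.exp (8 * π) / c).toNNReal, fun s f hf n hn x => ?_⟩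
  rw [ofReal_abs_sphericalAverage]
  set N := (discreteSphereFinset d √n).card
  obtain hN | hN := eq_or_ne N 0
  · simp [hN]
  have N_pos : (0 : ℝ) < N := Nat.cast_pos.2 (Nat.pos_of_ne_zero hN)
  set j := Nat.log 4 n
  have scale_le : (4 : ℝ) ^ j ≤ n := by exact_mod_cast Nat.pow_log_le_self 4 hn.ne'
  have lt_scale : n < 4 ^ (j + 1) := Nat.lt_pow_succ_log_self (by norm_num) n
  have le_scale : (n : ℝ) ≤ 4 * 4 ^ j := by
    rw [← pow_succ']
    exact_mod_cast lt_scale.le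
  set S : ℝ := 4 ^ j
  have S_pos : 0 < S := by positivity
  set σ := ‖∑ m ∈ discreteSphereFinset d √n, (f (x - m) : ℂ)‖ₑ
  have sum_le : σ * ENNReal.ofReal S ≤
      ENNReal.ofReal (Real.exp (8 * π) * √S ^ d) * circleMaximal (fun y => (f y : ℂ)) x :=
    enorm_sum_sphere_le (f := fun y => (f y : ℂ)) (s := s)
      (fun y hy => by rw [hf y hy, Complex.ofReal_zero]) lt_scale.le x
  calc ENNReal.ofReal (N : ℝ)⁻¹ * σ
      = ENNReal.ofReal ((N : ℝ)⁻¹ * S⁻¹) * (σ * ENNReal.ofReal S) := by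
        rw [mul_comm σ, ← mul_assoc, ← ENNReal.ofReal_mul (by positivity),
          inv_mul_cancel_right₀ S_pos.ne']
    _ ≤ ENNReal.ofReal ((N : ℝ)⁻¹ * S⁻¹) * (ENNReal.ofReal (Real.exp (8 * π) * √S ^ d) *
          circleMaximal (fun y => (f y : ℂ)) x) := by gcongr
    _ = ENNReal.ofReal ((N : ℝ)⁻¹ * S⁻¹ * (Real.exp (8 * π) * √S ^ d)) *
          circleMaximal (fun y => (f y : ℂ)) x := by
        rw [← mul_assoc, ← ENNReal.ofReal_mul (by positivity)]
    _ ≤ ENNReal.ofReal (4 * Real.exp (8 * π) / c) * circleMaximal (fun y => (f y : ℂ)) x := by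
        gcongr
        exact inv_mul_inv_mul_exp_mul_sqrt_pow_le hc N_pos S_pos scale_le le_scale
          (card_ge n hn hN) _

theorem exists_eq_sqrt_of_mem_admissibleRadii {lam : ℝ} (h : lam ∈ admissibleRadii) :
    ∃ k : ℕ, lam = √k := by
  obtain ⟨nonneg, k, hk⟩ := h
  exact ⟨k, by rw [← hk, Real.sqrt_sq nonneg]⟩

theorem exists_sphericalMaximal_le {d : ℕ} (hd : 5 ≤ d) :
    ∃ C : ℝ≥0, ∀ (s : Finset (Fin d → ℤ)) (f : (Fin d → ℤ) → ℝ), (∀ n ∉ s, f n = 0) →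
      ∀ x, sphericalMaximal f x ≤ ‖f x‖ₑ + C * circleMaximal (fun y => (f y : ℂ)) x := by
  obtain ⟨C, average_le⟩ := exists_sphericalAverage_le hd
  refine ⟨C, fun s f hf x => iSup₂_le fun lam hlam => ?_⟩
  obtain ⟨k, rfl⟩ := exists_eq_sqrt_of_mem_admissibleRadii hlam
  obtain rfl | hk := Nat.eq_zero_or_pos k
  · rw [Nat.cast_zero, Real.sqrt_zero, sphericalAverage_zero, ← Real.norm_eq_abs, ofReal_norm]
    exact le_self_add
  · exact (average_le s f hf k hk x).trans le_add_self

theorem exists_tsum_circleMaximal_sq_le {d : ℕ} (hd : 5 ≤ d) :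
    ∃ C : ℝ≥0, ∀ (s : Finset (Fin d → ℤ)) (f : (Fin d → ℤ) → ℂ), (∀ n ∉ s, f n = 0) →
      ∑' x, circleMaximal f x ^ 2 ≤ C * ∑' x, ‖f x‖ₑ ^ 2 := by
  lift ∫⁻ p, ENNReal.ofReal (arcWeight p.1.den p.2) ∂arcMeasure to ℝ≥0
    using lintegral_arcWeight_ne_top with w hw
  refine ⟨arcConst d * w ^ 2, fun s f hf => ?_⟩
  simpa only [← hw, ENNReal.coe_mul, ENNReal.coe_pow] using tsum_circleMaximal_sq_le hd hf

theorem exists_tsum_sphericalMaximal_sq_le_of_finite_support {d : ℕ} (hd : 5 ≤ d) :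
    ∃ C : ℝ≥0, ∀ (s : Finset (Fin d → ℤ)) (f : (Fin d → ℤ) → ℝ), (∀ n ∉ s, f n = 0) →
      ∑' x, sphericalMaximal f x ^ 2 ≤ C * ∑' x, ‖f x‖ₑ ^ 2 := by
  obtain ⟨C₁, pointwise_le⟩ := exists_sphericalMaximal_le hd
  obtain ⟨C₂, circle_le⟩ := exists_tsum_circleMaximal_sq_le hd
  refine ⟨2 * (1 + C₁ ^ 2 * C₂), fun s f hf => ?_⟩
  set g : (Fin d → ℤ) → ℂ := fun y => (f y : ℂ)
  have enorm_g (x) : ‖g x‖ₑ = ‖f x‖ₑ := by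
    rw [← ofReal_norm, ← ofReal_norm, Complex.norm_real]
  have circle_le_f := circle_le s g fun y hy => Complex.ofReal_eq_zero.2 (hf y hy)
  simp_rw [enorm_g] at circle_le_f
  calc ∑' x, sphericalMaximal f x ^ 2
      ≤ ∑' x, 2 * (‖f x‖ₑ ^ 2 + C₁ ^ 2 * circleMaximal g x ^ 2) := by
        refine ENNReal.tsum_le_tsum fun x => ?_
        rw [← mul_pow]
        exact (pow_le_pow_left' (pointwise_le s f hf x) 2).trans (ennreal_add_sq_le _ _)
    _ = 2 * (∑' x, ‖f x‖ₑ ^ 2 + C₁ ^ 2 * ∑' x, circleMaximal g x ^ 2) := by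
        rw [ENNReal.tsum_mul_left, ENNReal.tsum_add, ENNReal.tsum_mul_left]
    _ ≤ 2 * (∑' x, ‖f x‖ₑ ^ 2 + C₁ ^ 2 * (C₂ * ∑' x, ‖f x‖ₑ ^ 2)) := by gcongr
    _ = (2 * (1 + C₁ ^ 2 * C₂) : ℝ≥0) * ∑' x, ‖f x‖ₑ ^ 2 := by
        push_cast
        ring

/-! ### Passing to general functions -/

theorem abs_sphericalAverage_le_of_abs_le {d : ℕ} {lam : ℝ} {f g : (Fin d → ℤ) → ℝ}
    {x : Fin d → ℤ} (h : ∀ m ∈ discreteSphereFinset d lam, |f (x - m)| ≤ g (x - m)) :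
    |sphericalAverage lam f x| ≤ |sphericalAverage lam g x| := by
  rw [sphericalAverage, sphericalAverage, abs_mul, abs_mul]
  refine mul_le_mul_of_nonneg_left ?_ (abs_nonneg _)
  exact (Finset.abs_sum_le_sum_abs _ _).trans ((Finset.sum_le_sum h).trans (le_abs_self _))

/-- The cube `[-k, k] ^ d` of lattice points. -/
def latticeBox (d k : ℕ) : Finset (Fin d → ℤ) :=
  Finset.Icc (fun _ => -(k : ℤ)) fun _ => (k : ℤ)

theorem mem_latticeBox {d k : ℕ} {x : Fin d → ℤ} : x ∈ latticeBox d k ↔ ∀ i, |x i| ≤ k := by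
  simp only [latticeBox, Finset.mem_Icc, Pi.le_def, abs_le, forall_and]

/-- The restriction of `|f|` to the box `[-k, k] ^ d`, extended by zero. -/
def boxTruncation {d : ℕ} (f : (Fin d → ℤ) → ℝ) (k : ℕ) (x : Fin d → ℤ) : ℝ :=
  if x ∈ latticeBox d k then |f x| else 0

section BoxTruncation

variable {d : ℕ} (f : (Fin d → ℤ) → ℝ)

theorem enorm_boxTruncation_le (k : ℕ) (x : Fin d → ℤ) : ‖boxTruncation f k x‖ₑ ≤ ‖f x‖ₑ := by
  rw [boxTruncation]
  split_ifs
  · rw [← Real.norm_eq_abs, enorm_norm]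
  · rw [enorm_zero]
    exact zero_le

theorem abs_boxTruncation_le {k l : ℕ} (hkl : k ≤ l) (x : Fin d → ℤ) :
    |boxTruncation f k x| ≤ boxTruncation f l x := by
  by_cases mem_small : x ∈ latticeBox d k
  · have mem_large : x ∈ latticeBox d l :=
      mem_latticeBox.2 fun i => (mem_latticeBox.1 mem_small i).trans (Nat.cast_le.2 hkl)
    rw [boxTruncation, boxTruncation, if_pos mem_small, if_pos mem_large, abs_abs]
  · rw [boxTruncation, boxTruncation, if_neg mem_small, abs_zero]
    split_ifs
    exacts [abs_nonneg _, le_rfl]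

theorem monotone_sphericalMaximal_boxTruncation :
    Monotone fun k => sphericalMaximal (boxTruncation f k) := fun _ _ hkl _ =>
  iSup₂_mono fun _ _ => ENNReal.ofReal_le_ofReal <|
    abs_sphericalAverage_le_of_abs_le fun _ _ => abs_boxTruncation_le f hkl _

theorem sphericalMaximal_le_iSup (x : Fin d → ℤ) :
    sphericalMaximal f x ≤ ⨆ k, sphericalMaximal (boxTruncation f k) x := by
  refine iSup₂_le fun lam hlam => ?_
  set k := (discreteSphereFinset d lam).sup fun m => ∑ i, ((x - m) i).natAbs
  refine le_iSup_of_le k (le_iSup₂_of_le lam hlam (ENNReal.ofReal_le_ofReal ?_))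
  refine abs_sphericalAverage_le_of_abs_le fun m hm => ?_
  have mem_box : x - m ∈ latticeBox d k := by
    refine mem_latticeBox.2 fun i => ?_
    rw [Int.abs_eq_natAbs, Nat.cast_le]
    exact (Finset.single_le_sum (f := fun i => ((x - m) i).natAbs) (fun _ _ => Nat.zero_le _)
      (Finset.mem_univ i)).trans (Finset.le_sup (f := fun m => ∑ i, ((x - m) i).natAbs) hm)
  rw [boxTruncation, if_pos mem_box]

theorem tsum_sphericalMaximal_sq_le_iSup :
    ∑' x, sphericalMaximal f x ^ 2 ≤ ⨆ k, ∑' x, sphericalMaximal (boxTruncation f k) x ^ 2 := by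
  calc ∑' x, sphericalMaximal f x ^ 2
      ≤ ∑' x, ⨆ k, sphericalMaximal (boxTruncation f k) x ^ 2 := by
        refine ENNReal.tsum_le_tsum fun x => ?_
        rw [← ENNReal.iSup_pow]
        exact pow_le_pow_left' (sphericalMaximal_le_iSup f x) 2
    _ = ⨆ k, ∑' x, sphericalMaximal (boxTruncation f k) x ^ 2 := by
        simp_rw [← lintegral_count]
        refine lintegral_iSup (fun k => measurable_of_countable _) fun k l hkl x => ?_
        exact pow_le_pow_left' (monotone_sphericalMaximal_boxTruncation f hkl x) 2

end BoxTruncation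

theorem exists_tsum_sphericalMaximal_sq_le {d : ℕ} (hd : 5 ≤ d) :
    ∃ C : ℝ≥0, ∀ f : (Fin d → ℤ) → ℝ,
      ∑' x, sphericalMaximal f x ^ 2 ≤ C * ∑' x, ‖f x‖ₑ ^ 2 := by
  obtain ⟨C, truncated_le⟩ := exists_tsum_sphericalMaximal_sq_le_of_finite_support hd
  refine ⟨C, fun f => (tsum_sphericalMaximal_sq_le_iSup f).trans (iSup_le fun k => ?_)⟩
  refine (truncated_le _ (boxTruncation f k) fun x hx => if_neg hx).trans ?_
  gcongr with x
  exact enorm_boxTruncation_le f k x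

theorem eLpNorm_two_count_sq {α ε : Type*} [MeasurableSpace α] [MeasurableSingletonClass α]
    [ENorm ε] (f : α → ε) : eLpNorm f 2 Measure.count ^ 2 = ∑' x, ‖f x‖ₑ ^ 2 := by
  simpa [lintegral_count] using
    eLpNorm_nnreal_pow_eq_lintegral (f := f) (μ := Measure.count) (p := 2) two_ne_zero

end

theorem theorem1 (d : ℕ) (hd : 5 ≤ d) :
    ∃ C : ℝ≥0, ∀ f : (Fin d → ℤ) → ℝ,
      eLpNorm (sphericalMaximal f) 2 Measure.count ≤ C * eLpNorm f 2 Measure.count := by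
  obtain ⟨C, hC⟩ := exists_tsum_sphericalMaximal_sq_le hd
  refine ⟨NNReal.sqrt C, fun f => ?_⟩
  rw [← ENNReal.pow_le_pow_left_iff two_ne_zero, mul_pow, ← ENNReal.coe_pow, NNReal.sq_sqrt,
    eLpNorm_two_count_sq, eLpNorm_two_count_sq]
  simpa only [enorm_eq_self] using hC f
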